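/- Let $\mathbb{D}\subset\mathbb{C}$ be the open unit disk, $m$ Lebesgue measure, and for $t>-1$ let $d\lambda_t(z)=\frac{t+1}{\pi}(1-|z|^2)^t\,dm(z)$ on $\mathbb{D}$. Let $L^2_{a,t}(\mathbb{D})$ be the weighted Bergman space of holomorphic functions in $L^2(\mathbb{D},\lambda_t)$, $P^{(t)}$ the orthogonal projection of $L^2(\mathbb{D},\lambda_t)$ onto it, and $T^{(t)}_fh=P^{(t)}(fh)$, $h\in L^2_{a,t}(\mathbb{D})$, the Toeplitz operator with bounded symbol $f$. For $z,w\in\mathbb{D}$ put $\varphi_z(w)=\frac{z-w}{1-\bar z w}$, and for $0<s<1$ put $$\rho_t(s)=\frac{t+1}{16\pi^2}\int_s^1(1-x)^t x^{-1}F(s,x)\,dx,\qquad F(s,x)=-\Big[x\ln\frac{s}{x}+(1-x)\ln\frac{1-s}{1-x}\Big].$$ **Theorem.** Let $f,g:\overline{\mathbb{D}}\to\mathbb{C}$ be of class $\mathscr{C}^2$ on the closed disk (in the real sense). For every $t>-1$ the function $\rho_t$ is strictly positive on $(0,1)$, the operator $T^{(t)}_fT^{(t)}_g-T^{(t)}_{fg}$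 on $L^2_{a,t}(\mathbb{D})$ is of trace class, the integrals below converge absolutely, and $$\mathrm{Tr}\Big(T^{(t)}_fT^{(t)}_g-T^{(t)}_{fg}\Big)=\frac{1}{2\pi i}\int_{\mathbb{D}}\partial f\wedge\bar\partial g+\int_{\mathbb{D}^2}\rho_t(|\varphi_z(w)|^2)\,\Delta f(z)\,\Delta g(w)\,dm(z)\,dm(w),$$ where $\Delta=\partial_x^2+\partial_y^2$. Moreover, as $t\to\infty$ the second term on the right tends to $0$, that is, $$\lim_{t\to\infty}\mathrm{Tr}\Big(T^{(t)}_fT^{(t)}_g-T^{(t)}_{fg}\Big)=\frac{1}{2\pi i}\int_{\mathbb{D}}\partial f\wedge\bar\partial g .$$ -/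

import Mathlib

open MeasureTheory Set Filter Topology

theorem setIntegral_ball_of_differentiableOn {f : ℂ → ℂ} {z : ℂ} {r : ℝ} (hr : 0 < r)
    (hf : DifferentiableOn ℂ f (Metric.closedBall z r)) :
    ∫ w in Metric.ball z r, f w = (Real.pi * r ^ 2 : ℝ) * f z := by
  have hcirc : ∀ ρ ∈ Ioo 0 r, ∫ θ in Ioo (-Real.pi) Real.pi, f (circleMap z ρ θ)
      = (2 * Real.pi : ℝ) * f z := by
    intro ρ hρ
    have h1 : Real.circleAverage f z ρ = f z := by
      apply DiffContOnCl.circleAverage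
      rw [abs_of_pos hρ.1]
      exact (hf.mono (Metric.closedBall_subset_closedBall hρ.2.le)).diffContOnCl_ball subset_rfl
    rw [Real.circleAverage_def] at h1
    have h2 : Function.Periodic (fun θ => f (circleMap z ρ θ)) (2 * Real.pi) :=
      (periodic_circleMap z ρ).comp f
    have h3 := h2.intervalIntegral_add_eq (-Real.pi) 0
    rw [← integral_Ioc_eq_integral_Ioo, ← intervalIntegral.integral_of_le (by linarith [Real.pi_pos])]
    have h4 : -Real.pi + 2 * Real.pi = Real.pi := by ring
    rw [h4, zero_add] at h3
    rw [h3, ← h1]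
    rw [Complex.real_smul]
    push_cast
    have : (Real.pi : ℂ) ≠ 0 := by exact_mod_cast Real.pi_ne_zero
    field_simp
  have hpt : ∀ p : ℝ × ℝ, z + Complex.polarCoord.symm p = circleMap z p.1 p.2 := by
    intro p
    rw [Complex.polarCoord_symm_apply, circleMap, Complex.exp_mul_I]
    push_cast
    rfl
  rw [← integral_indicator Metric.isOpen_ball.measurableSet,
    ← integral_add_left_eq_self _ z, ← Complex.integral_comp_polarCoord_symm,
    polarCoord_target]
  have hsub : Ioo 0 r ×ˢ Ioo (-Real.pi) Real.pi ⊆ Ioi (0 : ℝ) ×ˢ Ioo (-Real.pi) Real.pi :=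
    prod_mono (fun x hx => hx.1) subset_rfl
  rw [setIntegral_eq_of_subset_of_forall_sdiff_eq_zero
    (measurableSet_Ioi.prod measurableSet_Ioo) hsub]
  · have hcongr : ∀ p ∈ Ioo 0 r ×ˢ Ioo (-Real.pi) Real.pi,
        p.1 • (Metric.ball z r).indicator f (z + Complex.polarCoord.symm p)
          = (p.1 : ℂ) * f (circleMap z p.1 p.2) := by
      rintro ⟨ρ, θ⟩ ⟨hρ, -⟩
      have hρ' : 0 < ρ ∧ ρ < r := hρ
      rw [hpt, indicator_of_mem, Complex.real_smul]
      rw [Metric.mem_ball, dist_eq_norm]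
      simp [circleMap, abs_of_pos hρ'.1, hρ'.2]
    rw [setIntegral_congr_fun (measurableSet_Ioo.prod measurableSet_Ioo) hcongr]
    rw [Measure.volume_eq_prod, setIntegral_prod]
    · have : ∀ ρ ∈ Ioo 0 r, ∫ θ in Ioo (-Real.pi) Real.pi, (ρ : ℂ) * f (circleMap z ρ θ)
          = ((ρ * (2 * Real.pi) : ℝ) : ℂ) * f z := by
        intro ρ hρ
        rw [integral_const_mul, hcirc ρ hρ]
        push_cast
        ring
      rw [setIntegral_congr_fun measurableSet_Ioo this, integral_mul_const, integral_complex_ofReal]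
      congr 2
      rw [← integral_Ioc_eq_integral_Ioo, ← intervalIntegral.integral_of_le hr.le,
        intervalIntegral.integral_mul_const, integral_id]
      ring
    · have hc : ContinuousOn (fun p : ℝ × ℝ => (p.1 : ℂ) * f (circleMap z p.1 p.2))
          (Icc 0 r ×ˢ Icc (-Real.pi) Real.pi) := by
        apply ContinuousOn.mul (by fun_prop)
        apply hf.continuousOn.comp
        · unfold circleMap; fun_prop
        · rintro ⟨ρ, θ⟩ ⟨hρ, -⟩
          have hρ' : 0 ≤ ρ ∧ ρ ≤ r := hρ
          exact Metric.closedBall_subset_closedBall hρ'.2 (circleMap_mem_closedBall z hρ'.1 θ)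
      rw [← Measure.volume_eq_prod]
      exact (hc.integrableOn_compact (isCompact_Icc.prod isCompact_Icc)).mono_set
        (prod_mono Ioo_subset_Icc_self Ioo_subset_Icc_self)
  · rintro ⟨ρ, θ⟩ ⟨⟨hρ, hθ⟩, hn⟩
    have hρ' : 0 < ρ := hρ
    have hle : r ≤ ρ := by
      by_contra h
      exact hn ⟨⟨hρ', not_le.mp h⟩, hθ⟩
    rw [hpt, indicator_of_notMem, smul_zero]
    rw [Metric.mem_ball, dist_eq_norm]
    simp [circleMap, abs_of_pos hρ', hle]

/-- The measure `dλ_t = (t + 1)/π (1 - |z|²)^t dm` on the open unit disk (a probability measure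
for `t > -1`), as a measure on `ℂ` carried by the disk. -/
noncomputable def bergmanMeasure (t : ℝ) : Measure ℂ :=
  (volume.restrict (Metric.ball (0 : ℂ) 1)).withDensity
    fun z => ENNReal.ofReal ((t + 1) / Real.pi * (1 - ‖z‖ ^ 2) ^ t)

/-- The weighted Bergman space `L²_{a,t}`: the elements of `L²(λ_t)` represented by a
holomorphic function on the open unit disk. -/
noncomputable def bergmanSpace (t : ℝ) : Submodule ℂ (Lp ℂ 2 (bergmanMeasure t)) where
  carrier := {u | ∃ h : ℂ → ℂ, DifferentiableOn ℂ h (Metric.ball 0 1) ∧ u =ᵐ[bergmanMeasure t] h}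
  add_mem' := by
    rintro u v ⟨h, hh, hu⟩ ⟨k, hk, hv⟩
    exact ⟨h + k, hh.add hk, (Lp.coeFn_add u v).trans (hu.add hv)⟩
  zero_mem' := ⟨0, differentiableOn_const 0, Lp.coeFn_zero ℂ 2 _⟩
  smul_mem' := by
    rintro c u ⟨h, hh, hu⟩
    exact ⟨c • h, hh.const_smul c, (Lp.coeFn_smul c u).trans (hu.const_smul c)⟩

theorem exists_restrict_le_smul_bergmanMeasure {t R : ℝ} (ht : -1 < t) (hR : R < 1) :
    ∃ C : ENNReal, C ≠ ⊤ ∧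
      volume.restrict (Metric.closedBall (0 : ℂ) R) ≤ C • bergmanMeasure t := by
  set d : ℂ → ℝ := fun z => (t + 1) / Real.pi * (1 - ‖z‖ ^ 2) ^ t with hd
  have hpos : ∀ z ∈ Metric.closedBall (0 : ℂ) R, 0 < 1 - ‖z‖ ^ 2 := by
    intro z hz
    have h1 : ‖z‖ ≤ R := by simpa using hz
    nlinarith [norm_nonneg z]
  have hdpos : ∀ z ∈ Metric.closedBall (0 : ℂ) R, 0 < d z := by
    intro z hz
    exact mul_pos (div_pos (by linarith) Real.pi_pos) (Real.rpow_pos_of_pos (hpos z hz) t)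
  have hcont : ContinuousOn d (Metric.closedBall (0 : ℂ) R) := by
    apply continuousOn_const.mul
    apply ContinuousOn.rpow_const (by fun_prop)
    intro z hz
    exact Or.inl (hpos z hz).ne'
  obtain ⟨c, hc, hcd⟩ : ∃ c : ℝ, 0 < c ∧ ∀ z ∈ Metric.closedBall (0 : ℂ) R, c ≤ d z := by
    rcases (Metric.closedBall (0 : ℂ) R).eq_empty_or_nonempty with he | hne
    · exact ⟨1, one_pos, by simp [he]⟩
    · obtain ⟨x, hx, hmin⟩ := (isCompact_closedBall (0 : ℂ) R).exists_isMinOn hne hcont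
      exact ⟨d x, hdpos x hx, fun z hz => hmin hz⟩
  refine ⟨(ENNReal.ofReal c)⁻¹, ?_, ?_⟩
  · simpa using hc
  have hsub : Metric.closedBall (0 : ℂ) R ⊆ Metric.ball 0 1 := Metric.closedBall_subset_ball hR
  have hc0 : ENNReal.ofReal c ≠ 0 := by simpa using hc
  have h1 : ENNReal.ofReal c • volume.restrict (Metric.closedBall (0 : ℂ) R)
      ≤ bergmanMeasure t := by
    rw [bergmanMeasure]
    calc ENNReal.ofReal c • volume.restrict (Metric.closedBall (0 : ℂ) R)
        = (volume.restrict (Metric.closedBall (0 : ℂ) R)).withDensity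
            (fun _ => ENNReal.ofReal c) := (withDensity_const _).symm
      _ ≤ (volume.restrict (Metric.closedBall (0 : ℂ) R)).withDensity
            (fun z => ENNReal.ofReal (d z)) := by
          apply withDensity_mono
          filter_upwards [ae_restrict_mem Metric.isClosed_closedBall.measurableSet] with z hz
          exact ENNReal.ofReal_le_ofReal (hcd z hz)
      _ ≤ _ := by
          rw [← withDensity_indicator Metric.isClosed_closedBall.measurableSet,
            ← withDensity_indicator Metric.isOpen_ball.measurableSet]
          apply withDensity_mono
          exact Eventually.of_forall
            (fun z => indicator_le_indicator_of_subset hsub (fun _ => bot_le) z)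
  calc volume.restrict (Metric.closedBall (0 : ℂ) R)
      = (ENNReal.ofReal c)⁻¹ • (ENNReal.ofReal c •
          volume.restrict (Metric.closedBall (0 : ℂ) R)) := by
        rw [smul_smul, ENNReal.inv_mul_cancel hc0 ENNReal.ofReal_ne_top, one_smul]
    _ ≤ _ := by gcongr

/-- Point evaluations are bounded in the norm of `L²(λ_t)`, uniformly on compact subsets. -/
theorem exists_norm_le_of_differentiableOn {t R : ℝ} (ht : -1 < t) (hR : R < 1) :
    ∃ C : ℝ, 0 ≤ C ∧ ∀ (u : Lp ℂ 2 (bergmanMeasure t)) (h : ℂ → ℂ),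
      DifferentiableOn ℂ h (Metric.ball 0 1) → u =ᵐ[bergmanMeasure t] h →
        ∀ z ∈ Metric.closedBall (0 : ℂ) R, ‖h z‖ ≤ C * ‖u‖ := by
  obtain ⟨r, hr, hr1⟩ : ∃ r : ℝ, 0 < r ∧ R + r < 1 := ⟨(1 - R) / 2, by linarith, by linarith⟩
  obtain ⟨C, hC, hle⟩ := exists_restrict_le_smul_bergmanMeasure ht hr1
  set ν := volume.restrict (Metric.closedBall (0 : ℂ) (R + r)) with hν
  have hνfin : IsFiniteMeasure ν := ⟨by
    rw [hν, Measure.restrict_apply_univ]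
    exact measure_closedBall_lt_top⟩
  set D : ENNReal := C ^ (1 / (2 : ENNReal)).toReal *
    ν univ ^ (1 / (1 : ENNReal).toReal - 1 / (2 : ENNReal).toReal) with hD
  have hDtop : D ≠ ⊤ := by
    apply ENNReal.mul_ne_top
    · exact ENNReal.rpow_ne_top_of_nonneg (by positivity) hC
    · exact ENNReal.rpow_ne_top_of_nonneg (by norm_num) (measure_ne_top _ _)
  refine ⟨(Real.pi * r ^ 2)⁻¹ * D.toReal, by positivity, ?_⟩
  intro u h hh hu z hz
  have hzn : ‖z‖ ≤ R := by simpa using hz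
  have hsub : Metric.closedBall z r ⊆ Metric.closedBall (0 : ℂ) (R + r) := by
    apply Metric.closedBall_subset_closedBall'
    rw [dist_zero_right]
    linarith
  have hsub1 : Metric.closedBall (0 : ℂ) (R + r) ⊆ Metric.ball 0 1 :=
    Metric.closedBall_subset_ball hr1
  have hmv := setIntegral_ball_of_differentiableOn hr (hh.mono (hsub.trans hsub1))
  have hcont : ContinuousOn h (Metric.closedBall (0 : ℂ) (R + r)) := hh.continuousOn.mono hsub1
  have hint : IntegrableOn h (Metric.closedBall (0 : ℂ) (R + r)) :=
    hcont.integrableOn_compact (isCompact_closedBall _ _)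
  have h1 : ‖∫ w in Metric.ball z r, h w‖ ≤ (eLpNorm h 1 ν).toReal := by
    refine (norm_integral_le_integral_norm _).trans ?_
    rw [eLpNorm_one_eq_lintegral_enorm, ← integral_norm_eq_lintegral_enorm hint.1]
    exact setIntegral_mono_set hint.norm (Eventually.of_forall fun _ => norm_nonneg _)
      (Metric.ball_subset_closedBall.trans hsub).eventuallyLE
  have h2 : eLpNorm h 1 ν ≤ D * eLpNorm u 2 (bergmanMeasure t) := by
    calc eLpNorm h 1 ν ≤ eLpNorm h 2 ν *
          ν univ ^ (1 / (1 : ENNReal).toReal - 1 / (2 : ENNReal).toReal) :=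
          eLpNorm_le_eLpNorm_mul_rpow_measure_univ (by norm_num) hint.1
      _ ≤ eLpNorm h 2 (C • bergmanMeasure t) *
          ν univ ^ (1 / (1 : ENNReal).toReal - 1 / (2 : ENNReal).toReal) := by
          gcongr
      _ = D * eLpNorm u 2 (bergmanMeasure t) := by
          rw [eLpNorm_smul_measure_of_ne_top (by norm_num), ← eLpNorm_congr_ae hu, hD, smul_eq_mul]
          ac_rfl
  have h3 : (eLpNorm h 1 ν).toReal ≤ D.toReal * ‖u‖ := by
    rw [Lp.norm_def, ← ENNReal.toReal_mul]
    exact ENNReal.toReal_mono (ENNReal.mul_ne_top hDtop (Lp.eLpNorm_ne_top u)) h2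
  have hpr : 0 < Real.pi * r ^ 2 := by positivity
  rw [hmv, norm_mul, Complex.norm_real, Real.norm_of_nonneg hpr.le] at h1
  rw [mul_assoc, inv_mul_eq_div, le_div_iff₀ hpr]
  linarith

theorem isClosed_bergmanSpace (t : ℝ) :
    IsClosed (bergmanSpace t : Set (Lp ℂ 2 (bergmanMeasure t))) := by
  rcases le_or_gt t (-1) with ht | ht
  · have h0 : bergmanMeasure t = 0 := by
      rw [bergmanMeasure]
      have : (fun z : ℂ => ENNReal.ofReal ((t + 1) / Real.pi * (1 - ‖z‖ ^ 2) ^ t))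
          =ᵐ[volume.restrict (Metric.ball (0 : ℂ) 1)] 0 := by
        filter_upwards [ae_restrict_mem Metric.isOpen_ball.measurableSet] with z hz
        have hz1 : ‖z‖ < 1 := by simpa using hz
        apply ENNReal.ofReal_of_nonpos
        apply mul_nonpos_of_nonpos_of_nonneg
        · exact div_nonpos_of_nonpos_of_nonneg (by linarith) Real.pi_pos.le
        · apply Real.rpow_nonneg
          nlinarith [norm_nonneg z]
      rw [withDensity_congr_ae this, withDensity_zero]
    have : (bergmanSpace t : Set (Lp ℂ 2 (bergmanMeasure t))) = univ := by
      apply eq_univ_of_forall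
      intro u
      refine ⟨0, differentiableOn_const 0, ?_⟩
      have hbot : ae (bergmanMeasure t) = ⊥ := ae_eq_bot.mpr h0
      rw [Filter.EventuallyEq, hbot]
      exact eventually_bot
    rw [this]
    exact isClosed_univ
  apply IsSeqClosed.isClosed
  intro u v hu huv
  choose h hh hae using hu
  have hcauchy := huv.cauchySeq
  have hunif : ∀ R < 1, UniformCauchySeqOn h atTop (Metric.closedBall (0 : ℂ) R) := by
    intro R hR
    obtain ⟨C, hC0, hC⟩ := exists_norm_le_of_differentiableOn ht hR
    rw [Metric.uniformCauchySeqOn_iff]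
    intro ε hε
    obtain ⟨N, hN⟩ := Metric.cauchySeq_iff.mp hcauchy (ε / (C + 1)) (by positivity)
    refine ⟨N, fun m hm n hn z hz => ?_⟩
    have h1 := hC (u m - u n) (h m - h n) ((hh m).sub (hh n))
      ((Lp.coeFn_sub _ _).trans ((hae m).sub (hae n))) z hz
    have h2 := hN m hm n hn
    rw [dist_eq_norm] at h2 ⊢
    calc ‖h m z - h n z‖ ≤ C * ‖u m - u n‖ := h1
      _ ≤ (C + 1) * ‖u m - u n‖ := by gcongr; linarith
      _ < (C + 1) * (ε / (C + 1)) := by gcongr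
      _ = ε := by field_simp
  have hlim : ∀ z ∈ Metric.ball (0 : ℂ) 1, ∃ l, Tendsto (fun n => h n z) atTop (𝓝 l) := by
    intro z hz
    exact cauchySeq_tendsto_of_complete
      ((hunif ‖z‖ (by simpa using hz)).cauchySeq (by simp))
  choose! l hl using hlim
  have hloc : TendstoLocallyUniformlyOn h l atTop (Metric.ball (0 : ℂ) 1) := by
    rw [tendstoLocallyUniformlyOn_iff_forall_isCompact Metric.isOpen_ball]
    intro K hK hKc
    obtain ⟨R, hR, hKR⟩ : ∃ R < 1, K ⊆ Metric.closedBall (0 : ℂ) R := by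
      rcases K.eq_empty_or_nonempty with rfl | hne
      · exact ⟨0, one_pos, by simp⟩
      · obtain ⟨x, hx, hmax⟩ := hKc.exists_isMaxOn hne (continuous_norm.continuousOn)
        refine ⟨‖x‖, by simpa using hK hx, fun y hy => ?_⟩
        simpa using hmax hy
    exact ((hunif R hR).tendstoUniformlyOn_of_tendsto
      (fun z hz => hl z (Metric.closedBall_subset_ball hR hz))).mono hKR
  refine ⟨l, hloc.differentiableOn (Eventually.of_forall hh) Metric.isOpen_ball, ?_⟩
  obtain ⟨ns, hns, hsub⟩ := (tendstoInMeasure_of_tendsto_Lp huv).exists_seq_tendsto_ae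
  have hball : ∀ᵐ z ∂bergmanMeasure t, z ∈ Metric.ball (0 : ℂ) 1 :=
    (withDensity_absolutelyContinuous _ _).ae_le (ae_restrict_mem Metric.isOpen_ball.measurableSet)
  filter_upwards [hsub, hball, ae_all_iff.mpr hae] with z hz hzb hzn
  have h1 : Tendsto (fun i => h (ns i) z) atTop (𝓝 (v z)) := by
    simpa only [hzn] using hz
  exact tendsto_nhds_unique h1 ((hl z hzb).comp hns.tendsto_atTop)

instance instCompleteSpaceBergmanSpace (t : ℝ) : CompleteSpace (bergmanSpace t) :=
  (isClosed_bergmanSpace t).completeSpace_coe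


/-- A function continuous on the closed disk is an essentially bounded symbol. -/
theorem memLp_top_bergmanMeasure (t : ℝ) {f : ℂ → ℂ}
    (hf : ContinuousOn f (Metric.closedBall 0 1)) : MemLp f ⊤ (bergmanMeasure t) := by
  have hac : bergmanMeasure t ≪ volume.restrict (Metric.ball (0 : ℂ) 1) :=
    withDensity_absolutelyContinuous _ _
  obtain ⟨C, hC⟩ := (isCompact_closedBall (0 : ℂ) 1).exists_bound_of_continuousOn hf
  refine memLp_top_of_bound
    (((hf.mono Metric.ball_subset_closedBall).aestronglyMeasurable
      Metric.isOpen_ball.measurableSet).mono_ac hac) C ?_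
  filter_upwards [hac.ae_le (ae_restrict_mem Metric.isOpen_ball.measurableSet)] with z hz
  exact hC z (Metric.ball_subset_closedBall hz)

/-- The multiplication operator `M_φ u = φ u` on `L²(λ_t)`, for `φ ∈ L^∞(λ_t)`. -/
noncomputable def bergmanMul (t : ℝ) (φ : Lp ℂ ⊤ (bergmanMeasure t)) :
    Lp ℂ 2 (bergmanMeasure t) →L[ℂ] Lp ℂ 2 (bergmanMeasure t) :=
  (ContinuousLinearMap.mul ℂ ℂ).holderL (bergmanMeasure t) ⊤ 2 2 φ

open Classical in
/-- The Toeplitz operator `T_f = P M_f |_{L²_{a,t}}` on the weighted Bergman space, where `P` is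
the orthogonal projection of `L²(λ_t)` onto `L²_{a,t}`, for an essentially bounded symbol `f`
(for other `f` the value `0` is a convention). -/
noncomputable def toeplitz (t : ℝ) (f : ℂ → ℂ) : bergmanSpace t →L[ℂ] bergmanSpace t :=
  if hf : MemLp f ⊤ (bergmanMeasure t) then
    (bergmanSpace t).orthogonalProjectionOnto ∘L bergmanMul t (hf.toLp f) ∘L
      (bergmanSpace t).subtypeL
  else 0

/-- The semi-commutator `T_f T_g - T_{fg}`. -/
noncomputable def semiCommutator (t : ℝ) (f g : ℂ → ℂ) : bergmanSpace t →L[ℂ] bergmanSpace t :=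
  toeplitz t f ∘L toeplitz t g - toeplitz t (fun z => f z * g z)

/-- `T` is of trace class: the trace `∑ ⟨|T| e_i, e_i⟩` of `|T| = (T* T)^{1/2}` in some
orthonormal basis (equivalently, in every one) is finite. -/
def IsTraceClass {H : Type*} [NormedAddCommGroup H] [InnerProductSpace ℂ H] [CompleteSpace H]
    (T : H →L[ℂ] H) : Prop :=
  ∃ (w : Set H) (b : HilbertBasis w ℂ H), Summable fun i => inner ℂ (b i) (CFC.abs T (b i))

/-- `T` is of trace class and its trace `∑ ⟨T e_i, e_i⟩`, computed in any orthonormal basis,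
is `a`. -/
def HasTrace {H : Type*} [NormedAddCommGroup H] [InnerProductSpace ℂ H] [CompleteSpace H]
    (T : H →L[ℂ] H) (a : ℂ) : Prop :=
  IsTraceClass T ∧
    ∀ (w : Set H) (b : HilbertBasis w ℂ H), HasSum (fun i => inner ℂ (b i) (T (b i))) a

open Classical in
/-- The trace of a trace class operator. -/
noncomputable def opTrace {H : Type*} [NormedAddCommGroup H] [InnerProductSpace ℂ H]
    [CompleteSpace H] (T : H →L[ℂ] H) : ℂ :=
  if h : ∃ a, HasTrace T a then h.choose else 0

/-- The trace is well defined, because orthonormal bases exist. -/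
theorem HasTrace.opTrace_eq {H : Type*} [NormedAddCommGroup H] [InnerProductSpace ℂ H]
    [CompleteSpace H] {T : H →L[ℂ] H} {a : ℂ} (h : HasTrace T a) : opTrace T = a := by
  have hex : ∃ a, HasTrace T a := ⟨a, h⟩
  rw [opTrace, dif_pos hex]
  obtain ⟨w, b, -⟩ := exists_hilbertBasis ℂ H
  exact (hex.choose_spec.2 w b).unique (h.2 w b)

/-- The `(1,0)`-part `∂f = (∂f/∂z) dz` of the differential `df` at `z`, as a function of the
tangent vector `v`. -/
noncomputable def delForm (f : ℂ → ℂ) (z v : ℂ) : ℂ :=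
  (fderiv ℝ f z v - Complex.I * fderiv ℝ f z (Complex.I * v)) / 2

/-- The `(0,1)`-part `∂̄f = (∂f/∂z̄) dz̄` of the differential `df` at `z`. -/
noncomputable def delbarForm (f : ℂ → ℂ) (z v : ℂ) : ℂ :=
  (fderiv ℝ f z v + Complex.I * fderiv ℝ f z (Complex.I * v)) / 2

/-- The wedge product of two `1`-forms on a domain of `ℂ`. -/
noncomputable def wedgeForm (α β : ℂ → ℂ → ℂ) (z u v : ℂ) : ℂ :=
  α z u * β z v - α z v * β z u

/-- The coefficient of `dx ∧ dy` in a `2`-form on a domain of `ℂ`. -/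
noncomputable def areaCoeff (ω : ℂ → ℂ → ℂ → ℂ) (z : ℂ) : ℂ := ω z 1 Complex.I

/-- The integral of a `2`-form over the unit disk with its standard orientation. -/
noncomputable def diskIntegral (ω : ℂ → ℂ → ℂ → ℂ) : ℂ :=
  ∫ z in Metric.ball (0 : ℂ) 1, areaCoeff ω z

/-- The involutive automorphism `φ_z(w) = (z - w) / (1 - z̄ w)` of the unit disk. -/
noncomputable def mobius (z w : ℂ) : ℂ := (z - w) / (1 - (starRingEnd ℂ) z * w)

/-- `F(s,x) = -[x ln (s/x) + (1 - x) ln ((1-s)/(1-x))]`. -/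
noncomputable def kernelF (s x : ℝ) : ℝ :=
  -(x * Real.log (s / x) + (1 - x) * Real.log ((1 - s) / (1 - x)))

/-- `ρ_t(s) = (t+1)/(16π²) ∫_s^1 (1-x)^t x⁻¹ F(s,x) dx`. -/
noncomputable def rhoKernel (t s : ℝ) : ℝ :=
  (t + 1) / (16 * Real.pi ^ 2) * ∫ x in s..1, (1 - x) ^ t * x⁻¹ * kernelF s x

/-- The function `ρ_t(|φ_z(w)|²) Δf(z) Δg(w)` of `(z, w)`. -/
noncomputable def laplacianIntegrand (t : ℝ) (f g : ℂ → ℂ) (p : ℂ × ℂ) : ℂ :=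
  (rhoKernel t (‖mobius p.1 p.2‖ ^ 2) : ℂ) * Laplacian.laplacian f p.1 *
    Laplacian.laplacian g p.2

/-!
The semi-commutator is a product of Hankel operators, `T_f T_g - T_{fg} = -H_{f̄}* H_g` with
`H_g = (1 - P) M_g`. A Hankel operator with Lipschitz symbol is Hilbert–Schmidt, with norm at most
the Lipschitz constant (`hsSum_hankel_le`): its squared norm is at most the double integral of
`|g z - g w|² |K(z, w)|²`, where `K` is the reproducing kernel, with equality for `g = z̄`, and the
norm of `H_{z̄}` is `1`. Hence the trace exists and equals
`-∑ ⟨H_{f̄} e_k, H_g e_k⟩` over the monomial basis (`hasTrace_semiCommutator`). What has to be shown is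
that the *defect* `∑ ⟨H_{f̄} e_k, H_g e_k⟩ + (area term) + (Laplacian term)` vanishes. The defect is
linear in `f`, changes to its conjugate under `(f, g) ↦ (ḡ, f̄)`, and is controlled by the Lipschitz
norm of `f` when `f` is harmonic (`norm_traceDefect_le`).

*Symbols `f` vanishing at the boundary.* Here the sum over the basis may be taken under the
integral, which turns the trace into the integral of `f z (g w - g z) |K(z, w)|²` against
`dλ_t(w) dλ_t(z)`. Up to the factor `(1 - |z|²)^{-(2+t)}` the inner integral is the Berezin transform
of `g` minus `g`; by Green's formula for radial densities, transported by the automorphism `φ_z`,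
this is the integral of `Δg` against the radial kernel `berezinKernel` of `|φ_z w|²`. Exchanging the integrals and applying the same Green
formula to `f`, now with the density `invariantDensity`, gives a multiple of `f w Δg(w)` from the
pole, and a second integral against the radial potential of that density. That potential is exactly
`ρ_t` (`radialPotential_invariantDensity`), and the pole term is `(1/4π) ∫ f Δg` because
`π ∫ invariantDensity = 1/4π`. By Stokes' formula `(1/4π) ∫ f Δg = (1/2πi) ∫ ∂f ∧ ∂̄g`.

*Harmonic symbols.* If `f` is conjugate holomorphic, then `H_{f̄} = 0`, `∂f = 0` and `Δf = 0`. For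
`f = z^j` and `g = z̄^k` the Laplacian term is zero, and both remaining terms are computed on
monomials; the sum over the basis telescopes (`traceDefect_pow_conj_pow`).

*General symbols.* The restriction of a `C²` function to the unit circle has Fourier coefficients
with `∑ |n| |c_n| < ∞`, so it extends to the disk as the sum of a power series in `z` and one in `z̄`
with finite Lipschitz norm, and the difference with `f` vanishes to first order at the boundary.
Therefore the defect of `(f, g)` vanishes as soon as that of `(z^j, g)` does for every `j`
(`traceDefect_eq_zero_of_pow`). This is used twice: for `g = z̄^k`, and then, after conjugation,
for arbitrary `g`.

The Laplacian term tends to zero because the integral of `ρ_t(|φ_z w|²)` over the bidisk is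
`O(t^{-1/2})` (`integral_norm_rhoKernel_mobius_prod_le`), by Green's formula for `|w|²` and a
first-moment bound for `invariantDensity`.
-/


/-! ### Hilbert–Schmidt operators and traces of products -/

section HilbertSchmidt

set_option linter.unusedSectionVars false

variable {H H' : Type*} [NormedAddCommGroup H] [InnerProductSpace ℂ H] [CompleteSpace H]
  [NormedAddCommGroup H'] [InnerProductSpace ℂ H'] [CompleteSpace H']

theorem HilbertBasis.hasSum_norm_inner_sq {ι : Type*} (b : HilbertBasis ι ℂ H) (x : H) :
    HasSum (fun i => ‖(inner ℂ (b i) x : ℂ)‖ ^ 2) (‖x‖ ^ 2) := by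
  have h := Complex.hasSum_re (b.hasSum_inner_mul_inner x x)
  have h1 : (inner ℂ x x : ℂ).re = ‖x‖ ^ 2 := by
    rw [inner_self_eq_norm_sq_to_K]
    norm_cast
  rw [h1] at h
  convert! h using 1
  ext i
  rw [← inner_conj_symm x (b i), Complex.conj_mul']
  norm_cast

theorem HilbertBasis.tsum_enorm_inner_sq {ι : Type*} (b : HilbertBasis ι ℂ H) (x : H) :
    ∑' i, ‖(inner ℂ (b i) x : ℂ)‖ₑ ^ 2 = ‖x‖ₑ ^ 2 := by
  have h := b.hasSum_norm_inner_sq x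
  have h2 := ENNReal.ofReal_tsum_of_nonneg (fun i => by positivity) h.summable
  rw [h.tsum_eq] at h2
  simpa [ENNReal.ofReal_pow, ofReal_norm] using h2.symm

/-- The square of the Hilbert–Schmidt norm of `A`, computed in the orthonormal basis `b`. -/
noncomputable def hsSum {ι : Type*} (b : HilbertBasis ι ℂ H) (A : H →L[ℂ] H') : ENNReal :=
  ∑' i, ‖A (b i)‖ₑ ^ 2

theorem hsSum_adjoint {ι κ : Type*} (b : HilbertBasis ι ℂ H) (c : HilbertBasis κ ℂ H')
    (A : H →L[ℂ] H') : hsSum b A = hsSum c (ContinuousLinearMap.adjoint A) := by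
  unfold hsSum
  calc ∑' i, ‖A (b i)‖ₑ ^ 2 = ∑' i, ∑' j, ‖(inner ℂ (c j) (A (b i)) : ℂ)‖ₑ ^ 2 := by
        simp_rw [c.tsum_enorm_inner_sq]
    _ = ∑' j, ∑' i, ‖(inner ℂ (c j) (A (b i)) : ℂ)‖ₑ ^ 2 := ENNReal.tsum_comm
    _ = ∑' j, ∑' i, ‖(inner ℂ (b i) (ContinuousLinearMap.adjoint A (c j)) : ℂ)‖ₑ ^ 2 := by
        refine tsum_congr fun j => tsum_congr fun i => ?_
        rw [ContinuousLinearMap.adjoint_inner_right, ← inner_conj_symm, RCLike.enorm_conj]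
    _ = _ := by simp_rw [b.tsum_enorm_inner_sq]

/-- The Hilbert–Schmidt norm does not depend on the orthonormal basis. -/
theorem hsSum_eq_hsSum {ι κ : Type*} (b : HilbertBasis ι ℂ H) (b' : HilbertBasis κ ℂ H)
    (A : H →L[ℂ] H') : hsSum b A = hsSum b' A := by
  obtain ⟨w, c, -⟩ := exists_hilbertBasis ℂ H'
  rw [hsSum_adjoint b c, ← hsSum_adjoint b' c]

theorem summable_of_hsSum_ne_top {ι : Type*} {b : HilbertBasis ι ℂ H} {A : H →L[ℂ] H'}
    (h : hsSum b A ≠ ⊤) : Summable fun i => ‖A (b i)‖ ^ 2 := by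
  have := ENNReal.summable_toReal h
  simpa [ENNReal.toReal_pow] using this

theorem hsSum_eq_ofReal_tsum {ι : Type*} {b : HilbertBasis ι ℂ H} {A : H →L[ℂ] H'}
    (h : hsSum b A ≠ ⊤) : hsSum b A = ENNReal.ofReal (∑' i, ‖A (b i)‖ ^ 2) := by
  rw [ENNReal.ofReal_tsum_of_nonneg (fun i => by positivity) (summable_of_hsSum_ne_top h)]
  simp [hsSum, ENNReal.ofReal_pow]

theorem hsSum_ne_top_of_summable {ι : Type*} {b : HilbertBasis ι ℂ H} {A : H →L[ℂ] H'}
    (h : Summable fun i => ‖A (b i)‖ ^ 2) : hsSum b A ≠ ⊤ := by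
  have := h.tsum_ofReal_ne_top
  simpa [hsSum, ENNReal.ofReal_pow, ofReal_norm] using this

theorem norm_inner_le_half_add_sq (x y : H) :
    ‖(inner ℂ x y : ℂ)‖ ≤ (‖x‖ ^ 2 + ‖y‖ ^ 2) / 2 := by
  have := norm_inner_le_norm (𝕜 := ℂ) x y
  nlinarith [sq_nonneg (‖x‖ - ‖y‖)]

theorem summable_norm_inner_of_hsSum_ne_top {ι : Type*} {b : HilbertBasis ι ℂ H}
    {A B : H →L[ℂ] H'} (hA : hsSum b A ≠ ⊤) (hB : hsSum b B ≠ ⊤) :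
    Summable fun i => ‖(inner ℂ (A (b i)) (B (b i)) : ℂ)‖ := by
  refine Summable.of_nonneg_of_le (fun i => norm_nonneg _)
    (fun i => norm_inner_le_half_add_sq _ _) ?_
  exact ((summable_of_hsSum_ne_top hA).add (summable_of_hsSum_ne_top hB)).div_const 2

theorem hsSum_add_smul_ne_top {ι : Type*} {b : HilbertBasis ι ℂ H} {A B : H →L[ℂ] H'} (z : ℂ)
    (hA : hsSum b A ≠ ⊤) (hB : hsSum b B ≠ ⊤) : hsSum b (A + z • B) ≠ ⊤ := by
  refine hsSum_ne_top_of_summable (Summable.of_nonneg_of_le (fun i => by positivity)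
    (fun i => ?_) (((summable_of_hsSum_ne_top hA).mul_left 2).add
      ((summable_of_hsSum_ne_top hB).mul_left (2 * ‖z‖ ^ 2))))
  have h1 : ‖(A + z • B) (b i)‖ ≤ ‖A (b i)‖ + ‖z‖ * ‖B (b i)‖ := by
    simpa [norm_smul] using norm_add_le (A (b i)) (z • B (b i))
  have h2 : ‖(A + z • B) (b i)‖ ^ 2 ≤ (‖A (b i)‖ + ‖z‖ * ‖B (b i)‖) ^ 2 := by gcongr
  nlinarith [sq_nonneg (‖A (b i)‖ - ‖z‖ * ‖B (b i)‖)]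

theorem hasSum_inner_polarization {ι : Type*} {d : HilbertBasis ι ℂ H} {A B : H →L[ℂ] H'}
    (hA : hsSum d A ≠ ⊤) (hB : hsSum d B ≠ ⊤) :
    HasSum (fun i => (inner ℂ (A (d i)) (B (d i)) : ℂ))
      (((∑' i, ‖(A + (1 : ℂ) • B) (d i)‖ ^ 2 : ℝ) - (∑' i, ‖(A + (-1 : ℂ) • B) (d i)‖ ^ 2 : ℝ)
        - Complex.I * (∑' i, ‖(A + Complex.I • B) (d i)‖ ^ 2 : ℝ)
        + Complex.I * (∑' i, ‖(A + (-Complex.I) • B) (d i)‖ ^ 2 : ℝ)) / 4) := by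
  have pol : ∀ x y : H', (inner ℂ x y : ℂ) = ((‖x + (1 : ℂ) • y‖ ^ 2 : ℝ)
      - (‖x + (-1 : ℂ) • y‖ ^ 2 : ℝ) - Complex.I * (‖x + Complex.I • y‖ ^ 2 : ℝ)
      + Complex.I * (‖x + (-Complex.I) • y‖ ^ 2 : ℝ)) / 4 := by
    intro x y
    rw [inner_eq_sum_norm_sq_div_four x y]
    simp only [one_smul, neg_smul, ← sub_eq_add_neg]
    push_cast
    have : (RCLike.I : ℂ) = Complex.I := rfl
    rw [this]
    simp only [Complex.coe_algebraMap]
    ring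
  have hs : ∀ z : ℂ, HasSum (fun i => ((‖(A + z • B) (d i)‖ ^ 2 : ℝ) : ℂ))
      ((∑' i, ‖(A + z • B) (d i)‖ ^ 2 : ℝ) : ℂ) := fun z =>
    Complex.hasSum_ofReal.mpr
      (summable_of_hsSum_ne_top (hsSum_add_smul_ne_top z hA hB)).hasSum
  have := ((((hs 1).sub (hs (-1))).sub ((hs Complex.I).mul_left Complex.I)).add
    ((hs (-Complex.I)).mul_left Complex.I)).div_const 4
  convert! this using 1
  ext i
  exact pol _ _

/-- The Hilbert–Schmidt pairing `∑ ⟨A b_i, B b_i⟩` does not depend on the orthonormal basis,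
by polarization. -/
theorem hasSum_inner_of_hsSum_ne_top {ι κ : Type*} {b : HilbertBasis ι ℂ H}
    (b' : HilbertBasis κ ℂ H) {A B : H →L[ℂ] H'} (hA : hsSum b A ≠ ⊤) (hB : hsSum b B ≠ ⊤) :
    HasSum (fun i => (inner ℂ (A (b' i)) (B (b' i)) : ℂ))
      (∑' i, (inner ℂ (A (b i)) (B (b i)) : ℂ)) := by
  have key : ∀ z : ℂ, (∑' i, ‖(A + z • B) (b' i)‖ ^ 2) = ∑' i, ‖(A + z • B) (b i)‖ ^ 2 := by
    intro z
    have h := hsSum_add_smul_ne_top z hA hB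
    have h' := h
    rw [hsSum_eq_hsSum b b'] at h'
    have e := hsSum_eq_hsSum b b' (A + z • B)
    rw [hsSum_eq_ofReal_tsum h, hsSum_eq_ofReal_tsum h'] at e
    exact ((ENNReal.ofReal_eq_ofReal_iff (tsum_nonneg fun i => by positivity)
      (tsum_nonneg fun i => by positivity)).mp e).symm
  have hb' := hasSum_inner_polarization (d := b') (A := A) (B := B) (by rwa [← hsSum_eq_hsSum b b']) (by rwa [← hsSum_eq_hsSum b b'])
  rw [(hasSum_inner_polarization hA hB).tsum_eq]
  simpa only [key] using hb'

theorem exists_resolvent_of_nonneg {Q : H →L[ℂ] H} (hQ : 0 ≤ Q) {ε : ℝ} (hε : 0 < ε) :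
    ∃ J : H →L[ℂ] H, ∀ x, Q (J x) + (ε : ℂ) • J x = x ∧ ‖Q (J x)‖ ≤ ‖x‖ := by
  have hpos : Q.IsPositive := (ContinuousLinearMap.nonneg_iff_isPositive Q).mp hQ
  have hre : ∀ y, ‖Q y + (ε : ℂ) • y‖ ^ 2
      = ‖Q y‖ ^ 2 + 2 * ε * (inner ℂ (Q y) y : ℂ).re + ε ^ 2 * ‖y‖ ^ 2 := by
    intro y
    rw [@norm_add_sq ℂ, inner_smul_right, norm_smul, RCLike.re_to_complex, Complex.re_ofReal_mul]
    simp only [Complex.norm_real, Real.norm_eq_abs, mul_pow, sq_abs]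
    ring
  have hu : IsUnit (Q + (ε : ℂ) • (1 : H →L[ℂ] H)) := by
    apply ContinuousLinearMap.isUnit_of_forall_le_norm_inner_map _ (c := ⟨ε, hε.le⟩) hε
    intro x
    have h1 : (inner ℂ ((Q + (ε : ℂ) • (1 : H →L[ℂ] H)) x) x : ℂ).re
        = (inner ℂ (Q x) x : ℂ).re + ε * ‖x‖ ^ 2 := by
      simp only [add_apply, smul_apply,
        one_apply_eq_self, inner_add_left, inner_smul_left, Complex.conj_ofReal,
        Complex.add_re, Complex.re_ofReal_mul]
      rw [← inner_self_eq_norm_sq (𝕜 := ℂ)]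
      rfl
    have h2 := hpos.re_inner_nonneg_left x
    have h3 := Complex.re_le_norm (inner ℂ ((Q + (ε : ℂ) • (1 : H →L[ℂ] H)) x) x : ℂ)
    rw [h1] at h3
    simp only [RCLike.re_to_complex] at h2
    have : ‖x‖ ^ 2 * ε ≤ ‖(inner ℂ ((Q + (ε : ℂ) • (1 : H →L[ℂ] H)) x) x : ℂ)‖ := by linarith
    exact this
  obtain ⟨U, hU⟩ := hu
  refine ⟨(↑U⁻¹ : H →L[ℂ] H), fun x => ?_⟩
  have h1 : Q ((↑U⁻¹ : H →L[ℂ] H) x) + (ε : ℂ) • (↑U⁻¹ : H →L[ℂ] H) x = x := by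
    have := congrArg (fun S : H →L[ℂ] H => S x) U.mul_inv
    rw [hU] at this
    simpa using this
  refine ⟨h1, ?_⟩
  have h2 := hre ((↑U⁻¹ : H →L[ℂ] H) x)
  rw [h1] at h2
  have h3 := hpos.re_inner_nonneg_left ((↑U⁻¹ : H →L[ℂ] H) x)
  simp only [RCLike.re_to_complex] at h3
  refine le_of_sq_le_sq ?_ (norm_nonneg _)
  have : 0 ≤ 2 * ε * (inner ℂ (Q ((↑U⁻¹ : H →L[ℂ] H) x)) ((↑U⁻¹ : H →L[ℂ] H) x) : ℂ).re := by
    positivity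
  nlinarith [sq_nonneg (ε * ‖(↑U⁻¹ : H →L[ℂ] H) x‖)]

/-- A product of two Hilbert–Schmidt operators is of trace class. With `Q = |T|`, the operators
`T (Q + ε)⁻¹` are contractions which replace the partial isometry of the polar decomposition up
to an error `ε`. -/
theorem isTraceClass_adjoint_comp {ι : Type*} (b : HilbertBasis ι ℂ H) {A B : H →L[ℂ] H'}
    (hA : hsSum b A ≠ ⊤) (hB : hsSum b B ≠ ⊤) :
    IsTraceClass (ContinuousLinearMap.adjoint A ∘L B) := by
  obtain ⟨w, d, -⟩ := exists_hilbertBasis ℂ H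
  refine ⟨w, d, ?_⟩
  set T := ContinuousLinearMap.adjoint A ∘L B with hT
  set Q := CFC.abs T with hQ
  have hQ0 : 0 ≤ Q := CFC.abs_nonneg T
  have hQs : ContinuousLinearMap.adjoint Q = Q :=
    ((ContinuousLinearMap.nonneg_iff_isPositive Q).mp hQ0).isSelfAdjoint
  have hQQ : ∀ x, Q (Q x) = ContinuousLinearMap.adjoint T (T x) := by
    intro x
    have := congrArg (fun S : H →L[ℂ] H => S x) (CFC.abs_mul_abs T)
    simpa [ContinuousLinearMap.star_eq_adjoint] using this
  have hnorm : ∀ y, ‖T y‖ = ‖Q y‖ := by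
    intro y
    have h1 : (inner ℂ (T y) (T y) : ℂ) = inner ℂ (Q y) (Q y) := by
      rw [← ContinuousLinearMap.adjoint_inner_right, ← hQQ, ← ContinuousLinearMap.adjoint_inner_right Q,
        hQs]
    rw [inner_self_eq_norm_sq_to_K, inner_self_eq_norm_sq_to_K] at h1
    have h2 : ‖T y‖ ^ 2 = ‖Q y‖ ^ 2 := by exact_mod_cast h1
    exact (sq_eq_sq₀ (norm_nonneg _) (norm_nonneg _)).mp h2
  rw [hsSum_eq_hsSum b d] at hA hB
  set M : ℝ := ((hsSum d A).toReal + (hsSum d B).toReal) / 2 with hM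
  have hfin : ∀ (ε : ℝ), 0 < ε → ∀ F : Finset w,
      ∑ i ∈ F, ‖(inner ℂ (d i) (Q (d i)) : ℂ)‖ ≤ M + ε * F.card := by
    intro ε hε F
    obtain ⟨J, hJ⟩ := exists_resolvent_of_nonneg hQ0 hε
    set V := T ∘L J with hV
    have hV1 : ‖V‖ ≤ 1 := ContinuousLinearMap.opNorm_le_bound _ zero_le_one fun x => by
      rw [hV, ContinuousLinearMap.comp_apply, hnorm, one_mul]
      exact (hJ x).2
    have hAV : hsSum d (A ∘L V) ≤ hsSum d A := by
      obtain ⟨v, c, -⟩ := exists_hilbertBasis ℂ H'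
      rw [hsSum_adjoint d c, hsSum_adjoint d c A]
      refine ENNReal.tsum_le_tsum fun j => ?_
      gcongr
      rw [enorm_le_iff_norm_le, ContinuousLinearMap.adjoint_comp, ContinuousLinearMap.comp_apply]
      refine (ContinuousLinearMap.le_opNorm _ _).trans ?_
      rw [LinearIsometryEquiv.norm_map]
      exact mul_le_of_le_one_left (norm_nonneg _) hV1
    have hAV' : hsSum d (A ∘L V) ≠ ⊤ := (hAV.trans_lt hA.lt_top).ne
    have hterm : ∀ i, ‖(inner ℂ (d i) (Q (d i)) : ℂ)‖
        ≤ (‖(A ∘L V) (d i)‖ ^ 2 + ‖B (d i)‖ ^ 2) / 2 + ε := by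
      intro i
      have hd : ‖d i‖ = 1 := d.orthonormal.1 i
      have h1 : (inner ℂ (d i) (Q (d i)) : ℂ)
          = inner ℂ ((A ∘L V) (d i)) (B (d i)) + ε * inner ℂ (Q (J (d i))) (d i) := by
        conv_lhs => rw [← (hJ (d i)).1]
        rw [inner_add_left, inner_smul_left, Complex.conj_ofReal, (hJ (d i)).1]
        congr 1
        · rw [← ContinuousLinearMap.adjoint_inner_right Q, hQs, hQQ,
            ContinuousLinearMap.adjoint_inner_right]
          exact ContinuousLinearMap.adjoint_inner_right A _ _
        · rw [← ContinuousLinearMap.adjoint_inner_right Q, hQs]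
      rw [h1]
      refine (norm_add_le _ _).trans (add_le_add (norm_inner_le_half_add_sq _ _) ?_)
      rw [norm_mul, Complex.norm_real, Real.norm_of_nonneg hε.le]
      have h2 := norm_inner_le_norm (𝕜 := ℂ) (Q (J (d i))) (d i)
      have h3 := (hJ (d i)).2
      rw [hd] at h2 h3
      nlinarith
    have hs : ∀ {C : H →L[ℂ] H'}, hsSum d C ≠ ⊤ →
        ∑ i ∈ F, ‖C (d i)‖ ^ 2 ≤ (hsSum d C).toReal := by
      intro C hC
      rw [hsSum_eq_ofReal_tsum hC, ENNReal.toReal_ofReal (tsum_nonneg fun i => by positivity)]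
      exact (summable_of_hsSum_ne_top hC).sum_le_tsum F fun i _ => by positivity
    calc ∑ i ∈ F, ‖(inner ℂ (d i) (Q (d i)) : ℂ)‖
        ≤ ∑ i ∈ F, ((‖(A ∘L V) (d i)‖ ^ 2 + ‖B (d i)‖ ^ 2) / 2 + ε) :=
          Finset.sum_le_sum fun i _ => hterm i
      _ = (∑ i ∈ F, ‖(A ∘L V) (d i)‖ ^ 2 + ∑ i ∈ F, ‖B (d i)‖ ^ 2) / 2 + ε * F.card := by
          rw [Finset.sum_add_distrib, ← Finset.sum_div, Finset.sum_add_distrib,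
            Finset.sum_const, nsmul_eq_mul, mul_comm ε]
      _ ≤ M + ε * F.card := by
          have h1 := hs hAV'
          have h2 := hs hB
          have h3 := ENNReal.toReal_mono hA hAV
          rw [hM]
          gcongr
          linarith
  have hle : ∀ F : Finset w, ∑ i ∈ F, ‖(inner ℂ (d i) (Q (d i)) : ℂ)‖ ≤ M := by
    intro F
    refine le_of_forall_pos_le_add fun δ hδ => ?_
    refine (hfin (δ / (F.card + 1)) (by positivity) F).trans ?_
    gcongr
    rw [div_mul_eq_mul_div, div_le_iff₀ (by positivity)]
    nlinarith
  exact (summable_of_sum_le (fun i => norm_nonneg _) hle).of_norm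

theorem hasTrace_neg_adjoint_comp {ι : Type*} (b : HilbertBasis ι ℂ H) {A B : H →L[ℂ] H'}
    (hA : hsSum b A ≠ ⊤) (hB : hsSum b B ≠ ⊤) :
    HasTrace (-(ContinuousLinearMap.adjoint A ∘L B))
      (-∑' i, (inner ℂ (A (b i)) (B (b i)) : ℂ)) := by
  constructor
  · obtain ⟨w, d, h⟩ := isTraceClass_adjoint_comp b hA hB
    exact ⟨w, d, by simpa only [CFC.abs_neg] using h⟩
  · intro w d
    have := (hasSum_inner_of_hsSum_ne_top d hA hB).neg
    convert! this using 1
    ext i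
    rw [neg_apply, inner_neg_right, ContinuousLinearMap.comp_apply,
      ContinuousLinearMap.adjoint_inner_right]

end HilbertSchmidt

/-! ### The Laplacian of a composition with a holomorphic function -/

theorem laplacian_eq_fderiv_fderiv (f : ℂ → ℂ) (z : ℂ) :
    Laplacian.laplacian f z
      = fderiv ℝ (fderiv ℝ f) z 1 1 + fderiv ℝ (fderiv ℝ f) z Complex.I Complex.I := by
  rw [InnerProductSpace.laplacian_eq_iteratedFDeriv_complexPlane]
  simp [iteratedFDeriv_two_apply]

/-- The trace of a real bilinear form on `ℂ` over the orthogonal frame `v`, `i v`. -/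
theorem bilin_self_add_bilin_mul_I (B : ℂ →L[ℝ] ℂ →L[ℝ] ℂ) (v : ℂ) :
    B v v + B (Complex.I * v) (Complex.I * v)
      = (‖v‖ ^ 2 : ℝ) * (B 1 1 + B Complex.I Complex.I) := by
  have h1 : v = v.re • (1 : ℂ) + v.im • Complex.I := by
    simp
  have h2 : Complex.I * v = v.re • Complex.I - v.im • (1 : ℂ) := by
    conv_lhs => rw [h1]
    simp only [Complex.real_smul]
    linear_combination (v.im : ℂ) * Complex.I_mul_I
  have h3 : ‖v‖ ^ 2 = v.re ^ 2 + v.im ^ 2 := by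
    rw [← Complex.normSq_eq_norm_sq, Complex.normSq_apply]
    ring
  rw [h2, h3]
  conv_lhs => enter [1]; rw [h1]
  have hs : ∀ (r : ℝ) (x : ℂ), B (r • x) = r • B x := fun r x => B.map_smul r x
  have hs' : ∀ (r : ℝ) (x y : ℂ), B x (r • y) = r • B x y := fun r x y => (B x).map_smul r y
  simp only [map_add, map_sub, add_apply, sub_apply, hs, hs', smul_apply]
  simp only [Complex.real_smul]
  push_cast
  ring

theorem fderiv_fderiv_apply {f : ℂ → ℂ} {z : ℂ} (hf : ContDiffAt ℝ 2 f z) (u v : ℂ) :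
    fderiv ℝ (fderiv ℝ f) z u v = fderiv ℝ (fun w => fderiv ℝ f w v) z u := by
  have hd : DifferentiableAt ℝ (fderiv ℝ f) z :=
    (hf.fderiv_right (m := 1) (by norm_num)).differentiableAt (by norm_num)
  have := (hd.hasFDerivAt.clm_apply (hasFDerivAt_const v z)).fderiv
  rw [this]
  simp

theorem hasFDerivAt_real_of_hasDerivAt {φ : ℂ → ℂ} {a z : ℂ} (h : HasDerivAt φ a z) :
    HasFDerivAt φ (a • (1 : ℂ →L[ℝ] ℂ)) z := by
  have := h.hasFDerivAt.restrictScalars ℝ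
  convert! this using 1
  ext
  simp [mul_comm]

theorem fderiv_comp_of_hasDerivAt {g φ : ℂ → ℂ} {a z : ℂ} (hφ : HasDerivAt φ a z)
    (hg : DifferentiableAt ℝ g (φ z)) (v : ℂ) :
    fderiv ℝ (g ∘ φ) z v = fderiv ℝ g (φ z) (a * v) := by
  rw [(hg.hasFDerivAt.comp z (hasFDerivAt_real_of_hasDerivAt hφ)).fderiv]
  simp

/-- The Laplacian is conformally covariant in dimension two. -/
theorem laplacian_comp_of_differentiableOn {g φ : ℂ → ℂ} {U : Set ℂ} (hU : IsOpen U)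
    (hφ : DifferentiableOn ℂ φ U) {z : ℂ} (hz : z ∈ U) (hg : ContDiffAt ℝ 2 g (φ z)) :
    Laplacian.laplacian (g ∘ φ) z
      = (‖deriv φ z‖ ^ 2 : ℝ) * Laplacian.laplacian g (φ z) := by
  have han : AnalyticAt ℂ φ z := hφ.analyticAt (hU.mem_nhds hz)
  have hφ2 : ContDiffAt ℝ 2 φ z := han.contDiffAt.restrict_scalars ℝ
  have hF : ContDiffAt ℝ 2 (g ∘ φ) z := hg.comp z hφ2
  have hev : ∀ v : ℂ, (fun w => fderiv ℝ (g ∘ φ) w v)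
      =ᶠ[𝓝 z] fun w => fderiv ℝ g (φ w) (deriv φ w * v) := by
    intro v
    have h1 : ∀ᶠ w in 𝓝 z, ContDiffAt ℝ 2 g (φ w) :=
      hφ2.continuousAt.eventually (hg.eventually (by norm_num))
    filter_upwards [h1, hU.mem_nhds hz] with w hw hwU
    exact fderiv_comp_of_hasDerivAt (hφ.differentiableAt (hU.mem_nhds hwU)).hasDerivAt
      (hw.differentiableAt (by norm_num)) v
  have hdg : HasFDerivAt (fderiv ℝ g) (fderiv ℝ (fderiv ℝ g) (φ z)) (φ z) :=
    ((hg.fderiv_right (m := 1) (by norm_num)).differentiableAt (by norm_num)).hasFDerivAt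
  have hd1 : HasDerivAt φ (deriv φ z) z := han.differentiableAt.hasDerivAt
  have hd2 : HasDerivAt (deriv φ) (deriv (deriv φ) z) z := han.deriv.differentiableAt.hasDerivAt
  have key : ∀ u v : ℂ, fderiv ℝ (fderiv ℝ (g ∘ φ)) z u v
      = fderiv ℝ (fderiv ℝ g) (φ z) (deriv φ z * u) (deriv φ z * v)
        + fderiv ℝ g (φ z) (deriv (deriv φ) z * u * v) := by
    intro u v
    rw [fderiv_fderiv_apply hF, (hev v).fderiv_eq]
    have h1 := hdg.comp z (hasFDerivAt_real_of_hasDerivAt hd1)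
    have h2 := (hasFDerivAt_real_of_hasDerivAt hd2).mul_const v
    have := (h1.clm_apply h2).fderiv
    simp only [Function.comp_def] at this
    rw [this]
    simp [mul_comm, mul_left_comm]
    ring_nf
  rw [laplacian_eq_fderiv_fderiv, laplacian_eq_fderiv_fderiv, key, key]
  have h := bilin_self_add_bilin_mul_I (fderiv ℝ (fderiv ℝ g) (φ z)) (deriv φ z)
  rw [← h]
  have e : deriv (deriv φ) z * Complex.I * Complex.I = -(deriv (deriv φ) z * 1 * 1) := by
    rw [mul_assoc, Complex.I_mul_I]; ring
  rw [e, map_neg, mul_one, mul_comm (deriv φ z) Complex.I]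
  ring

/-! ### Automorphisms of the disk -/

theorem one_sub_conj_mul_ne_zero {z w : ℂ} (hz : ‖z‖ < 1) (hw : ‖w‖ ≤ 1) :
    1 - (starRingEnd ℂ) z * w ≠ 0 := by
  intro h
  have h1 : (starRingEnd ℂ) z * w = 1 := (sub_eq_zero.mp h).symm
  have h2 : ‖z‖ * ‖w‖ = 1 := by
    rw [← RCLike.norm_conj z, ← norm_mul, h1, norm_one]
  nlinarith [norm_nonneg z, norm_nonneg w]

theorem norm_one_sub_conj_mul_comm (z w : ℂ) :
    ‖1 - (starRingEnd ℂ) z * w‖ = ‖1 - (starRingEnd ℂ) w * z‖ := by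
  rw [← RCLike.norm_conj (1 - (starRingEnd ℂ) z * w)]
  congr 1
  simp [mul_comm]

theorem one_sub_norm_mobius_sq {z w : ℂ} (hz : ‖z‖ < 1) (hw : ‖w‖ ≤ 1) :
    1 - ‖mobius z w‖ ^ 2
      = (1 - ‖z‖ ^ 2) * (1 - ‖w‖ ^ 2) / ‖1 - (starRingEnd ℂ) z * w‖ ^ 2 := by
  have h := norm_ne_zero_iff.mpr (one_sub_conj_mul_ne_zero hz hw)
  rw [mobius, norm_div, div_pow, eq_div_iff (by positivity), sub_mul,
    div_mul_cancel₀ _ (by positivity)]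
  simp only [← Complex.normSq_eq_norm_sq, Complex.normSq_apply, Complex.sub_re, Complex.sub_im,
    Complex.mul_re, Complex.mul_im, Complex.conj_re, Complex.conj_im, Complex.one_re,
    Complex.one_im]
  ring

theorem norm_mobius_lt_one {z w : ℂ} (hz : ‖z‖ < 1) (hw : ‖w‖ < 1) : ‖mobius z w‖ < 1 := by
  have h := one_sub_norm_mobius_sq hz hw.le
  have h1 := norm_pos_iff.mpr (one_sub_conj_mul_ne_zero hz hw.le)
  have h2 : 0 < 1 - ‖z‖ ^ 2 := by nlinarith [norm_nonneg z]
  have h3 : 0 < 1 - ‖w‖ ^ 2 := by nlinarith [norm_nonneg w]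
  have h4 : 0 < 1 - ‖mobius z w‖ ^ 2 := by rw [h]; positivity
  nlinarith [norm_nonneg (mobius z w)]

theorem norm_mobius_comm (z w : ℂ) : ‖mobius z w‖ = ‖mobius w z‖ := by
  rw [mobius, mobius, norm_div, norm_div, norm_sub_rev, norm_one_sub_conj_mul_comm]

theorem mobius_mem_ball {z w : ℂ} (hz : z ∈ Metric.ball (0 : ℂ) 1)
    (hw : w ∈ Metric.ball (0 : ℂ) 1) : mobius z w ∈ Metric.ball (0 : ℂ) 1 := by
  rw [mem_ball_zero_iff] at *
  exact norm_mobius_lt_one hz hw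

theorem mobius_zero_right (z : ℂ) : mobius z 0 = z := by simp [mobius]

theorem one_sub_norm_sq_ne_zero {z : ℂ} (hz : ‖z‖ < 1) : (1 - (‖z‖ ^ 2 : ℝ) : ℂ) ≠ 0 := by
  have h2 : 1 - ‖z‖ ^ 2 ≠ 0 := by nlinarith [norm_nonneg z]
  exact_mod_cast h2

theorem one_sub_conj_mul_mobius {z w : ℂ} (hz : ‖z‖ < 1) (hw : ‖w‖ ≤ 1) :
    1 - (starRingEnd ℂ) z * mobius z w
      = (1 - (‖z‖ ^ 2 : ℝ)) / (1 - (starRingEnd ℂ) z * w) := by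
  have h := one_sub_conj_mul_ne_zero hz hw
  have hc := Complex.conj_mul' z
  rw [mobius, eq_div_iff h, sub_mul, mul_div_assoc', div_mul_cancel₀ _ h]
  push_cast
  rw [← hc]
  ring

theorem mobius_mobius {z w : ℂ} (hz : ‖z‖ < 1) (hw : ‖w‖ ≤ 1) : mobius z (mobius z w) = w := by
  have h := one_sub_conj_mul_ne_zero hz hw
  have hz2 := one_sub_norm_sq_ne_zero hz
  have hc := Complex.conj_mul' z
  rw [mobius, one_sub_conj_mul_mobius hz hw, div_div_eq_mul_div, div_eq_iff hz2, mobius,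
    sub_mul, div_mul_cancel₀ _ h]
  push_cast
  rw [← hc]
  ring

theorem hasDerivAt_mobius {z w : ℂ} (hz : ‖z‖ < 1) (hw : ‖w‖ ≤ 1) :
    HasDerivAt (mobius z)
      (-(1 - (‖z‖ ^ 2 : ℝ)) / (1 - (starRingEnd ℂ) z * w) ^ 2) w := by
  have h := one_sub_conj_mul_ne_zero hz hw
  have h1 : HasDerivAt (fun w => z - w) (-1) w := by
    simpa using (hasDerivAt_id w).const_sub z
  have h2 : HasDerivAt (fun w => 1 - (starRingEnd ℂ) z * w) (-(starRingEnd ℂ) z) w := by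
    simpa using ((hasDerivAt_id w).const_mul ((starRingEnd ℂ) z)).const_sub 1
  have := h1.div h2 h
  refine this.congr_deriv ?_
  congr 1
  have hc := Complex.conj_mul' z
  push_cast
  rw [← hc]
  ring

/-- The Jacobian determinant `(1 - |z|²)² / |1 - z̄ w|⁴` of the disk automorphism `φ_z`. -/
noncomputable def mobiusJac (z w : ℂ) : ℝ :=
  (1 - ‖z‖ ^ 2) ^ 2 / ‖1 - (starRingEnd ℂ) z * w‖ ^ 4

theorem mobiusJac_nonneg (z w : ℂ) : 0 ≤ mobiusJac z w := by unfold mobiusJac; positivity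

theorem norm_deriv_mobius_sq {z w : ℂ} (hz : ‖z‖ < 1) (hw : ‖w‖ ≤ 1) :
    ‖deriv (mobius z) w‖ ^ 2 = mobiusJac z w := by
  rw [(hasDerivAt_mobius hz hw).deriv, norm_div, norm_neg, norm_pow, mobiusJac]
  have : ‖(1 - (‖z‖ ^ 2 : ℝ) : ℂ)‖ = |1 - ‖z‖ ^ 2| := by
    rw [← Real.norm_eq_abs, ← Complex.norm_real]
    push_cast
    rfl
  rw [this, div_pow, sq_abs, ← pow_mul]

theorem differentiableOn_mobius {z : ℂ} (hz : ‖z‖ < 1) :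
    DifferentiableOn ℂ (mobius z) (Metric.ball 0 1) := fun _ hw =>
  (hasDerivAt_mobius hz (mem_ball_zero_iff.mp hw).le).differentiableAt.differentiableWithinAt

theorem injOn_mobius {z : ℂ} (hz : ‖z‖ < 1) : InjOn (mobius z) (Metric.ball 0 1) := by
  intro u hu v hv h
  rw [← mobius_mobius hz (mem_ball_zero_iff.mp hu).le, h,
    mobius_mobius hz (mem_ball_zero_iff.mp hv).le]

theorem image_mobius_ball {z : ℂ} (hz : ‖z‖ < 1) :
    mobius z '' Metric.ball 0 1 = Metric.ball 0 1 := by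
  have hz' : z ∈ Metric.ball (0 : ℂ) 1 := mem_ball_zero_iff.mpr hz
  ext w
  constructor
  · rintro ⟨u, hu, rfl⟩
    exact mobius_mem_ball hz' hu
  · intro hw
    exact ⟨mobius z w, mobius_mem_ball hz' hw, mobius_mobius hz (mem_ball_zero_iff.mp hw).le⟩

theorem det_smul_one (a : ℂ) : (a • (1 : ℂ →L[ℝ] ℂ)).det = ‖a‖ ^ 2 := by
  have h : ((a • (1 : ℂ →L[ℝ] ℂ) : ℂ →L[ℝ] ℂ) : ℂ →ₗ[ℝ] ℂ)
      = (LinearMap.lsmul ℂ ℂ a).restrictScalars ℝ := by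
    ext
    simp
  rw [ContinuousLinearMap.det, h, LinearMap.det_restrictScalars, LinearMap.det_ring,
    Algebra.norm_complex_apply]
  simp [Complex.normSq_eq_norm_sq]

theorem abs_det_mobius {z w : ℂ} (hz : ‖z‖ < 1) (hw : ‖w‖ ≤ 1) :
    |(deriv (mobius z) w • (1 : ℂ →L[ℝ] ℂ)).det| = mobiusJac z w := by
  rw [det_smul_one, norm_deriv_mobius_sq hz hw, abs_of_nonneg (mobiusJac_nonneg _ _)]

theorem hasFDerivWithinAt_mobius {z w : ℂ} (hz : ‖z‖ < 1) (hw : ‖w‖ ≤ 1) :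
    HasFDerivWithinAt (mobius z) (deriv (mobius z) w • (1 : ℂ →L[ℝ] ℂ)) (Metric.ball 0 1) w :=
  (hasFDerivAt_real_of_hasDerivAt
    (hasDerivAt_mobius hz hw).differentiableAt.hasDerivAt).hasFDerivWithinAt

section ChangeOfVariables

variable {E : Type*} [NormedAddCommGroup E] [NormedSpace ℝ E]

theorem integral_ball_mobius {z : ℂ} (hz : ‖z‖ < 1) (F : ℂ → E) :
    ∫ w in Metric.ball (0 : ℂ) 1, mobiusJac z w • F (mobius z w)
      = ∫ w in Metric.ball (0 : ℂ) 1, F w := by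
  conv_rhs => rw [← image_mobius_ball hz]
  rw [integral_image_eq_integral_abs_det_fderiv_smul volume Metric.isOpen_ball.measurableSet
    (fun w hw => hasFDerivWithinAt_mobius hz (mem_ball_zero_iff.mp hw).le) (injOn_mobius hz)]
  refine setIntegral_congr_fun Metric.isOpen_ball.measurableSet fun w hw => ?_
  simp only [abs_det_mobius hz (mem_ball_zero_iff.mp hw).le]

theorem integrableOn_ball_mobius_iff {z : ℂ} (hz : ‖z‖ < 1) (F : ℂ → E) :
    IntegrableOn (fun w => mobiusJac z w • F (mobius z w)) (Metric.ball (0 : ℂ) 1)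
      ↔ IntegrableOn F (Metric.ball (0 : ℂ) 1) := by
  conv_rhs => rw [← image_mobius_ball hz]
  rw [integrableOn_image_iff_integrableOn_abs_det_fderiv_smul volume
    Metric.isOpen_ball.measurableSet
    (fun w hw => hasFDerivWithinAt_mobius hz (mem_ball_zero_iff.mp hw).le) (injOn_mobius hz)]
  refine integrableOn_congr_fun (fun w hw => ?_) Metric.isOpen_ball.measurableSet
  simp only [abs_det_mobius hz (mem_ball_zero_iff.mp hw).le]

end ChangeOfVariables

theorem laplacian_comp_mobius {g : ℂ → ℂ} (hg : ContDiffOn ℝ 2 g (Metric.ball 0 1)) {z w : ℂ}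
    (hz : ‖z‖ < 1) (hw : w ∈ Metric.ball (0 : ℂ) 1) :
    Laplacian.laplacian (g ∘ mobius z) w
      = mobiusJac z w * Laplacian.laplacian g (mobius z w) := by
  rw [laplacian_comp_of_differentiableOn Metric.isOpen_ball (differentiableOn_mobius hz) hw,
    norm_deriv_mobius_sq hz (mem_ball_zero_iff.mp hw).le]
  exact hg.contDiffAt (Metric.isOpen_ball.mem_nhds
    (mobius_mem_ball (mem_ball_zero_iff.mpr hz) hw))

theorem contDiffOn_comp_mobius {g : ℂ → ℂ} (hg : ContDiffOn ℝ 2 g (Metric.ball 0 1)) {z : ℂ}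
    (hz : ‖z‖ < 1) : ContDiffOn ℝ 2 (g ∘ mobius z) (Metric.ball 0 1) := by
  refine hg.comp ?_ fun _ hw => mobius_mem_ball (mem_ball_zero_iff.mpr hz) hw
  exact ((differentiableOn_mobius hz).contDiffOn Metric.isOpen_ball).restrict_scalars ℝ

/-- The automorphism `φ_z` moves `|z|²` by at most `2|u|`. -/
theorem norm_mobius_sq_sub_le {z u : ℂ} (hz : ‖z‖ < 1) (hu : ‖u‖ < 1) :
    ‖mobius z u‖ ^ 2 - ‖z‖ ^ 2 ≤ 2 * ‖u‖ := by
  have h := one_sub_norm_mobius_sq hz hu.le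
  have h1 := norm_pos_iff.mpr (one_sub_conj_mul_ne_zero hz hu.le)
  have h2 : 0 < 1 - ‖z‖ ^ 2 := by nlinarith [norm_nonneg z]
  have h3 : ‖1 - (starRingEnd ℂ) z * u‖ ≤ 1 + ‖u‖ := by
    refine (norm_sub_le _ _).trans ?_
    rw [norm_one, norm_mul, RCLike.norm_conj]
    nlinarith [norm_nonneg u]
  have h4 : (1 - ‖z‖ ^ 2) * (1 - 2 * ‖u‖)
      ≤ (1 - ‖z‖ ^ 2) * (1 - ‖u‖ ^ 2) / ‖1 - (starRingEnd ℂ) z * u‖ ^ 2 := by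
    rw [mul_div_assoc]
    gcongr
    rw [le_div_iff₀ (by positivity)]
    rcases le_or_gt (1 - 2 * ‖u‖) 0 with h5 | h5
    · have : 0 ≤ 1 - ‖u‖ ^ 2 := by nlinarith [norm_nonneg u]
      nlinarith [sq_nonneg (‖1 - (starRingEnd ℂ) z * u‖)]
    · have h6 : ‖1 - (starRingEnd ℂ) z * u‖ ^ 2 ≤ (1 + ‖u‖) ^ 2 := by gcongr
      have h7 : (1 - 2 * ‖u‖) * (1 + ‖u‖) ^ 2 ≤ 1 - ‖u‖ ^ 2 := by
        have := norm_nonneg u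
        nlinarith [mul_nonneg this this, mul_nonneg (mul_nonneg this this) this]
      nlinarith
  nlinarith [norm_nonneg u, sq_nonneg ‖z‖]

/-! ### Radial integrals over the disk -/

/-- Under `u ↦ |u|²` the area measure of the disk becomes `π` times Lebesgue measure on `(0,1)`. -/
theorem map_norm_sq_restrict_ball :
    Measure.map (fun u : ℂ => ‖u‖ ^ 2) (volume.restrict (Metric.ball (0 : ℂ) 1))
      = ENNReal.ofReal Real.pi • (volume.restrict (Ioo (0 : ℝ) 1)) := by
  have hm : Measurable fun u : ℂ => ‖u‖ ^ 2 := by fun_prop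
  have : IsFiniteMeasure (volume.restrict (Metric.ball (0 : ℂ) 1)) :=
    ⟨by rw [Measure.restrict_apply_univ]; exact measure_ball_lt_top⟩
  have := Measure.isFiniteMeasure_map (volume.restrict (Metric.ball (0 : ℂ) 1))
    (fun u : ℂ => ‖u‖ ^ 2)
  refine Measure.ext_of_Iic _ _ fun a => ?_
  rw [Measure.map_apply hm measurableSet_Iic, Measure.smul_apply,
    Measure.restrict_apply (hm measurableSet_Iic), Measure.restrict_apply measurableSet_Iic]
  rcases lt_or_ge a 0 with ha | ha
  · have h1 : (fun u : ℂ => ‖u‖ ^ 2) ⁻¹' Iic a ∩ Metric.ball 0 1 = ∅ := by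
      ext u
      simp only [mem_inter_iff, mem_preimage, mem_Iic, mem_empty_iff_false, iff_false, not_and]
      intro h
      nlinarith [sq_nonneg ‖u‖]
    have h2 : Iic a ∩ Ioo 0 1 = ∅ := by
      ext x
      simp only [mem_inter_iff, mem_Iic, mem_Ioo, mem_empty_iff_false, iff_false]
      rintro ⟨h, h', -⟩
      linarith
    rw [h1, h2]
    simp
  rcases lt_or_ge a 1 with ha1 | ha1
  · have h1 : (fun u : ℂ => ‖u‖ ^ 2) ⁻¹' Iic a ∩ Metric.ball 0 1
        = Metric.closedBall 0 (Real.sqrt a) := by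
      ext u
      simp only [mem_inter_iff, mem_preimage, mem_Iic, mem_ball_zero_iff,
        mem_closedBall_zero_iff]
      rw [Real.le_sqrt (norm_nonneg _) ha]
      refine ⟨fun h => h.1, fun h => ⟨h, ?_⟩⟩
      nlinarith [norm_nonneg u]
    have h2 : Iic a ∩ Ioo 0 1 = Ioc 0 a := by
      ext x
      simp only [mem_inter_iff, mem_Iic, mem_Ioo, mem_Ioc]
      constructor
      · rintro ⟨h, h', -⟩; exact ⟨h', h⟩
      · rintro ⟨h, h'⟩; exact ⟨h', h, h'.trans_lt ha1⟩
    rw [h1, h2, Complex.volume_closedBall, Real.volume_Ioc, sub_zero, smul_eq_mul,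
      ← ENNReal.ofReal_pow (Real.sqrt_nonneg _), Real.sq_sqrt ha, mul_comm]
    congr 1
    exact (ENNReal.ofReal_coe_nnreal).symm
  · have h1 : (fun u : ℂ => ‖u‖ ^ 2) ⁻¹' Iic a ∩ Metric.ball 0 1 = Metric.ball 0 1 := by
      ext u
      simp only [mem_inter_iff, mem_preimage, mem_Iic, mem_ball_zero_iff, and_iff_right_iff_imp]
      intro h
      nlinarith [norm_nonneg u]
    have h2 : Iic a ∩ Ioo 0 1 = Ioo 0 1 := by
      ext x
      simp only [mem_inter_iff, mem_Iic, mem_Ioo, and_iff_right_iff_imp]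
      rintro ⟨-, h⟩
      linarith
    rw [h1, h2, Complex.volume_ball, Real.volume_Ioo, smul_eq_mul]
    simp only [ENNReal.ofReal_one, one_pow, one_mul, sub_zero, mul_one]
    exact (ENNReal.ofReal_coe_nnreal).symm

theorem aestronglyMeasurable_of_smul_pi {E : Type*} [TopologicalSpace E] {κ : ℝ → E}
    (hκ : AEStronglyMeasurable κ (volume.restrict (Ioo (0 : ℝ) 1))) :
    AEStronglyMeasurable κ
      (Measure.map (fun u : ℂ => ‖u‖ ^ 2) (volume.restrict (Metric.ball (0 : ℂ) 1))) := by
  rw [map_norm_sq_restrict_ball]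
  exact hκ.smul_measure _

theorem integrableOn_comp_norm_sq {κ : ℝ → ℝ} (hκ : IntegrableOn κ (Ioo 0 1)) :
    IntegrableOn (fun u : ℂ => κ (‖u‖ ^ 2)) (Metric.ball (0 : ℂ) 1) := by
  have := (integrable_map_measure (aestronglyMeasurable_of_smul_pi hκ.1)
    (by fun_prop : AEMeasurable (fun u : ℂ => ‖u‖ ^ 2) _)).mp (by
      rw [map_norm_sq_restrict_ball]
      exact Integrable.smul_measure hκ ENNReal.ofReal_ne_top)
  exact this

theorem setIntegral_comp_norm_sq {κ : ℝ → ℝ}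
    (hκ : AEStronglyMeasurable κ (volume.restrict (Ioo (0 : ℝ) 1))) :
    ∫ u in Metric.ball (0 : ℂ) 1, κ (‖u‖ ^ 2) = Real.pi * ∫ x in Ioo 0 1, κ x := by
  rw [← integral_map (f := κ) (φ := fun u : ℂ => ‖u‖ ^ 2) (by fun_prop)
    (aestronglyMeasurable_of_smul_pi hκ), map_norm_sq_restrict_ball, integral_smul_measure,
    ENNReal.toReal_ofReal Real.pi_pos.le, smul_eq_mul]

theorem image_sq_Ioo {a : ℝ} (ha : 0 ≤ a) : (fun r : ℝ => r ^ 2) '' Ioo a 1 = Ioo (a ^ 2) 1 := by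
  ext x
  constructor
  · rintro ⟨r, ⟨h1, h2⟩, rfl⟩
    exact ⟨by nlinarith, by nlinarith⟩
  · rintro ⟨h1, h2⟩
    have hx : 0 ≤ x := (sq_nonneg a).trans h1.le
    refine ⟨Real.sqrt x, ⟨Real.lt_sqrt_of_sq_lt h1, ?_⟩, Real.sq_sqrt hx⟩
    rw [Real.sqrt_lt' one_pos]
    simpa using h2

theorem integrableOn_mul_comp_sq {κ : ℝ → ℝ} (hκ : IntegrableOn κ (Ioo 0 1)) :
    IntegrableOn (fun r => r * κ (r ^ 2)) (Ioo 0 1) := by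
  have himg := image_sq_Ioo le_rfl
  rw [zero_pow two_ne_zero] at himg
  rw [← himg, integrableOn_image_iff_integrableOn_abs_deriv_smul measurableSet_Ioo
    (f' := fun r => 2 * r) (fun x _ => by simpa using (hasDerivAt_pow 2 x).hasDerivWithinAt)
    (fun x hx y hy h => (sq_eq_sq₀ hx.1.le hy.1.le).mp h)] at hκ
  have := hκ.const_mul (1 / 2)
  refine IntegrableOn.congr_fun this (fun r hr => ?_) measurableSet_Ioo
  simp only [smul_eq_mul]
  rw [abs_of_pos (by linarith [hr.1])]
  ring

theorem setIntegral_Ioo_comp_sq (κ : ℝ → ℝ) {a : ℝ} (ha : 0 ≤ a) :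
    ∫ r in Ioo a 1, 2 * r * κ (r ^ 2) = ∫ x in Ioo (a ^ 2) 1, κ x := by
  rw [← image_sq_Ioo ha, integral_image_eq_integral_abs_deriv_smul measurableSet_Ioo
    (f' := fun r => 2 * r) (fun x _ => by simpa using (hasDerivAt_pow 2 x).hasDerivWithinAt)
    (fun x hx y hy h => (sq_eq_sq₀ (ha.trans hx.1.le) (ha.trans hy.1.le)).mp h)]
  refine setIntegral_congr_fun measurableSet_Ioo fun r hr => ?_
  simp only [smul_eq_mul]
  rw [abs_of_pos (by linarith [hr.1])]

theorem circleMap_zero_mem_ball {r θ : ℝ} (h : r ∈ Ioo (0 : ℝ) 1) :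
    circleMap 0 r θ ∈ Metric.ball (0 : ℂ) 1 := by
  simpa [circleMap, abs_of_pos h.1] using h.2

theorem norm_circleMap_zero_of_pos {r θ : ℝ} (h : 0 < r) : ‖circleMap 0 r θ‖ = r := by
  simp [abs_of_pos h]

/-- Polar coordinates for the product of a radial function and an arbitrary one. -/
theorem setIntegral_ball_radial_mul_of_integrable {κ : ℝ → ℝ} {G : ℂ → ℂ}
    (hint : Integrable (fun p : ℝ × ℝ => ((p.1 * κ (p.1 ^ 2) : ℝ) : ℂ) * G (circleMap 0 p.1 p.2))
      ((volume.restrict (Ioo (0 : ℝ) 1)).prod (volume.restrict (Ioo (-Real.pi) Real.pi)))) :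
    ∫ u in Metric.ball (0 : ℂ) 1, (κ (‖u‖ ^ 2) : ℂ) * G u
      = ∫ r in Ioo (0 : ℝ) 1, ((r * κ (r ^ 2) : ℝ) : ℂ) *
          ∫ θ in Ioo (-Real.pi) Real.pi, G (circleMap 0 r θ) := by
  set f : ℂ → ℂ := fun u => (κ (‖u‖ ^ 2) : ℂ) * G u with hf
  have hpt : ∀ p : ℝ × ℝ, Complex.polarCoord.symm p = circleMap 0 p.1 p.2 := by
    intro p
    rw [Complex.polarCoord_symm_apply, circleMap, Complex.exp_mul_I]
    push_cast
    simp
  rw [← integral_indicator Metric.isOpen_ball.measurableSet,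
    ← Complex.integral_comp_polarCoord_symm, polarCoord_target]
  have hsub : Ioo (0 : ℝ) 1 ×ˢ Ioo (-Real.pi) Real.pi
      ⊆ Ioi (0 : ℝ) ×ˢ Ioo (-Real.pi) Real.pi := prod_mono (fun x hx => hx.1) subset_rfl
  rw [setIntegral_eq_of_subset_of_forall_sdiff_eq_zero
    (measurableSet_Ioi.prod measurableSet_Ioo) hsub]
  · have hcongr : ∀ p ∈ Ioo (0 : ℝ) 1 ×ˢ Ioo (-Real.pi) Real.pi,
        p.1 • (Metric.ball (0 : ℂ) 1).indicator f (Complex.polarCoord.symm p)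
          = ((p.1 * κ (p.1 ^ 2) : ℝ) : ℂ) * G (circleMap 0 p.1 p.2) := by
      rintro ⟨r, θ⟩ ⟨hr, -⟩
      rw [hpt, indicator_of_mem (circleMap_zero_mem_ball hr), hf]
      simp only [norm_circleMap_zero_of_pos hr.1, Complex.real_smul]
      push_cast
      ring
    rw [setIntegral_congr_fun (measurableSet_Ioo.prod measurableSet_Ioo) hcongr]
    rw [Measure.volume_eq_prod, setIntegral_prod]
    · simp only [integral_const_mul]
    · rw [IntegrableOn, ← Measure.prod_restrict]
      exact hint
  · rintro ⟨r, θ⟩ ⟨⟨hr, hθ⟩, hn⟩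
    have hr' : 0 < r := hr
    have hle : 1 ≤ r := by
      by_contra h
      exact hn ⟨⟨hr', not_le.mp h⟩, hθ⟩
    rw [hpt, indicator_of_notMem, smul_zero]
    rw [mem_ball_zero_iff, norm_circleMap_zero_of_pos hr']
    exact not_lt.mpr hle

theorem setIntegral_ball_radial_mul {κ : ℝ → ℝ} (hκ : IntegrableOn κ (Ioo 0 1)) {G : ℂ → ℂ}
    (hG : ContinuousOn G (Metric.ball 0 1)) {C : ℝ}
    (hC : ∀ u ∈ Metric.ball (0 : ℂ) 1, κ (‖u‖ ^ 2) ≠ 0 → ‖G u‖ ≤ C) :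
    ∫ u in Metric.ball (0 : ℂ) 1, (κ (‖u‖ ^ 2) : ℂ) * G u
      = ∫ r in Ioo (0 : ℝ) 1, ((r * κ (r ^ 2) : ℝ) : ℂ) *
          ∫ θ in Ioo (-Real.pi) Real.pi, G (circleMap 0 r θ) := by
  apply setIntegral_ball_radial_mul_of_integrable
  have h1 : Integrable (fun p : ℝ × ℝ => ((p.1 * κ (p.1 ^ 2) : ℝ) : ℂ) * (1 : ℂ))
      ((volume.restrict (Ioo (0 : ℝ) 1)).prod (volume.restrict (Ioo (-Real.pi) Real.pi))) :=
    Integrable.mul_prod (integrableOn_mul_comp_sq hκ).ofReal (integrable_const (1 : ℂ))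
  simp only [mul_one] at h1
  refine (h1.norm.const_mul C).mono' (h1.1.mul ?_) ?_
  · rw [Measure.prod_restrict]
    apply ContinuousOn.aestronglyMeasurable _ (measurableSet_Ioo.prod measurableSet_Ioo)
    apply hG.comp
    · unfold circleMap; fun_prop
    · rintro ⟨r, θ⟩ ⟨hr, -⟩
      exact circleMap_zero_mem_ball hr
  · rw [Measure.prod_restrict]
    filter_upwards [ae_restrict_mem (measurableSet_Ioo.prod measurableSet_Ioo)] with p hp
    rw [norm_mul, mul_comm]
    rcases eq_or_ne (κ (p.1 ^ 2)) 0 with h0 | h0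
    · simp [h0]
    · refine mul_le_mul_of_nonneg_right (hC _ (circleMap_zero_mem_ball hp.1) ?_) (norm_nonneg _)
      rwa [norm_circleMap_zero_of_pos hp.1.1]

theorem continuousOn_laplacian {G : ℂ → ℂ} (hG : ContDiffOn ℝ 2 G (Metric.ball 0 1)) :
    ContinuousOn (Laplacian.laplacian G) (Metric.ball 0 1) := by
  have h1 : ContDiffOn ℝ 1 (fderiv ℝ G) (Metric.ball 0 1) :=
    hG.fderiv_of_isOpen Metric.isOpen_ball (by norm_num)
  have h2 : ContinuousOn (fderiv ℝ (fderiv ℝ G)) (Metric.ball 0 1) :=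
    h1.continuousOn_fderiv_of_isOpen Metric.isOpen_ball le_rfl
  have h3 : Laplacian.laplacian G = fun z => fderiv ℝ (fderiv ℝ G) z 1 1
      + fderiv ℝ (fderiv ℝ G) z Complex.I Complex.I := by
    ext z; exact laplacian_eq_fderiv_fderiv G z
  rw [h3]
  exact ((h2.clm_apply continuousOn_const).clm_apply continuousOn_const).add
    ((h2.clm_apply continuousOn_const).clm_apply continuousOn_const)

theorem integrableOn_log_div {r : ℝ} : IntegrableOn (fun s => Real.log (r / s)) (Ioo 0 r) := by
  rcases le_or_gt r 0 with hr | hr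
  · simp [Ioo_eq_empty (not_lt.mpr hr)]
  have h : IntegrableOn (fun s => Real.log r - Real.log s) (Ioo 0 r) := by
    refine (integrable_const _).sub ?_
    have := (intervalIntegral.intervalIntegrable_log' (a := 0) (b := r)).1
    exact this.mono_set Ioo_subset_Ioc_self
  refine h.congr_fun (fun s hs => ?_) measurableSet_Ioo
  exact (Real.log_div hr.ne' hs.1.ne').symm

/-- Integration by parts against the fundamental solution `log (r / σ)` of the radial Laplacian. -/
theorem setIntegral_log_div_mul {r : ℝ} (hr : 0 < r) {g d d2 : ℝ → ℂ}
    (hg : ContinuousOn g (Icc 0 r)) (hd : ContinuousOn d (Icc 0 r))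
    (hg' : ∀ σ ∈ Ioo 0 r, HasDerivAt g (d σ) σ) (hd' : ∀ σ ∈ Ioo 0 r, HasDerivAt d (d2 σ) σ)
    (hint : IntegrableOn (fun σ => ((Real.log (r / σ) : ℝ) : ℂ) * ((σ : ℂ) * d2 σ + d σ))
      (Ioo 0 r)) :
    ∫ σ in Ioo 0 r, ((Real.log (r / σ) : ℝ) : ℂ) * ((σ : ℂ) * d2 σ + d σ) = g r - g 0 := by
  rw [← integral_Ioc_eq_integral_Ioo, ← intervalIntegral.integral_of_le hr.le]
  have hlogc : Tendsto (fun σ : ℝ => ((σ * Real.log (r / σ) : ℝ) : ℂ)) (𝓝[>] 0) (𝓝 0) := by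
    have h1 : Tendsto (fun σ : ℝ => Real.log r * σ - Real.log σ * σ ^ (1 : ℝ)) (𝓝[>] 0)
        (𝓝 0) := by
      have h2 : Tendsto (fun σ : ℝ => Real.log r * σ) (𝓝[>] 0) (𝓝 0) := by
        have : Tendsto (fun σ : ℝ => Real.log r * σ) (𝓝 0) (𝓝 (Real.log r * 0)) :=
          (continuous_const.mul continuous_id).tendsto 0
        rw [mul_zero] at this
        exact this.mono_left nhdsWithin_le_nhds
      simpa using h2.sub (tendsto_log_mul_rpow_nhdsGT_zero one_pos)
    have h3 : Tendsto (fun σ : ℝ => σ * Real.log (r / σ)) (𝓝[>] 0) (𝓝 0) := by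
      refine h1.congr' ?_
      filter_upwards [self_mem_nhdsWithin] with σ hσ
      rw [Real.log_div hr.ne' (ne_of_gt hσ), Real.rpow_one]
      ring
    exact (Complex.continuous_ofReal.tendsto' 0 0 Complex.ofReal_zero).comp h3
  have h0r : (0 : ℝ) ∈ Icc 0 r := ⟨le_rfl, hr.le⟩
  have hrr : r ∈ Icc 0 r := ⟨hr.le, le_rfl⟩
  have hn0 : 𝓝[>] (0 : ℝ) ≤ 𝓝[Icc 0 r] 0 := by
    rw [← nhdsWithin_Ioo_eq_nhdsGT hr]
    exact nhdsWithin_mono _ Ioo_subset_Icc_self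
  have hnr : 𝓝[<] r ≤ 𝓝[Icc 0 r] r := by
    rw [← nhdsWithin_Ioo_eq_nhdsLT hr]
    exact nhdsWithin_mono _ Ioo_subset_Icc_self
  rw [intervalIntegral.integral_eq_sub_of_hasDerivAt_of_tendsto hr
    (f := fun σ => ((σ * Real.log (r / σ) : ℝ) : ℂ) * d σ + g σ) (fa := g 0) (fb := g r)]
  · intro σ hσ
    have h1 : HasDerivAt (fun σ : ℝ => σ * Real.log (r / σ)) (Real.log (r / σ) - 1) σ := by
      have h2 : HasDerivAt (fun σ : ℝ => r / σ) (-r / σ ^ 2) σ := by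
        simpa [div_eq_mul_inv] using (hasDerivAt_inv hσ.1.ne').const_mul r
      have h3 := (hasDerivAt_id σ).mul (h2.log (div_pos hr hσ.1).ne')
      refine h3.congr_deriv ?_
      have := hσ.1.ne'
      have := hr.ne'
      simp only [id]
      field_simp
      ring
    refine ((h1.ofReal_comp.mul (hd' σ hσ)).add (hg' σ hσ)).congr_deriv ?_
    push_cast
    ring
  · rw [intervalIntegrable_iff_integrableOn_Ioo_of_le hr.le]
    exact hint
  · simpa using (hlogc.mul ((hd 0 h0r).tendsto.mono_left hn0)).add
      ((hg 0 h0r).tendsto.mono_left hn0)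
  · have h3 : Tendsto (fun σ : ℝ => ((σ * Real.log (r / σ) : ℝ) : ℂ)) (𝓝[<] r) (𝓝 0) := by
      have hcont : ContinuousAt (fun σ : ℝ => ((σ * Real.log (r / σ) : ℝ) : ℂ)) r := by
        have hrne := hr.ne'
        have : ContinuousAt (fun σ : ℝ => Real.log (r / σ)) r := by
          apply ContinuousAt.log
          · exact continuousAt_const.div continuousAt_id hrne
          · simp [hrne]
        fun_prop
      have := hcont.tendsto.mono_left (nhdsWithin_le_nhds (s := Iio r))
      simpa [div_self hr.ne'] using this
    simpa using (h3.mul ((hd r hrr).tendsto.mono_left hnr)).add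
      ((hg r hrr).tendsto.mono_left hnr)

theorem hasDerivAt_clm_apply {L : ℝ → ℂ →L[ℝ] ℂ} {L' : ℂ →L[ℝ] ℂ} {v : ℝ → ℂ} {v' : ℂ} {s : ℝ}
    (hL : HasDerivAt L L' s) (hv : HasDerivAt v v' s) :
    HasDerivAt (fun s => L s (v s)) (L' (v s) + L s v') s :=
  HasDerivAt.clm_apply hL hv

set_option maxHeartbeats 1000000 in
/-- The circular means of `G` in terms of the Laplacian: Green's formula with the fundamental
solution `log (r / |u|)`, in polar coordinates. The integrand `log (r/σ) σ ΔG` is split into a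
radial derivative `X`, integrated along rays, and an angular derivative `Y`, which integrates
to zero on every circle. -/
theorem circle_integral_sub_eq {G : ℂ → ℂ} (hG : ContDiffOn ℝ 2 G (Metric.ball 0 1)) {r : ℝ}
    (hr : r ∈ Ioo (0 : ℝ) 1) :
    (∫ θ in Ioo (-Real.pi) Real.pi, G (circleMap 0 r θ)) - (2 * Real.pi : ℝ) * G 0
      = ∫ σ in Ioo 0 r, ((σ * Real.log (r / σ) : ℝ) : ℂ) *
          ∫ θ in Ioo (-Real.pi) Real.pi, Laplacian.laplacian G (circleMap 0 σ θ) := by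
  set e : ℝ → ℂ := fun θ => Complex.exp (θ * Complex.I) with he
  have hcirc : ∀ σ θ : ℝ, circleMap 0 σ θ = σ • e θ := by
    intro σ θ
    simp [circleMap, he]
  have hen : ∀ θ, ‖e θ‖ = 1 := fun θ => Complex.norm_exp_ofReal_mul_I θ
  set D1 := fderiv ℝ G with hD1
  set D2 := fderiv ℝ D1 with hD2
  have hc1 : ContDiffOn ℝ 1 D1 (Metric.ball 0 1) :=
    hG.fderiv_of_isOpen Metric.isOpen_ball (by norm_num)
  have hcc1 : ContinuousOn D1 (Metric.ball 0 1) := hc1.continuousOn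
  have hcc2 : ContinuousOn D2 (Metric.ball 0 1) :=
    hc1.continuousOn_fderiv_of_isOpen Metric.isOpen_ball le_rfl
  have hd1 : ∀ z ∈ Metric.ball (0 : ℂ) 1, HasFDerivAt G (D1 z) z := fun z hz =>
    ((hG.differentiableOn (by norm_num)).differentiableAt
      (Metric.isOpen_ball.mem_nhds hz)).hasFDerivAt
  have hd2 : ∀ z ∈ Metric.ball (0 : ℂ) 1, HasFDerivAt D1 (D2 z) z := fun z hz =>
    ((hc1.differentiableOn (by norm_num)).differentiableAt
      (Metric.isOpen_ball.mem_nhds hz)).hasFDerivAt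
  have hmem : ∀ σ ∈ Icc 0 r, ∀ θ, σ • e θ ∈ Metric.ball (0 : ℂ) 1 := by
    intro σ hσ θ
    rw [mem_ball_zero_iff, norm_smul, hen, mul_one, Real.norm_of_nonneg hσ.1]
    exact hσ.2.trans_lt hr.2
  have hec : Continuous e := by fun_prop
  have hde : ∀ θ, HasDerivAt e (Complex.I * e θ) θ := by
    intro θ
    have := ((Complex.ofRealCLM.hasDerivAt (x := θ)).mul_const Complex.I).cexp
    simpa [he, mul_comm] using this
  -- the two bounded factors of the radial and the angular derivative
  set x : ℝ × ℝ → ℂ := fun p => (p.1 : ℂ) * D2 (p.1 • e p.2) (e p.2) (e p.2)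
    + D1 (p.1 • e p.2) (e p.2) with hx
  set y : ℝ × ℝ → ℂ := fun p => (p.1 : ℂ) * D2 (p.1 • e p.2) (Complex.I * e p.2)
    (Complex.I * e p.2) - D1 (p.1 • e p.2) (e p.2) with hy
  have hpc : ContinuousOn (fun p : ℝ × ℝ => p.1 • e p.2) (Icc 0 r ×ˢ Icc (-Real.pi) Real.pi) := by
    fun_prop
  have hpm : MapsTo (fun p : ℝ × ℝ => p.1 • e p.2) (Icc 0 r ×ˢ Icc (-Real.pi) Real.pi)
      (Metric.ball 0 1) := fun p hp => hmem p.1 hp.1 p.2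
  have hcD1 := hcc1.comp hpc hpm
  have hcD2 := hcc2.comp hpc hpm
  have hce : ContinuousOn (fun p : ℝ × ℝ => e p.2) (Icc 0 r ×ˢ Icc (-Real.pi) Real.pi) := by
    fun_prop
  have hxc : ContinuousOn x (Icc 0 r ×ˢ Icc (-Real.pi) Real.pi) := by
    refine ContinuousOn.add (ContinuousOn.mul (by fun_prop) ?_) ?_
    · exact (hcD2.clm_apply hce).clm_apply hce
    · exact hcD1.clm_apply hce
  have hyc : ContinuousOn y (Icc 0 r ×ˢ Icc (-Real.pi) Real.pi) := by
    refine ContinuousOn.sub (ContinuousOn.mul (by fun_prop) ?_) ?_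
    · exact (hcD2.clm_apply (hce.const_smul Complex.I)).clm_apply (hce.const_smul Complex.I)
    · exact hcD1.clm_apply hce
  have hK : IsCompact (Icc 0 r ×ˢ Icc (-Real.pi) Real.pi) := isCompact_Icc.prod isCompact_Icc
  obtain ⟨Cx, hCx⟩ := hK.exists_bound_of_continuousOn hxc
  set S := Ioo 0 r ×ˢ Ioo (-Real.pi) Real.pi with hS
  have hSK : S ⊆ Icc 0 r ×ˢ Icc (-Real.pi) Real.pi :=
    prod_mono Ioo_subset_Icc_self Ioo_subset_Icc_self
  have hSm : MeasurableSet S := measurableSet_Ioo.prod measurableSet_Ioo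
  have hlog : Integrable (fun p : ℝ × ℝ => ((Real.log (r / p.1) : ℝ) : ℂ) * (1 : ℂ))
      ((volume.restrict (Ioo 0 r)).prod (volume.restrict (Ioo (-Real.pi) Real.pi))) :=
    Integrable.mul_prod integrableOn_log_div.ofReal (integrable_const (1 : ℂ))
  simp only [mul_one] at hlog
  have hXint : Integrable (fun p : ℝ × ℝ => ((Real.log (r / p.1) : ℝ) : ℂ) * x p)
      ((volume.restrict (Ioo 0 r)).prod (volume.restrict (Ioo (-Real.pi) Real.pi))) := by
    refine hlog.mul_bdd (c := Cx) ?_ ?_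
    · rw [Measure.prod_restrict]
      exact (hxc.mono hSK).aestronglyMeasurable hSm
    · rw [Measure.prod_restrict]
      filter_upwards [ae_restrict_mem hSm] with p hp
      exact hCx p (hSK hp)
  -- integration along rays
  have hray : ∀ θ ∈ Ioo (-Real.pi) Real.pi,
      ∫ σ in Ioo 0 r, ((Real.log (r / σ) : ℝ) : ℂ) * x (σ, θ) = G (circleMap 0 r θ) - G 0 := by
    intro θ hθ
    have hxθ : ContinuousOn (fun σ => x (σ, θ)) (Icc 0 r) :=
      hxc.comp (by fun_prop) fun σ hσ => ⟨hσ, hθ.1.le, hθ.2.le⟩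
    have hint : IntegrableOn (fun σ => ((Real.log (r / σ) : ℝ) : ℂ) * x (σ, θ)) (Ioo 0 r) := by
      refine Integrable.mul_bdd (c := Cx) integrableOn_log_div.ofReal
        ((hxθ.mono Ioo_subset_Icc_self).aestronglyMeasurable measurableSet_Ioo) ?_
      filter_upwards [ae_restrict_mem measurableSet_Ioo] with σ hσ
      exact hCx _ ⟨Ioo_subset_Icc_self hσ, hθ.1.le, hθ.2.le⟩
    have hp : ∀ σ : ℝ, HasDerivAt (fun σ : ℝ => σ • e θ) (e θ) σ := fun σ => by
      simpa using (hasDerivAt_id σ).smul_const (e θ)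
    have hc0 : ContinuousOn (fun σ : ℝ => σ • e θ) (Icc 0 r) := by fun_prop
    have hGc : ContinuousOn (fun σ : ℝ => G (σ • e θ)) (Icc 0 r) :=
      hG.continuousOn.comp hc0 fun σ hσ => hmem σ hσ θ
    have hDc : ContinuousOn (fun σ : ℝ => D1 (σ • e θ) (e θ)) (Icc 0 r) :=
      (hcc1.comp hc0 fun σ hσ => hmem σ hσ θ).clm_apply continuousOn_const
    have := setIntegral_log_div_mul hr.1 hGc hDc
      (fun σ hσ => (hd1 _ (hmem σ (Ioo_subset_Icc_self hσ) θ)).comp_hasDerivAt σ (hp σ))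
      (d2 := fun σ => D2 (σ • e θ) (e θ) (e θ))
      (fun σ hσ => by
        have h1 : HasDerivAt (fun σ : ℝ => D1 (σ • e θ)) (D2 (σ • e θ) (e θ)) σ :=
          (hd2 _ (hmem σ (Ioo_subset_Icc_self hσ) θ)).comp_hasDerivAt σ (hp σ)
        simpa using hasDerivAt_clm_apply h1 (hasDerivAt_const σ (e θ))) hint
    rw [this, hcirc, zero_smul]
  -- integration along circles
  have hcircle : ∀ σ ∈ Ioo 0 r, ∫ θ in Ioo (-Real.pi) Real.pi, y (σ, θ) = 0 := by
    intro σ hσ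
    have hσm := hmem σ (Ioo_subset_Icc_self hσ)
    have hyσ : ContinuousOn (fun θ => y (σ, θ)) (Icc (-Real.pi) Real.pi) :=
      hyc.comp (by fun_prop) fun θ hθ => ⟨Ioo_subset_Icc_self hσ, hθ⟩
    have hpi : -Real.pi ≤ Real.pi := by linarith [Real.pi_pos]
    rw [← integral_Ioc_eq_integral_Ioo, ← intervalIntegral.integral_of_le hpi]
    rw [intervalIntegral.integral_eq_sub_of_hasDerivAt
      (f := fun θ => D1 (σ • e θ) (Complex.I * e θ))]
    · simp [he, Complex.exp_neg]
    · intro θ _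
      have hp : HasDerivAt (fun θ : ℝ => σ • e θ) (σ • (Complex.I * e θ)) θ :=
        (hde θ).const_smul σ
      have h1 : HasDerivAt (fun θ : ℝ => D1 (σ • e θ)) (D2 (σ • e θ) (σ • (Complex.I * e θ))) θ :=
        (hd2 _ (hσm θ)).comp_hasDerivAt θ hp
      refine (hasDerivAt_clm_apply h1 ((hde θ).const_mul Complex.I)).congr_deriv ?_
      have hII : Complex.I * (Complex.I * e θ) = -e θ := by
        rw [← mul_assoc, Complex.I_mul_I]; ring
      have hsm : D2 (σ • e θ) (σ • (Complex.I * e θ)) = σ • D2 (σ • e θ) (Complex.I * e θ) :=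
        (D2 (σ • e θ)).map_smul σ _
      simp only [hy, hII, map_neg]
      rw [hsm]
      simp only [smul_apply, Complex.real_smul]
      ring
    · apply ContinuousOn.intervalIntegrable
      rwa [uIcc_of_le hpi]
  have hxy : ∀ σ θ : ℝ, x (σ, θ) + y (σ, θ) = (σ : ℂ) * Laplacian.laplacian G (circleMap 0 σ θ) := by
    intro σ θ
    have h := bilin_self_add_bilin_mul_I (D2 (σ • e θ)) (e θ)
    rw [hen, one_pow, Complex.ofReal_one, one_mul] at h
    rw [laplacian_eq_fderiv_fderiv, hcirc, ← h]
    simp only [hx, hy]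
    ring
  have hlhs : (∫ θ in Ioo (-Real.pi) Real.pi, G (circleMap 0 r θ)) - (2 * Real.pi : ℝ) * G 0
      = ∫ θ in Ioo (-Real.pi) Real.pi, ∫ σ in Ioo 0 r, ((Real.log (r / σ) : ℝ) : ℂ) * x (σ, θ) := by
    rw [setIntegral_congr_fun measurableSet_Ioo hray, integral_sub _ (integrable_const _)]
    · simp only [integral_const, measureReal_restrict_apply_univ, Real.volume_real_Ioo_of_le
        (by linarith [Real.pi_pos] : -Real.pi ≤ Real.pi), Complex.real_smul]
      congr 3
      ring
    · have : ContinuousOn (fun θ => G (circleMap 0 r θ)) (Icc (-Real.pi) Real.pi) :=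
        hG.continuousOn.comp (by unfold circleMap; fun_prop)
          fun θ _ => circleMap_zero_mem_ball hr
      exact (this.integrableOn_compact isCompact_Icc).mono_set Ioo_subset_Icc_self
  rw [hlhs, ← integral_integral_swap (f := fun σ θ => ((Real.log (r / σ) : ℝ) : ℂ) * x (σ, θ))
    hXint]
  refine setIntegral_congr_fun measurableSet_Ioo fun σ hσ => ?_
  have hcontIcc : ∀ {q : ℝ × ℝ → ℂ}, ContinuousOn q (Icc 0 r ×ˢ Icc (-Real.pi) Real.pi) →
      IntegrableOn (fun θ => q (σ, θ)) (Ioo (-Real.pi) Real.pi) := by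
    intro q hq
    have : ContinuousOn (fun θ => q (σ, θ)) (Icc (-Real.pi) Real.pi) :=
      hq.comp (by fun_prop) fun θ hθ => ⟨Ioo_subset_Icc_self hσ, hθ⟩
    exact (this.integrableOn_compact isCompact_Icc).mono_set Ioo_subset_Icc_self
  have h1 := integral_add (hcontIcc hxc) (hcontIcc hyc)
  rw [hcircle σ hσ, add_zero] at h1
  simp only [hxy, integral_const_mul] at h1
  simp only [integral_const_mul]
  rw [← h1]
  push_cast
  ring

theorem integrableOn_of_mul_comp_sq {κ : ℝ → ℝ}
    (hκ : IntegrableOn (fun r => r * κ (r ^ 2)) (Ioo 0 1)) : IntegrableOn κ (Ioo 0 1) := by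
  have himg := image_sq_Ioo le_rfl
  rw [zero_pow two_ne_zero] at himg
  rw [← himg, integrableOn_image_iff_integrableOn_abs_deriv_smul measurableSet_Ioo
    (f' := fun r => 2 * r) (fun x _ => by simpa using (hasDerivAt_pow 2 x).hasDerivWithinAt)
    (fun x hx y hy h => (sq_eq_sq₀ hx.1.le hy.1.le).mp h)]
  have := hκ.const_mul 2
  refine IntegrableOn.congr_fun this (fun r hr => ?_) measurableSet_Ioo
  simp only [smul_eq_mul]
  rw [abs_of_pos (by linarith [hr.1])]
  ring

/-- The radial solution `u ↦ b(|u|²)` of `Δ b = κ(|u|²)` on the punctured disk which vanishes,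
together with its normal derivative, on the unit circle. -/
noncomputable def radialPotential (κ : ℝ → ℝ) (s : ℝ) : ℝ :=
  1 / 4 * ∫ x in Ioo s 1, Real.log (x / s) * κ x

theorem radialPotential_sq (κ : ℝ → ℝ) {σ : ℝ} (hσ : 0 < σ) :
    radialPotential κ (σ ^ 2) = ∫ r in Ioo σ 1, Real.log (r / σ) * (r * κ (r ^ 2)) := by
  rw [radialPotential, ← setIntegral_Ioo_comp_sq (fun x => Real.log (x / σ ^ 2) * κ x) hσ.le,
    ← integral_const_mul]
  refine setIntegral_congr_fun measurableSet_Ioo fun r hr => ?_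
  rw [← div_pow, Real.log_pow]
  push_cast
  ring

/-- The kernel `σ log (r / σ)` of the triangle `σ < r`. -/
noncomputable def logKernel (p : ℝ × ℝ) : ℝ := if p.2 < p.1 then p.2 * Real.log (p.1 / p.2) else 0

theorem measurable_logKernel : Measurable logKernel := by
  unfold logKernel
  refine Measurable.ite (measurableSet_lt measurable_snd measurable_fst) ?_ measurable_const
  fun_prop

theorem norm_logKernel_le {r σ : ℝ} (hr : r ∈ Ioo (0 : ℝ) 1) (hσ : σ ∈ Ioo (0 : ℝ) 1) :
    ‖logKernel (r, σ)‖ ≤ 1 := by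
  unfold logKernel
  simp only
  split_ifs with h
  · have h1 : 1 ≤ r / σ := by rw [le_div_iff₀ hσ.1]; linarith
    have h2 := Real.log_nonneg h1
    have h3 := Real.log_le_sub_one_of_pos (by linarith : 0 < r / σ)
    rw [Real.norm_of_nonneg (mul_nonneg hσ.1.le h2)]
    calc σ * Real.log (r / σ) ≤ σ * (r / σ) := by
          apply mul_le_mul_of_nonneg_left _ hσ.1.le
          linarith
      _ = r := mul_div_cancel₀ r hσ.1.ne'
      _ ≤ 1 := hr.2.le
  · simp

theorem integrable_mul_logKernel {κ : ℝ → ℝ} (hκ : IntegrableOn κ (Ioo 0 1)) :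
    Integrable (fun p : ℝ × ℝ => p.1 * κ (p.1 ^ 2) * logKernel p)
      ((volume.restrict (Ioo (0 : ℝ) 1)).prod (volume.restrict (Ioo (0 : ℝ) 1))) := by
  have h1 : Integrable (fun p : ℝ × ℝ => (p.1 * κ (p.1 ^ 2)) * (1 : ℝ))
      ((volume.restrict (Ioo (0 : ℝ) 1)).prod (volume.restrict (Ioo (0 : ℝ) 1))) :=
    Integrable.mul_prod (integrableOn_mul_comp_sq hκ) (integrable_const (1 : ℝ))
  simp only [mul_one] at h1
  refine h1.mul_bdd (c := 1) measurable_logKernel.aestronglyMeasurable ?_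
  rw [Measure.prod_restrict]
  filter_upwards [ae_restrict_mem (measurableSet_Ioo.prod measurableSet_Ioo)] with p hp
  exact norm_logKernel_le hp.1 hp.2

theorem integral_mul_logKernel (κ : ℝ → ℝ) {σ : ℝ} (hσ : σ ∈ Ioo (0 : ℝ) 1) :
    ∫ r in Ioo (0 : ℝ) 1, r * κ (r ^ 2) * logKernel (r, σ)
      = σ * radialPotential κ (σ ^ 2) := by
  rw [radialPotential_sq κ hσ.1, ← integral_const_mul]
  have hsub : Ioo σ 1 ⊆ Ioo 0 1 := Ioo_subset_Ioo_left hσ.1.le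
  rw [setIntegral_eq_of_subset_of_forall_sdiff_eq_zero measurableSet_Ioo hsub]
  · refine setIntegral_congr_fun measurableSet_Ioo fun r hr => ?_
    simp only [logKernel, if_pos hr.1]
    ring
  · rintro r ⟨hr, hn⟩
    have : ¬ σ < r := fun h => hn ⟨h, hr.2⟩
    simp [logKernel, this]

theorem integrableOn_radialPotential {κ : ℝ → ℝ} (hκ : IntegrableOn κ (Ioo 0 1)) :
    IntegrableOn (radialPotential κ) (Ioo 0 1) := by
  apply integrableOn_of_mul_comp_sq
  refine IntegrableOn.congr_fun (integrable_mul_logKernel hκ).integral_prod_right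
    (fun σ hσ => ?_) measurableSet_Ioo
  exact integral_mul_logKernel κ hσ

/-- Green's formula on the disk for a function against a radial density. -/
theorem setIntegral_ball_radial_mul_eq {κ : ℝ → ℝ} (hκ : IntegrableOn κ (Ioo 0 1)) {G : ℂ → ℂ}
    (hG : ContDiffOn ℝ 2 G (Metric.ball 0 1))
    {C : ℝ} (hC : ∀ z ∈ Metric.ball (0 : ℂ) 1, ‖G z‖ ≤ C)
    {M : ℝ} (hM : ∀ z ∈ Metric.ball (0 : ℂ) 1, ‖Laplacian.laplacian G z‖ ≤ M) :
    ∫ u in Metric.ball (0 : ℂ) 1, (κ (‖u‖ ^ 2) : ℂ) * G u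
      = (Real.pi * ∫ x in Ioo 0 1, κ x : ℝ) * G 0 +
        ∫ u in Metric.ball (0 : ℂ) 1,
          (radialPotential κ (‖u‖ ^ 2) : ℂ) * Laplacian.laplacian G u := by
  set A : ℝ → ℂ := fun r => ∫ θ in Ioo (-Real.pi) Real.pi, G (circleMap 0 r θ) with hA
  set D : ℝ → ℂ := fun r =>
    ∫ θ in Ioo (-Real.pi) Real.pi, Laplacian.laplacian G (circleMap 0 r θ) with hD
  have hLc := continuousOn_laplacian hG
  rw [setIntegral_ball_radial_mul hκ hG.continuousOn fun u hu _ => hC u hu,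
    setIntegral_ball_radial_mul (integrableOn_radialPotential hκ) hLc fun u hu _ => hM u hu]
  have hk := integrableOn_mul_comp_sq hκ
  have hDm : AEStronglyMeasurable D (volume.restrict (Ioo (0 : ℝ) 1)) := by
    have h1 : AEStronglyMeasurable
        (fun p : ℝ × ℝ => Laplacian.laplacian G (circleMap 0 p.1 p.2))
        ((volume.restrict (Ioo (0 : ℝ) 1)).prod (volume.restrict (Ioo (-Real.pi) Real.pi))) := by
      rw [Measure.prod_restrict]
      apply ContinuousOn.aestronglyMeasurable _ (measurableSet_Ioo.prod measurableSet_Ioo)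
      apply hLc.comp
      · unfold circleMap; fun_prop
      · rintro ⟨r, θ⟩ ⟨hr, -⟩
        exact circleMap_zero_mem_ball hr
    exact h1.integral_prod_right'
  have hDb : ∀ σ ∈ Ioo (0 : ℝ) 1, ‖D σ‖ ≤ M * (2 * Real.pi) := by
    intro σ hσ
    have := norm_setIntegral_le_of_norm_le_const (μ := volume) (s := Ioo (-Real.pi) Real.pi)
      (f := fun θ => Laplacian.laplacian G (circleMap 0 σ θ)) (C := M) measure_Ioo_lt_top
      (fun θ _ => hM _ (circleMap_zero_mem_ball hσ))
    rw [Real.volume_real_Ioo_of_le (by linarith [Real.pi_pos])] at this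
    refine this.trans (le_of_eq ?_)
    ring
  have hΦ : Integrable
      (fun p : ℝ × ℝ => ((p.1 * κ (p.1 ^ 2) * logKernel p : ℝ) : ℂ) * D p.2)
      ((volume.restrict (Ioo (0 : ℝ) 1)).prod (volume.restrict (Ioo (0 : ℝ) 1))) := by
    refine (integrable_mul_logKernel hκ).ofReal.mul_bdd (c := M * (2 * Real.pi)) hDm.comp_snd ?_
    rw [Measure.prod_restrict]
    filter_upwards [ae_restrict_mem (measurableSet_Ioo.prod measurableSet_Ioo)] with p hp
    exact hDb p.2 hp.2
  have hcirc : ∀ r ∈ Ioo (0 : ℝ) 1, ((r * κ (r ^ 2) : ℝ) : ℂ) * A r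
      = ((r * κ (r ^ 2) : ℝ) : ℂ) * ((2 * Real.pi : ℝ) * G 0)
        + ∫ σ in Ioo (0 : ℝ) 1, ((r * κ (r ^ 2) * logKernel (r, σ) : ℝ) : ℂ) * D σ := by
    intro r hr
    have h1 := circle_integral_sub_eq hG hr
    have h2 : ∫ σ in Ioo (0 : ℝ) 1, ((r * κ (r ^ 2) * logKernel (r, σ) : ℝ) : ℂ) * D σ
        = ((r * κ (r ^ 2) : ℝ) : ℂ) *
          ∫ σ in Ioo 0 r, ((σ * Real.log (r / σ) : ℝ) : ℂ) * D σ := by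
      rw [← integral_const_mul]
      rw [setIntegral_eq_of_subset_of_forall_sdiff_eq_zero measurableSet_Ioo
        (Ioo_subset_Ioo_right hr.2.le : Ioo 0 r ⊆ Ioo 0 1)]
      · refine setIntegral_congr_fun measurableSet_Ioo fun σ hσ => ?_
        simp only [logKernel, if_pos hσ.2]
        push_cast
        ring
      · rintro σ ⟨hσ, hn⟩
        have : ¬ σ < r := fun h => hn ⟨hσ.1, h⟩
        simp [logKernel, this]
    rw [h2, ← h1]
    ring
  have hΦ' : Integrable (fun r => ∫ σ in Ioo (0 : ℝ) 1,
      ((r * κ (r ^ 2) * logKernel (r, σ) : ℝ) : ℂ) * D σ) (volume.restrict (Ioo (0 : ℝ) 1)) :=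
    hΦ.integral_prod_left
  have hk' : Integrable (fun r => ((r * κ (r ^ 2) : ℝ) : ℂ) * ((2 * Real.pi : ℝ) * G 0))
      (volume.restrict (Ioo (0 : ℝ) 1)) := hk.ofReal.mul_const _
  rw [setIntegral_congr_fun measurableSet_Ioo hcirc, integral_add hk' hΦ',
    integral_mul_const, integral_integral_swap hΦ]
  congr 1
  · rw [integral_complex_ofReal]
    have h3 := setIntegral_Ioo_comp_sq κ le_rfl
    rw [zero_pow two_ne_zero] at h3
    rw [← h3, ← integral_const_mul, ← mul_assoc, ← Complex.ofReal_mul, ← integral_mul_const]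
    congr 3
    ext r
    ring
  · refine setIntegral_congr_fun measurableSet_Ioo fun σ hσ => ?_
    simp only [integral_mul_const]
    rw [integral_complex_ofReal, integral_mul_logKernel κ hσ]

theorem circle_integral_of_differentiableOn {h : ℂ → ℂ}
    (hh : DifferentiableOn ℂ h (Metric.ball 0 1)) {r : ℝ} (hr : r ∈ Ioo (0 : ℝ) 1) :
    ∫ θ in Ioo (-Real.pi) Real.pi, h (circleMap 0 r θ) = (2 * Real.pi : ℝ) * h 0 := by
  have h1 : Real.circleAverage h 0 r = h 0 := by
    apply DiffContOnCl.circleAverage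
    rw [abs_of_pos hr.1]
    exact (hh.mono (Metric.closedBall_subset_ball hr.2)).diffContOnCl_ball subset_rfl
  rw [Real.circleAverage_def] at h1
  have h2 : Function.Periodic (fun θ => h (circleMap 0 r θ)) (2 * Real.pi) :=
    (periodic_circleMap 0 r).comp h
  have h3 := h2.intervalIntegral_add_eq (-Real.pi) 0
  rw [← integral_Ioc_eq_integral_Ioo, ← intervalIntegral.integral_of_le (by linarith [Real.pi_pos])]
  have h4 : -Real.pi + 2 * Real.pi = Real.pi := by ring
  rw [h4, zero_add] at h3
  rw [h3, ← h1, Complex.real_smul]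
  push_cast
  have : (Real.pi : ℂ) ≠ 0 := by exact_mod_cast Real.pi_ne_zero
  field_simp

/-- The mean value property against a radial density. -/
theorem setIntegral_ball_radial_mul_of_differentiableOn {κ : ℝ → ℝ}
    (hκ : IntegrableOn κ (Ioo 0 1)) {h : ℂ → ℂ} (hh : DifferentiableOn ℂ h (Metric.ball 0 1))
    (hint : IntegrableOn (fun u => (κ (‖u‖ ^ 2) : ℂ) * h u) (Metric.ball 0 1)) :
    ∫ u in Metric.ball (0 : ℂ) 1, (κ (‖u‖ ^ 2) : ℂ) * h u
      = (Real.pi * ∫ x in Ioo 0 1, κ x : ℝ) * h 0 := by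
  -- cut off near the boundary, where `h` may be unbounded
  set R : ℕ → ℝ := fun n => 1 - 1 / ((n : ℝ) + 1) with hR
  have hRlt : ∀ n, R n < 1 := fun n => by
    have : (0 : ℝ) < 1 / ((n : ℝ) + 1) := by positivity
    simp only [hR]; linarith
  have hRlim : Tendsto R atTop (𝓝 1) := by
    simpa [hR] using (tendsto_one_div_add_atTop_nhds_zero_nat (𝕜 := ℝ)).const_sub 1
  have hRev : ∀ x < (1 : ℝ), ∀ᶠ n in atTop, x ∈ Iio (R n) := fun x hx =>
    hRlim.eventually (lt_mem_nhds hx)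
  set k : ℕ → ℝ → ℝ := fun n => (Iio (R n)).indicator κ with hk
  have hkint : ∀ n, IntegrableOn (k n) (Ioo 0 1) := fun n => hκ.indicator measurableSet_Iio
  have hkle : ∀ n x, ‖k n x‖ ≤ ‖κ x‖ := fun n x => norm_indicator_le_norm_self _ _
  have hklim : ∀ x < (1 : ℝ), Tendsto (fun n => k n x) atTop (𝓝 (κ x)) := by
    intro x hx
    refine tendsto_const_nhds.congr' ?_
    filter_upwards [hRev x hx] with n hn
    exact (indicator_of_mem hn κ).symm
  have hn : ∀ n, ∫ u in Metric.ball (0 : ℂ) 1, (k n (‖u‖ ^ 2) : ℂ) * h u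
      = (Real.pi * ∫ x in Ioo 0 1, k n x : ℝ) * h 0 := by
    intro n
    obtain ⟨C, hC⟩ := (isCompact_closedBall (0 : ℂ) (Real.sqrt (R n))).exists_bound_of_continuousOn
      (hh.continuousOn.mono (Metric.closedBall_subset_ball (by
        rw [Real.sqrt_lt' one_pos]; simpa using hRlt n)))
    rw [setIntegral_ball_radial_mul (hkint n) hh.continuousOn (C := C)]
    · have h1 : ∀ r ∈ Ioo (0 : ℝ) 1, ((r * k n (r ^ 2) : ℝ) : ℂ) *
          ∫ θ in Ioo (-Real.pi) Real.pi, h (circleMap 0 r θ)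
          = ((2 * r * k n (r ^ 2) : ℝ) : ℂ) * (Real.pi * h 0) := by
        intro r hr
        rw [circle_integral_of_differentiableOn hh hr]
        push_cast
        ring
      rw [setIntegral_congr_fun measurableSet_Ioo h1, integral_mul_const, integral_complex_ofReal]
      have h3 := setIntegral_Ioo_comp_sq (k n) le_rfl
      rw [zero_pow two_ne_zero] at h3
      rw [h3]
      push_cast
      ring
    · intro u _ hu
      apply hC
      have h2 : ‖u‖ ^ 2 ∈ Iio (R n) := mem_of_indicator_ne_zero hu
      rw [mem_closedBall_zero_iff]
      exact Real.le_sqrt_of_sq_le (mem_Iio.mp h2).le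
  have hmem : ∀ᵐ u ∂(volume.restrict (Metric.ball (0 : ℂ) 1)), ‖u‖ ^ 2 < 1 := by
    filter_upwards [ae_restrict_mem Metric.isOpen_ball.measurableSet] with u hu
    rw [mem_ball_zero_iff] at hu
    nlinarith [norm_nonneg u]
  have hlim1 : Tendsto (fun n => ∫ u in Metric.ball (0 : ℂ) 1, (k n (‖u‖ ^ 2) : ℂ) * h u) atTop
      (𝓝 (∫ u in Metric.ball (0 : ℂ) 1, (κ (‖u‖ ^ 2) : ℂ) * h u)) := by
    refine tendsto_integral_of_dominated_convergence _ (fun n => ?_) hint.norm (fun n => ?_) ?_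
    · exact ((integrableOn_comp_norm_sq (hkint n)).ofReal.1).mul
        (hh.continuousOn.aestronglyMeasurable Metric.isOpen_ball.measurableSet)
    · refine Eventually.of_forall fun u => ?_
      rw [norm_mul, norm_mul, Complex.norm_real, Complex.norm_real]
      exact mul_le_mul_of_nonneg_right (hkle n _) (norm_nonneg _)
    · filter_upwards [hmem] with u hu
      exact ((Complex.continuous_ofReal.tendsto _).comp (hklim _ hu)).mul_const _
  have hlim2 : Tendsto (fun n => ∫ x in Ioo (0 : ℝ) 1, k n x) atTop
      (𝓝 (∫ x in Ioo (0 : ℝ) 1, κ x)) := by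
    refine tendsto_integral_of_dominated_convergence _ (fun n => (hkint n).1) hκ.norm
      (fun n => Eventually.of_forall fun x => hkle n x) ?_
    filter_upwards [ae_restrict_mem measurableSet_Ioo] with x hx
    exact hklim x hx.2
  simp only [hn] at hlim1
  refine tendsto_nhds_unique hlim1 ?_
  exact ((Complex.continuous_ofReal.tendsto _).comp (hlim2.const_mul Real.pi)).mul_const _

/-! ### The radial kernels -/

theorem setIntegral_Ioo_of_hasDerivAt {a b : ℝ} (hab : a < b) {f f' : ℝ → ℝ}
    (hd : ∀ x ∈ Ioo a b, HasDerivAt f (f' x) x) (hint : IntegrableOn f' (Ioo a b)) {fa fb : ℝ}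
    (ha : Tendsto f (𝓝[>] a) (𝓝 fa)) (hb : Tendsto f (𝓝[<] b) (𝓝 fb)) :
    ∫ x in Ioo a b, f' x = fb - fa := by
  rw [← integral_Ioc_eq_integral_Ioo, ← intervalIntegral.integral_of_le hab.le]
  exact intervalIntegral.integral_eq_sub_of_hasDerivAt_of_tendsto hab hd
    ((intervalIntegrable_iff_integrableOn_Ioo_of_le hab.le).mpr hint) ha hb

theorem integrableOn_one_sub_rpow {t : ℝ} (ht : -1 < t) {a : ℝ} (ha : a ∈ Icc (0 : ℝ) 1) :
    IntegrableOn (fun x : ℝ => (1 - x) ^ t) (Ioo a 1) := by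
  have h := (intervalIntegral.intervalIntegrable_rpow' (a := 0) (b := 1) ht).comp_sub_left 1
  simp only [sub_zero, sub_self] at h
  have h2 := (intervalIntegrable_iff_integrableOn_Ioo_of_le zero_le_one).mp h.symm
  exact h2.mono_set (Ioo_subset_Ioo_left ha.1)

theorem tendsto_one_sub_rpow {t : ℝ} (ht : 0 < t) :
    Tendsto (fun x : ℝ => (1 - x) ^ t) (𝓝[<] 1) (𝓝 0) := by
  have h : ContinuousAt (fun x : ℝ => (1 - x) ^ t) 1 :=
    ContinuousAt.rpow_const (by fun_prop) (Or.inr ht.le)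
  have := h.tendsto.mono_left (nhdsWithin_le_nhds (s := Iio 1))
  simpa [Real.zero_rpow ht.ne'] using this

theorem hasDerivAt_one_sub_rpow {t x : ℝ} (hx : x < 1) :
    HasDerivAt (fun x : ℝ => (1 - x) ^ (t + 1)) (-((t + 1) * (1 - x) ^ t)) x := by
  have h := ((hasDerivAt_id x).const_sub 1).rpow_const (p := t + 1) (Or.inl (by simp; linarith))
  refine h.congr_deriv ?_
  simp only [id, add_sub_cancel_right]
  ring

theorem setIntegral_one_sub_rpow {t : ℝ} (ht : -1 < t) :
    ∫ x in Ioo (0 : ℝ) 1, (1 - x) ^ t = 1 / (t + 1) := by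
  have h0 : t + 1 ≠ 0 := by linarith
  rw [setIntegral_Ioo_of_hasDerivAt zero_lt_one
    (f := fun x => -(1 / (t + 1)) * (1 - x) ^ (t + 1)) (fa := -(1 / (t + 1)))
    (fb := -(1 / (t + 1)) * 0)]
  · ring
  · intro x hx
    refine ((hasDerivAt_one_sub_rpow hx.2).const_mul _).congr_deriv ?_
    field_simp
  · exact integrableOn_one_sub_rpow ht ⟨le_rfl, zero_le_one⟩
  · have h : ContinuousAt (fun x : ℝ => -(1 / (t + 1)) * (1 - x) ^ (t + 1)) 0 :=
      (ContinuousAt.rpow_const (by fun_prop) (Or.inl (by simp))).const_mul _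
    have := h.tendsto.mono_left (nhdsWithin_le_nhds (s := Ioi 0))
    simpa using this
  · exact (tendsto_one_sub_rpow (by linarith)).const_mul _

/-- The density of the Bergman measure in the variable `x = |z|²`. -/
noncomputable def weightDensity (t x : ℝ) : ℝ := (t + 1) / Real.pi * (1 - x) ^ t

theorem integrableOn_weightDensity {t : ℝ} (ht : -1 < t) :
    IntegrableOn (weightDensity t) (Ioo 0 1) :=
  (integrableOn_one_sub_rpow ht ⟨le_rfl, zero_le_one⟩).const_mul _

theorem pi_mul_setIntegral_weightDensity {t : ℝ} (ht : -1 < t) :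
    Real.pi * ∫ x in Ioo 0 1, weightDensity t x = 1 := by
  have h0 : t + 1 ≠ 0 := by linarith
  simp only [weightDensity]
  rw [integral_const_mul, setIntegral_one_sub_rpow ht]
  have := Real.pi_ne_zero
  field_simp

theorem weightDensity_nonneg {t : ℝ} (ht : -1 < t) {x : ℝ} (hx : x ≤ 1) :
    0 ≤ weightDensity t x :=
  mul_nonneg (div_nonneg (by linarith) Real.pi_pos.le) (Real.rpow_nonneg (by linarith) t)

/-- The radial kernel of the Berezin transform minus the identity in terms of the Laplacian. -/
noncomputable def berezinKernel (t s : ℝ) : ℝ :=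
  1 / (4 * Real.pi) * ∫ y in s..1, (1 - y) ^ (t + 1) * y⁻¹

theorem integrableOn_one_sub_rpow_mul_inv {t : ℝ} (ht : -1 < t) {s : ℝ} (hs : s ∈ Ioo (0 : ℝ) 1) :
    IntegrableOn (fun y : ℝ => (1 - y) ^ t * y⁻¹) (Ioo s 1) := by
  refine (integrableOn_one_sub_rpow ht ⟨hs.1.le, hs.2.le⟩).mul_bdd (c := s⁻¹)
    (by fun_prop) ?_
  filter_upwards [ae_restrict_mem measurableSet_Ioo] with y hy
  have hy0 : 0 < y := hs.1.trans hy.1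
  rw [Real.norm_of_nonneg (by positivity)]
  exact inv_anti₀ hs.1 hy.1.le

theorem berezinKernel_eq {t s : ℝ} (hs : s ∈ Ioo (0 : ℝ) 1) :
    berezinKernel t s = 1 / (4 * Real.pi) * ∫ y in Ioo s 1, (1 - y) ^ (t + 1) * y⁻¹ := by
  rw [berezinKernel, intervalIntegral.integral_of_le hs.2.le, integral_Ioc_eq_integral_Ioo]

theorem berezinKernel_nonneg {t s : ℝ} (hs : s ∈ Ioo (0 : ℝ) 1) : 0 ≤ berezinKernel t s := by
  rw [berezinKernel_eq hs]
  refine mul_nonneg (by have := Real.pi_pos; positivity) (setIntegral_nonneg measurableSet_Ioo ?_)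
  intro y hy
  have hy0 : 0 < y := hs.1.trans hy.1
  have : 0 ≤ 1 - y := by linarith [hy.2]
  positivity

theorem neg_log_le {s : ℝ} (hs : s ∈ Ioo (0 : ℝ) 1) :
    -Real.log s ≤ 2 * (s ^ (-(1 / 2) : ℝ) * (1 - s)) := by
  have h1 := Real.log_le_sub_one_of_pos (Real.rpow_pos_of_pos hs.1 (-(1 / 2)))
  rw [Real.log_rpow hs.1] at h1
  have h2 : s ^ (-(1 / 2) : ℝ) * s = s ^ (1 / 2 : ℝ) := by
    conv_lhs => rw [← Real.rpow_add_one hs.1.ne']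
    norm_num
  have h3 : s ^ (1 / 2 : ℝ) ≤ 1 := Real.rpow_le_one hs.1.le hs.2.le (by norm_num)
  rw [mul_sub, h2, mul_one]
  linarith

theorem berezinKernel_le {t s : ℝ} (ht : -1 < t) (hs : s ∈ Ioo (0 : ℝ) 1) :
    berezinKernel t s
      ≤ 1 / (2 * Real.pi) * (s ^ (-(1 / 2) : ℝ) * (1 - s) ^ (t + 2)) := by
  have hpi := Real.pi_pos
  have h1s : 0 < 1 - s := by linarith [hs.2]
  have h1 : ∫ y in Ioo s 1, (1 - y) ^ (t + 1) * y⁻¹ ≤ ∫ y in Ioo s 1, (1 - s) ^ (t + 1) * y⁻¹ := by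
    refine setIntegral_mono_on (integrableOn_one_sub_rpow_mul_inv (by linarith) hs) ?_
      measurableSet_Ioo fun y hy => ?_
    · refine (ContinuousOn.integrableOn_compact isCompact_Icc ?_).mono_set
        (Ioo_subset_Icc_self (a := s) (b := 1))
      refine continuousOn_const.mul (continuousOn_id.inv₀ fun y hy => ?_)
      exact (hs.1.trans_le hy.1).ne'
    · have hy0 : 0 < y := hs.1.trans hy.1
      gcongr
      · linarith [hy.2]
      · linarith
      · exact hy.1.le
  have h2 : ∫ y in Ioo s 1, y⁻¹ = -Real.log s := by
    rw [← integral_Ioc_eq_integral_Ioo, ← intervalIntegral.integral_of_le hs.2.le,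
      integral_inv_of_pos hs.1 one_pos, one_div, Real.log_inv]
  rw [integral_const_mul, h2] at h1
  rw [berezinKernel_eq hs]
  calc 1 / (4 * Real.pi) * ∫ y in Ioo s 1, (1 - y) ^ (t + 1) * y⁻¹
      ≤ 1 / (4 * Real.pi) * ((1 - s) ^ (t + 1) * (2 * (s ^ (-(1 / 2) : ℝ) * (1 - s)))) := by
        gcongr
        exact h1.trans (mul_le_mul_of_nonneg_left (neg_log_le hs) (by positivity))
    _ = _ := by
        have h5 : (1 - s) ^ (t + 2) = (1 - s) ^ (t + 1) * (1 - s) := by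
          rw [← Real.rpow_add_one h1s.ne']; congr 1; ring
        rw [h5]
        generalize (1 - s) ^ (t + 1) = A
        generalize s ^ (-(1 / 2) : ℝ) = B
        field_simp
        ring

theorem hasDerivAt_berezinKernel {t s : ℝ} (ht : -1 < t) (hs : s ∈ Ioo (0 : ℝ) 1) :
    HasDerivAt (berezinKernel t) (-(1 / (4 * Real.pi) * ((1 - s) ^ (t + 1) * s⁻¹))) s := by
  have hc : ContinuousOn (fun y : ℝ => (1 - y) ^ (t + 1) * y⁻¹) (Ioi 0) := by
    refine ContinuousOn.mul ?_ (continuousOn_id.inv₀ fun y hy => (ne_of_gt hy))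
    exact ContinuousOn.rpow_const (by fun_prop) fun y _ => Or.inr (by linarith)
  have h := intervalIntegral.integral_hasDerivAt_left (a := s) (b := 1)
    (f := fun y : ℝ => (1 - y) ^ (t + 1) * y⁻¹) ?_
    (hc.stronglyMeasurableAtFilter isOpen_Ioi s hs.1)
    (hc.continuousAt (Ioi_mem_nhds hs.1))
  · refine (h.const_mul (1 / (4 * Real.pi))).congr_deriv ?_
    ring
  · rw [intervalIntegrable_iff_integrableOn_Ioo_of_le hs.2.le]
    exact integrableOn_one_sub_rpow_mul_inv (by linarith) hs

/-- Green's formula for the weight `λ_t` has the Berezin kernel as its potential. -/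
theorem radialPotential_weightDensity {t s : ℝ} (ht : -1 < t) (hs : s ∈ Ioo (0 : ℝ) 1) :
    radialPotential (weightDensity t) s = berezinKernel t s := by
  have hlogle : ∀ x ∈ Ioo s 1, ‖Real.log (x / s)‖ ≤ Real.log (1 / s) := by
    intro x hx
    have hx1 : 1 ≤ x / s := by rw [le_div_iff₀ hs.1]; linarith [hx.1]
    rw [Real.norm_of_nonneg (Real.log_nonneg hx1)]
    apply Real.log_le_log (by linarith)
    have := hs.1
    gcongr
    exact hx.2.le
  have hi1 : IntegrableOn (fun x => Real.log (x / s) * (1 - x) ^ t) (Ioo s 1) := by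
    refine (integrableOn_one_sub_rpow ht ⟨hs.1.le, hs.2.le⟩).bdd_mul (c := Real.log (1 / s))
      (by fun_prop : Measurable _).aestronglyMeasurable ?_
    filter_upwards [ae_restrict_mem measurableSet_Ioo] with x hx
    exact hlogle x hx
  have hi2 := integrableOn_one_sub_rpow_mul_inv (t := t + 1) (by linarith) hs
  have hcont : ContinuousAt (fun x => Real.log (x / s)) s := by
    have := hs.1.ne'
    exact (continuousAt_id.div_const s).log (by simp [this])
  have h := setIntegral_Ioo_of_hasDerivAt hs.2
    (f := fun x => Real.log (x / s) * (1 - x) ^ (t + 1))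
    (f' := fun x => (1 - x) ^ (t + 1) * x⁻¹ - (t + 1) * (Real.log (x / s) * (1 - x) ^ t))
    (fa := 0) (fb := 0) ?_ (hi2.sub (hi1.const_mul _)) ?_ ?_
  · rw [integral_sub hi2 (hi1.const_mul _), integral_const_mul, sub_zero, sub_eq_zero] at h
    rw [radialPotential, berezinKernel_eq hs, h]
    simp only [weightDensity]
    rw [← integral_const_mul, ← integral_const_mul, ← integral_const_mul]
    refine setIntegral_congr_fun measurableSet_Ioo fun x _ => ?_
    have := Real.pi_ne_zero
    field_simp
  · intro x hx
    have hx0 : 0 < x := hs.1.trans hx.1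
    have h1 : HasDerivAt (fun x => Real.log (x / s)) x⁻¹ x := by
      have := ((hasDerivAt_id x).div_const s).log (by have := hs.1; positivity)
      refine this.congr_deriv ?_
      have := hs.1.ne'
      simp only [id]
      field_simp
    refine (h1.mul (hasDerivAt_one_sub_rpow hx.2)).congr_deriv ?_
    ring
  · have h1 : ContinuousAt (fun x => Real.log (x / s) * (1 - x) ^ (t + 1)) s :=
      hcont.mul (ContinuousAt.rpow_const (by fun_prop) (Or.inr (by linarith)))
    have := h1.tendsto.mono_left (nhdsWithin_le_nhds (s := Ioi s))
    simpa [hs.1.ne'] using this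
  · have h1 : ContinuousAt (fun x => Real.log (x / s)) 1 := by
      have := hs.1.ne'
      exact (continuousAt_id.div_const s).log (by simp [this])
    simpa using (h1.tendsto.mono_left (nhdsWithin_le_nhds (s := Iio 1))).mul
      (tendsto_one_sub_rpow (by linarith : 0 < t + 1))

theorem integrableOn_rpow_mul_one_sub_rpow {t : ℝ} (ht : -1 < t) :
    IntegrableOn (fun x : ℝ => x ^ (-(1 / 2) : ℝ) * (1 - x) ^ t) (Ioo 0 1) := by
  have h := (Complex.betaIntegral_convergent (u := (1 / 2 : ℝ)) (v := (t + 1 : ℝ))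
    (by simp) (by simp; linarith))
  have h2 := ((intervalIntegrable_iff_integrableOn_Ioo_of_le zero_le_one).mp h).norm
  refine IntegrableOn.congr_fun h2 (fun x hx => ?_) measurableSet_Ioo
  have hx1 : 0 < 1 - x := by linarith [hx.2]
  have e1 : ((1 / 2 : ℝ) : ℂ) - 1 = ((-(1 / 2) : ℝ) : ℂ) := by push_cast; norm_num
  have e2 : ((t + 1 : ℝ) : ℂ) - 1 = (t : ℂ) := by push_cast; ring
  have e3 : 1 - (x : ℂ) = ((1 - x : ℝ) : ℂ) := by push_cast; ring
  simp only [e1, e2, e3, norm_mul]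
  rw [Complex.norm_cpow_eq_rpow_re_of_pos hx.1, Complex.norm_cpow_eq_rpow_re_of_pos hx1,
    Complex.ofReal_re, Complex.ofReal_re]

/-- The density obtained from the Berezin kernel by dividing by `π (1 - x)² / (t + 1)`. It is the
Laplacian of `u ↦ ρ_t(|u|²)` on the punctured disk, in the variable `x = |u|²`. -/
noncomputable def invariantDensity (t x : ℝ) : ℝ :=
  (t + 1) / Real.pi * (((1 - x) ^ 2)⁻¹ * berezinKernel t x)

theorem continuousOn_berezinKernel {t : ℝ} (ht : -1 < t) :
    ContinuousOn (berezinKernel t) (Ioo 0 1) := fun _ hs =>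
  (hasDerivAt_berezinKernel ht hs).continuousAt.continuousWithinAt

theorem inv_sq_mul_berezinKernel_le {t s : ℝ} (ht : -1 < t) (hs : s ∈ Ioo (0 : ℝ) 1) :
    ((1 - s) ^ 2)⁻¹ * berezinKernel t s
      ≤ 1 / (2 * Real.pi) * (s ^ (-(1 / 2) : ℝ) * (1 - s) ^ t) := by
  have h1s : 0 < 1 - s := by linarith [hs.2]
  have h := berezinKernel_le ht hs
  rw [Real.rpow_add h1s, Real.rpow_two] at h
  rw [inv_mul_le_iff₀ (by positivity)]
  calc _ ≤ _ := h
    _ = _ := by ring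

theorem integrableOn_inv_sq_mul_berezinKernel {t : ℝ} (ht : -1 < t) :
    IntegrableOn (fun x => ((1 - x) ^ 2)⁻¹ * berezinKernel t x) (Ioo 0 1) := by
  refine Integrable.mono' ((integrableOn_rpow_mul_one_sub_rpow ht).const_mul (1 / (2 * Real.pi)))
    ?_ ?_
  · apply ContinuousOn.aestronglyMeasurable _ measurableSet_Ioo
    refine ContinuousOn.mul (ContinuousOn.inv₀ (by fun_prop) fun x hx => ?_)
      (continuousOn_berezinKernel ht)
    have : 0 < 1 - x := by linarith [hx.2]
    positivity
  · filter_upwards [ae_restrict_mem measurableSet_Ioo] with x hx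
    rw [Real.norm_of_nonneg (mul_nonneg (by positivity) (berezinKernel_nonneg hx))]
    exact inv_sq_mul_berezinKernel_le ht hx

theorem integrableOn_invariantDensity {t : ℝ} (ht : -1 < t) :
    IntegrableOn (invariantDensity t) (Ioo 0 1) :=
  (integrableOn_inv_sq_mul_berezinKernel ht).const_mul _

theorem invariantDensity_nonneg {t : ℝ} (ht : -1 < t) {x : ℝ} (hx : x ∈ Ioo (0 : ℝ) 1) :
    0 ≤ invariantDensity t x :=
  mul_nonneg (div_nonneg (by linarith) Real.pi_pos.le)
    (mul_nonneg (by positivity) (berezinKernel_nonneg hx))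

theorem tendsto_pow_div_mul_berezinKernel_zero {t : ℝ} (ht : -1 < t) {n : ℕ} (hn : n ≠ 0) :
    Tendsto (fun x => x ^ n / (1 - x) * berezinKernel t x) (𝓝[>] 0) (𝓝 0) := by
  have h1 : Tendsto (fun x : ℝ => 1 / (2 * Real.pi) * (x ^ (1 / 2 : ℝ) * (1 - x) ^ (t + 1)))
      (𝓝[>] 0) (𝓝 0) := by
    have hc : ContinuousAt
        (fun x : ℝ => 1 / (2 * Real.pi) * (x ^ (1 / 2 : ℝ) * (1 - x) ^ (t + 1))) 0 := by
      refine ContinuousAt.const_mul (ContinuousAt.mul ?_ ?_) _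
      · exact ContinuousAt.rpow_const continuousAt_id (Or.inr (by norm_num))
      · exact ContinuousAt.rpow_const (by fun_prop) (Or.inl (by simp))
    have := hc.tendsto.mono_left (nhdsWithin_le_nhds (s := Ioi 0))
    simpa using this
  refine squeeze_zero' ?_ ?_ h1
  · filter_upwards [Ioo_mem_nhdsGT zero_lt_one] with x hx
    have : 0 < 1 - x := by linarith [hx.2]
    have := berezinKernel_nonneg (t := t) hx
    have := hx.1
    positivity
  · filter_upwards [Ioo_mem_nhdsGT zero_lt_one] with x hx
    have h1x : 0 < 1 - x := by linarith [hx.2]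
    have h2 := berezinKernel_le ht hx
    have h3 : x ^ n ≤ x := pow_le_of_le_one hx.1.le hx.2.le hn
    have h4 : x ^ (1 / 2 : ℝ) = x ^ (-(1 / 2) : ℝ) * x := by
      rw [← Real.rpow_add_one hx.1.ne']; norm_num
    have h5 : (1 - x) ^ (t + 2) = (1 - x) ^ (t + 1) * (1 - x) := by
      rw [← Real.rpow_add_one h1x.ne']; congr 1; ring
    calc x ^ n / (1 - x) * berezinKernel t x
        ≤ x / (1 - x) * (1 / (2 * Real.pi) * (x ^ (-(1 / 2) : ℝ) * (1 - x) ^ (t + 2))) := by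
          apply mul_le_mul _ h2 (berezinKernel_nonneg hx) (by have := hx.1; positivity)
          gcongr
      _ = _ := by
          rw [h4, h5]
          field_simp

theorem tendsto_div_mul_berezinKernel_one {t : ℝ} (ht : -1 < t) :
    Tendsto (fun x => 1 / (1 - x) * berezinKernel t x) (𝓝[<] 1) (𝓝 0) := by
  have h1 : Tendsto (fun x : ℝ => 1 / (2 * Real.pi) * (x ^ (-(1 / 2) : ℝ) * (1 - x) ^ (t + 1)))
      (𝓝[<] 1) (𝓝 0) := by
    have hc : ContinuousAt (fun x : ℝ => x ^ (-(1 / 2) : ℝ)) 1 :=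
      ContinuousAt.rpow_const continuousAt_id (Or.inl (by simp))
    have := ((hc.tendsto.mono_left (nhdsWithin_le_nhds (s := Iio 1))).mul
      (tendsto_one_sub_rpow (by linarith : 0 < t + 1))).const_mul (1 / (2 * Real.pi))
    simpa using this
  refine squeeze_zero' ?_ ?_ h1
  · filter_upwards [Ioo_mem_nhdsLT zero_lt_one] with x hx
    have : 0 < 1 - x := by linarith [hx.2]
    have := berezinKernel_nonneg (t := t) hx
    positivity
  · filter_upwards [Ioo_mem_nhdsLT zero_lt_one] with x hx
    have h1x : 0 < 1 - x := by linarith [hx.2]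
    have h2 := berezinKernel_le ht hx
    have h5 : (1 - x) ^ (t + 2) = (1 - x) ^ (t + 1) * (1 - x) := by
      rw [← Real.rpow_add_one h1x.ne']; congr 1; ring
    rw [one_div_mul_eq_div, div_le_iff₀ h1x]
    refine h2.trans (le_of_eq ?_)
    rw [h5]
    ring

theorem tendsto_pow_div_mul_berezinKernel_one {t : ℝ} (ht : -1 < t) (n : ℕ) :
    Tendsto (fun x => x ^ n / (1 - x) * berezinKernel t x) (𝓝[<] 1) (𝓝 0) := by
  have hc : ContinuousAt (fun x : ℝ => x ^ n) 1 := by fun_prop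
  have := (hc.tendsto.mono_left (nhdsWithin_le_nhds (s := Iio 1))).mul
    (tendsto_div_mul_berezinKernel_one ht)
  simp only [mul_zero] at this
  refine this.congr fun x => ?_
  ring

/-- The total mass of `invariantDensity`, by integration by parts; it is the source of the factor
`1/4π` in front of `∫ f Δg`. -/
theorem pi_mul_setIntegral_invariantDensity {t : ℝ} (ht : -1 < t) :
    Real.pi * ∫ x in Ioo 0 1, invariantDensity t x = 1 / (4 * Real.pi) := by
  have hi1 := integrableOn_inv_sq_mul_berezinKernel ht
  have hi2 := (integrableOn_one_sub_rpow ht (a := 0) ⟨le_rfl, zero_le_one⟩).const_mul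
    (1 / (4 * Real.pi))
  have h := setIntegral_Ioo_of_hasDerivAt zero_lt_one
    (f := fun x => x ^ 1 / (1 - x) * berezinKernel t x)
    (f' := fun x => ((1 - x) ^ 2)⁻¹ * berezinKernel t x - 1 / (4 * Real.pi) * (1 - x) ^ t)
    ?_ (hi1.sub hi2) (tendsto_pow_div_mul_berezinKernel_zero ht one_ne_zero)
    (tendsto_pow_div_mul_berezinKernel_one ht 1)
  · rw [integral_sub hi1 hi2, integral_const_mul, setIntegral_one_sub_rpow ht, sub_zero,
      sub_eq_zero] at h
    simp only [invariantDensity]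
    rw [integral_const_mul, h]
    have := Real.pi_ne_zero
    have h0 : t + 1 ≠ 0 := by linarith
    field_simp
  · intro x hx
    have h1x : 0 < 1 - x := by linarith [hx.2]
    have h1 : HasDerivAt (fun x : ℝ => x ^ 1 / (1 - x)) (((1 - x) ^ 2)⁻¹) x := by
      have := (hasDerivAt_pow 1 x).div ((hasDerivAt_id x).const_sub 1) h1x.ne'
      refine this.congr_deriv ?_
      simp only [id]
      field_simp
      norm_num
    refine (h1.mul (hasDerivAt_berezinKernel ht hx)).congr_deriv ?_
    rw [Real.rpow_add_one h1x.ne']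
    have := hx.1.ne'
    have := h1x.ne'
    field_simp
    ring

theorem pi_mul_setIntegral_mul_invariantDensity_le {t : ℝ} (ht : -1 < t) :
    Real.pi * ∫ x in Ioo 0 1, x * invariantDensity t x ≤ 1 / (4 * Real.pi * (t + 2)) := by
  have hi0 := integrableOn_inv_sq_mul_berezinKernel ht
  have hbd : ∀ {c : ℝ → ℝ}, Continuous c → (∀ x ∈ Ioo (0 : ℝ) 1, ‖c x‖ ≤ 2) →
      IntegrableOn (fun x => c x * (((1 - x) ^ 2)⁻¹ * berezinKernel t x)) (Ioo 0 1) := by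
    intro c hc hb
    refine hi0.bdd_mul (c := 2) hc.aestronglyMeasurable ?_
    filter_upwards [ae_restrict_mem measurableSet_Ioo] with x hx
    exact hb x hx
  have hi1 : IntegrableOn (fun x => (2 * x - x ^ 2) * (((1 - x) ^ 2)⁻¹ * berezinKernel t x))
      (Ioo 0 1) := hbd (by fun_prop) fun x hx => by
    rw [Real.norm_of_nonneg (by nlinarith [hx.1, hx.2])]
    nlinarith [hx.1, hx.2]
  have hi3 : IntegrableOn (fun x => x * (((1 - x) ^ 2)⁻¹ * berezinKernel t x)) (Ioo 0 1) :=
    hbd (by fun_prop) fun x hx => by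
      rw [Real.norm_of_nonneg hx.1.le]
      linarith [hx.2]
  have ha := integrableOn_one_sub_rpow ht (a := 0) ⟨le_rfl, zero_le_one⟩
  have hb := integrableOn_one_sub_rpow (t := t + 1) (by linarith) (a := 0) ⟨le_rfl, zero_le_one⟩
  have hi2 : IntegrableOn (fun x => 1 / (4 * Real.pi) * ((1 - x) ^ t - (1 - x) ^ (t + 1)))
      (Ioo 0 1) := (ha.sub hb).const_mul _
  have h := setIntegral_Ioo_of_hasDerivAt zero_lt_one
    (f := fun x => x ^ 2 / (1 - x) * berezinKernel t x)
    (f' := fun x => (2 * x - x ^ 2) * (((1 - x) ^ 2)⁻¹ * berezinKernel t x)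
      - 1 / (4 * Real.pi) * ((1 - x) ^ t - (1 - x) ^ (t + 1)))
    ?_ (hi1.sub hi2) (tendsto_pow_div_mul_berezinKernel_zero ht two_ne_zero)
    (tendsto_pow_div_mul_berezinKernel_one ht 2)
  · rw [integral_sub hi1 hi2, integral_const_mul, integral_sub ha hb, setIntegral_one_sub_rpow ht,
      setIntegral_one_sub_rpow (by linarith : -1 < t + 1), sub_zero, sub_eq_zero] at h
    have hmono : ∫ x in Ioo 0 1, x * (((1 - x) ^ 2)⁻¹ * berezinKernel t x)
        ≤ ∫ x in Ioo 0 1, (2 * x - x ^ 2) * (((1 - x) ^ 2)⁻¹ * berezinKernel t x) := by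
      refine setIntegral_mono_on hi3 hi1 measurableSet_Ioo fun x hx => ?_
      refine mul_le_mul_of_nonneg_right (by nlinarith [hx.1, hx.2]) ?_
      exact mul_nonneg (by positivity) (berezinKernel_nonneg hx)
    rw [h] at hmono
    have e : ∫ x in Ioo 0 1, x * invariantDensity t x
        = (t + 1) / Real.pi * ∫ x in Ioo 0 1, x * (((1 - x) ^ 2)⁻¹ * berezinKernel t x) := by
      rw [← integral_const_mul]
      refine setIntegral_congr_fun measurableSet_Ioo fun x _ => ?_
      simp only [invariantDensity]
      ring
    rw [e]
    have hpi := Real.pi_pos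
    have h1 : 0 < t + 1 := by linarith
    have h2 : 0 < t + 2 := by linarith
    calc _ ≤ Real.pi * ((t + 1) / Real.pi *
          (1 / (4 * Real.pi) * (1 / (t + 1) - 1 / (t + 1 + 1)))) := by gcongr
      _ = _ := by
          have : t + 1 + 1 ≠ 0 := by linarith
          field_simp
          ring
  · intro x hx
    have h1x : 0 < 1 - x := by linarith [hx.2]
    have h1 : HasDerivAt (fun x : ℝ => x ^ 2 / (1 - x)) ((2 * x - x ^ 2) * ((1 - x) ^ 2)⁻¹) x := by
      have := (hasDerivAt_pow 2 x).div ((hasDerivAt_id x).const_sub 1) h1x.ne'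
      refine this.congr_deriv ?_
      simp only [id]
      field_simp
      ring
    refine (h1.mul (hasDerivAt_berezinKernel ht hx)).congr_deriv ?_
    rw [Real.rpow_add_one h1x.ne']
    have := hx.1.ne'
    have := h1x.ne'
    field_simp
    ring

/-! ### The kernel of the Laplacian term -/

theorem kernelF_eq {s x : ℝ} :
    kernelF s x = x * Real.log (x / s) + (1 - x) * Real.log ((1 - x) / (1 - s)) := by
  rw [kernelF, ← inv_div x s, ← inv_div (1 - x) (1 - s), Real.log_inv, Real.log_inv]
  ring

theorem kernelF_le {s x : ℝ} (hs : s ∈ Ioo (0 : ℝ) 1) (hx : x ∈ Ioo s 1) :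
    kernelF s x ≤ Real.log (1 / s) := by
  have hx0 : 0 < x := hs.1.trans hx.1
  have h1 : Real.log (x / s) ≤ Real.log (1 / s) := by
    apply Real.log_le_log (div_pos hx0 hs.1)
    have := hs.1
    gcongr
    exact hx.2.le
  have h2 : 0 ≤ Real.log (x / s) := Real.log_nonneg (by rw [le_div_iff₀ hs.1]; linarith [hx.1])
  have h3 : Real.log ((1 - x) / (1 - s)) ≤ 0 := by
    apply Real.log_nonpos
    · exact div_nonneg (by linarith [hx.2]) (by linarith [hs.2])
    · rw [div_le_one (by linarith [hs.2])]; linarith [hx.1]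
  rw [kernelF_eq]
  nlinarith [hx.2, hx.1]

/-- `F(s,x)` is the relative entropy of two Bernoulli distributions. -/
theorem kernelF_pos {s x : ℝ} (hs : s ∈ Ioo (0 : ℝ) 1) (hx : x ∈ Ioo s 1) : 0 < kernelF s x := by
  have hx0 : 0 < x := hs.1.trans hx.1
  have h1x : 0 < 1 - x := by linarith [hx.2]
  have h1s : 0 < 1 - s := by linarith [hs.2]
  have h1 := Real.log_lt_sub_one_of_pos (div_pos hs.1 hx0)
    (by rw [ne_eq, div_eq_one_iff_eq hx0.ne']; exact hx.1.ne)
  have h2 := Real.log_le_sub_one_of_pos (div_pos h1s h1x)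
  have e1 : x * (s / x - 1) = s - x := by field_simp
  have e2 : (1 - x) * ((1 - s) / (1 - x) - 1) = x - s := by field_simp; ring
  rw [kernelF]
  nlinarith [mul_lt_mul_of_pos_left h1 hx0, mul_le_mul_of_nonneg_left h2 h1x.le]

theorem hasDerivAt_kernelF {s x : ℝ} (hs : s ∈ Ioo (0 : ℝ) 1) (hx : x ∈ Ioo (0 : ℝ) 1) :
    HasDerivAt (kernelF s) (Real.log (x / s) - Real.log ((1 - x) / (1 - s))) x := by
  have h1x : 0 < 1 - x := by linarith [hx.2]
  have h1s : 0 < 1 - s := by linarith [hs.2]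
  have hs0 := hs.1
  have hx0 := hx.1
  have e : kernelF s = fun x => x * Real.log (x / s)
      + (1 - x) * Real.log ((1 - x) / (1 - s)) := by
    ext y; exact kernelF_eq
  rw [e]
  have h1 := ((hasDerivAt_id x).div_const s).log (by simp only [id]; positivity)
  have h2 := (((hasDerivAt_id x).const_sub 1).div_const (1 - s)).log
    (by simp only [id]; positivity)
  refine (((hasDerivAt_id x).mul h1).add (((hasDerivAt_id x).const_sub 1).mul h2)).congr_deriv ?_
  simp only [id]
  field_simp
  ring

theorem kernelF_self {s : ℝ} (hs : s ∈ Ioo (0 : ℝ) 1) : kernelF s s = 0 := by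
  have h1 := hs.1.ne'
  have h2 : 1 - s ≠ 0 := by linarith [hs.2]
  rw [kernelF, div_self h1, div_self h2, Real.log_one]
  ring

theorem integrableOn_kernelF {t s : ℝ} (ht : -1 < t) (hs : s ∈ Ioo (0 : ℝ) 1) :
    IntegrableOn (fun x => (1 - x) ^ t * x⁻¹ * kernelF s x) (Ioo s 1) := by
  refine (integrableOn_one_sub_rpow_mul_inv ht hs).mul_bdd (c := Real.log (1 / s)) ?_ ?_
  · apply Measurable.aestronglyMeasurable
    unfold kernelF
    fun_prop
  · filter_upwards [ae_restrict_mem measurableSet_Ioo] with x hx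
    rw [Real.norm_of_nonneg (kernelF_pos hs hx).le]
    exact kernelF_le hs hx

theorem rhoKernel_pos {t s : ℝ} (ht : -1 < t) (hs : s ∈ Ioo (0 : ℝ) 1) : 0 < rhoKernel t s := by
  have hpi := Real.pi_pos
  have h1 : 0 < t + 1 := by linarith
  refine mul_pos (by positivity) ?_
  refine intervalIntegral.intervalIntegral_pos_of_pos_on
    ((intervalIntegrable_iff_integrableOn_Ioo_of_le hs.2.le).mpr (integrableOn_kernelF ht hs))
    (fun x hx => ?_) hs.2
  have hx0 : 0 < x := hs.1.trans hx.1
  have h1x : 0 < 1 - x := by linarith [hx.2]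
  have := kernelF_pos hs hx
  positivity

/-- The kernel `ρ_t` is a radial potential: `F(s, x)` arises from integrating the logarithmic kernel
by parts against the integral defining the Berezin kernel. -/
theorem radialPotential_invariantDensity {t s : ℝ} (ht : -1 < t) (hs : s ∈ Ioo (0 : ℝ) 1) :
    radialPotential (invariantDensity t) s = rhoKernel t s := by
  have hpi := Real.pi_pos
  have hsub : Ioo s 1 ⊆ Ioo 0 1 := Ioo_subset_Ioo_left hs.1.le
  have hi1 : IntegrableOn
      (fun x => Real.log (x / s) * (((1 - x) ^ 2)⁻¹ * berezinKernel t x)) (Ioo s 1) := by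
    refine ((integrableOn_inv_sq_mul_berezinKernel ht).mono_set hsub).bdd_mul
      (c := Real.log (1 / s)) (by fun_prop : Measurable _).aestronglyMeasurable ?_
    filter_upwards [ae_restrict_mem measurableSet_Ioo] with x hx
    have hx1 : 1 ≤ x / s := by rw [le_div_iff₀ hs.1]; linarith [hx.1]
    rw [Real.norm_of_nonneg (Real.log_nonneg hx1)]
    apply Real.log_le_log (by linarith)
    have := hs.1
    gcongr
    exact hx.2.le
  have hi2 := (integrableOn_kernelF ht hs).const_mul (1 / (4 * Real.pi))
  have h := setIntegral_Ioo_of_hasDerivAt hs.2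
    (f := fun x => kernelF s x * (1 / (1 - x) * berezinKernel t x))
    (f' := fun x => Real.log (x / s) * (((1 - x) ^ 2)⁻¹ * berezinKernel t x)
      - 1 / (4 * Real.pi) * ((1 - x) ^ t * x⁻¹ * kernelF s x))
    (fa := 0) (fb := 0) ?_ (hi1.sub hi2) ?_ ?_
  · rw [integral_sub hi1 hi2, sub_zero, sub_eq_zero, integral_const_mul] at h
    rw [rhoKernel, intervalIntegral.integral_of_le hs.2.le, integral_Ioc_eq_integral_Ioo,
      radialPotential]
    have e : ∫ x in Ioo s 1, Real.log (x / s) * invariantDensity t x = (t + 1) / Real.pi *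
        ∫ x in Ioo s 1, Real.log (x / s) * (((1 - x) ^ 2)⁻¹ * berezinKernel t x) := by
      rw [← integral_const_mul]
      refine setIntegral_congr_fun measurableSet_Ioo fun x _ => ?_
      simp only [invariantDensity]
      ring
    rw [e, h]
    field_simp
    ring
  · intro x hx
    have hx' := hsub hx
    have h1x : 0 < 1 - x := by linarith [hx.2]
    have h1s : 0 < 1 - s := by linarith [hs.2]
    have h1 : HasDerivAt (fun x : ℝ => 1 / (1 - x)) (((1 - x) ^ 2)⁻¹) x := by
      have := ((hasDerivAt_id x).const_sub 1).inv h1x.ne'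
      simp only [one_div]
      refine this.congr_deriv ?_
      simp only [id]
      field_simp
    have h2 : HasDerivAt (fun x : ℝ => 1 / (1 - x) * berezinKernel t x) _ x :=
      h1.mul (hasDerivAt_berezinKernel ht hx')
    refine ((hasDerivAt_kernelF hs hx').mul h2).congr_deriv ?_
    have e1 := kernelF_eq (s := s) (x := x)
    rw [Real.rpow_add_one h1x.ne', e1]
    have := hx'.1.ne'
    have := h1x.ne'
    field_simp
    ring
  · have h1 : ContinuousAt (fun x => kernelF s x * (1 / (1 - x) * berezinKernel t x)) s := by
      refine (hasDerivAt_kernelF hs hs).continuousAt.mul (ContinuousAt.mul ?_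
        (hasDerivAt_berezinKernel ht hs).continuousAt)
      refine continuousAt_const.div (by fun_prop) ?_
      linarith [hs.2]
    have := h1.tendsto.mono_left (nhdsWithin_le_nhds (s := Ioi s))
    simpa [kernelF_self hs] using this
  · have h1 := (tendsto_div_mul_berezinKernel_one ht).const_mul (Real.log (1 / s))
    rw [mul_zero] at h1
    refine squeeze_zero' ?_ ?_ h1
    · filter_upwards [Ioo_mem_nhdsLT hs.2] with x hx
      have h1x : 0 < 1 - x := by linarith [hx.2]
      have := kernelF_pos hs hx
      have := berezinKernel_nonneg (t := t) (hsub hx)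
      positivity
    · filter_upwards [Ioo_mem_nhdsLT hs.2] with x hx
      have h1x : 0 < 1 - x := by linarith [hx.2]
      have := berezinKernel_nonneg (t := t) (hsub hx)
      exact mul_le_mul_of_nonneg_right (kernelF_le hs hx) (by positivity)

/-! ### Integration against the Bergman measure -/

section BergmanMeasure

variable {t : ℝ}

theorem ae_mem_ball_bergmanMeasure : ∀ᵐ z ∂bergmanMeasure t, z ∈ Metric.ball (0 : ℂ) 1 :=
  (withDensity_absolutelyContinuous _ _).ae_le (ae_restrict_mem Metric.isOpen_ball.measurableSet)

theorem weightDensity_nonneg_of_mem_ball (ht : -1 < t) {z : ℂ} (hz : z ∈ Metric.ball (0 : ℂ) 1) :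
    0 ≤ weightDensity t (‖z‖ ^ 2) := by
  apply weightDensity_nonneg ht
  rw [mem_ball_zero_iff] at hz
  nlinarith [norm_nonneg z]

theorem measurable_weightDensity_norm_sq : Measurable fun z : ℂ => weightDensity t (‖z‖ ^ 2) := by
  unfold weightDensity
  fun_prop

theorem bergmanMeasure_eq : bergmanMeasure t = (volume.restrict (Metric.ball (0 : ℂ) 1)).withDensity
    fun z => ENNReal.ofReal (weightDensity t (‖z‖ ^ 2)) := rfl

theorem integrable_bergmanMeasure_iff (ht : -1 < t) {f : ℂ → ℂ} :
    Integrable f (bergmanMeasure t)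
      ↔ IntegrableOn (fun z => (weightDensity t (‖z‖ ^ 2) : ℂ) * f z) (Metric.ball 0 1) := by
  rw [bergmanMeasure_eq, integrable_withDensity_iff_integrable_smul'
    measurable_weightDensity_norm_sq.ennreal_ofReal
    (Eventually.of_forall fun _ => ENNReal.ofReal_lt_top), IntegrableOn]
  refine integrable_congr ?_
  filter_upwards [ae_restrict_mem Metric.isOpen_ball.measurableSet] with z hz
  rw [ENNReal.toReal_ofReal (weightDensity_nonneg_of_mem_ball ht hz), Complex.real_smul]

theorem integral_bergmanMeasure (ht : -1 < t) (f : ℂ → ℂ) :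
    ∫ z, f z ∂bergmanMeasure t
      = ∫ z in Metric.ball (0 : ℂ) 1, (weightDensity t (‖z‖ ^ 2) : ℂ) * f z := by
  rw [bergmanMeasure_eq, integral_withDensity_eq_integral_toReal_smul
    measurable_weightDensity_norm_sq.ennreal_ofReal
    (Eventually.of_forall fun _ => ENNReal.ofReal_lt_top)]
  refine setIntegral_congr_fun Metric.isOpen_ball.measurableSet fun z hz => ?_
  rw [ENNReal.toReal_ofReal (weightDensity_nonneg_of_mem_ball ht hz), Complex.real_smul]

theorem isFiniteMeasure_bergmanMeasure (ht : -1 < t) : IsFiniteMeasure (bergmanMeasure t) := by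
  have h : Integrable (fun _ : ℂ => (1 : ℂ)) (bergmanMeasure t) := by
    rw [integrable_bergmanMeasure_iff ht]
    have := (integrableOn_comp_norm_sq (integrableOn_weightDensity ht)).ofReal (𝕜 := ℂ)
    simpa [IntegrableOn] using this
  rw [integrable_const_iff] at h
  exact h.resolve_left one_ne_zero

theorem aestronglyMeasurable_bergmanMeasure {h : ℂ → ℂ}
    (hc : ContinuousOn h (Metric.ball 0 1)) : AEStronglyMeasurable h (bergmanMeasure t) :=
  (hc.aestronglyMeasurable Metric.isOpen_ball.measurableSet).mono_ac
    (withDensity_absolutelyContinuous _ _)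

theorem memLp_bergmanMeasure_of_bound (ht : -1 < t) {h : ℂ → ℂ} {p : ENNReal}
    (hc : ContinuousOn h (Metric.ball 0 1)) {C : ℝ}
    (hC : ∀ z ∈ Metric.ball (0 : ℂ) 1, ‖h z‖ ≤ C) : MemLp h p (bergmanMeasure t) := by
  have := isFiniteMeasure_bergmanMeasure ht
  refine MemLp.of_bound (aestronglyMeasurable_bergmanMeasure hc) C ?_
  filter_upwards [ae_mem_ball_bergmanMeasure] with z hz using hC z hz

theorem inner_eq_integral {u v : Lp ℂ 2 (bergmanMeasure t)} {a b : ℂ → ℂ}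
    (hu : u =ᵐ[bergmanMeasure t] a) (hv : v =ᵐ[bergmanMeasure t] b) :
    (inner ℂ u v : ℂ) = ∫ z, (starRingEnd ℂ) (a z) * b z ∂bergmanMeasure t := by
  rw [L2.inner_def]
  refine integral_congr_ae ?_
  filter_upwards [hu, hv] with z h1 h2
  rw [h1, h2, RCLike.inner_apply, mul_comm]

theorem integrable_conj_mul {a b : ℂ → ℂ} (ha : MemLp a 2 (bergmanMeasure t))
    (hb : MemLp b 2 (bergmanMeasure t)) :
    Integrable (fun z => (starRingEnd ℂ) (a z) * b z) (bergmanMeasure t) :=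
  MemLp.integrable_mul (p := 2) (q := 2) ha.star hb

/-- The element of the Bergman space represented by a square integrable holomorphic function. -/
noncomputable def toBergman (t : ℝ) (h : ℂ → ℂ) (hh : DifferentiableOn ℂ h (Metric.ball 0 1))
    (hm : MemLp h 2 (bergmanMeasure t)) : bergmanSpace t :=
  ⟨hm.toLp h, h, hh, hm.coeFn_toLp⟩

theorem coeFn_toBergman {h : ℂ → ℂ} (hh : DifferentiableOn ℂ h (Metric.ball 0 1))
    (hm : MemLp h 2 (bergmanMeasure t)) :
    (toBergman t h hh hm : Lp ℂ 2 (bergmanMeasure t)) =ᵐ[bergmanMeasure t] h :=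
  hm.coeFn_toLp

/-- The holomorphic representative of an element of the Bergman space. -/
noncomputable def holo (u : bergmanSpace t) : ℂ → ℂ := u.2.choose

theorem differentiableOn_holo (u : bergmanSpace t) :
    DifferentiableOn ℂ (holo u) (Metric.ball 0 1) := u.2.choose_spec.1

theorem coeFn_eq_holo (u : bergmanSpace t) :
    (u : Lp ℂ 2 (bergmanMeasure t)) =ᵐ[bergmanMeasure t] holo u := u.2.choose_spec.2

theorem memLp_holo (u : bergmanSpace t) : MemLp (holo u) 2 (bergmanMeasure t) :=
  (memLp_congr_ae (coeFn_eq_holo u)).mp (Lp.memLp _)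

end BergmanMeasure

/-! ### The orthonormal basis of monomials -/

section Monomials

variable {t : ℝ}

/-- The moment `∫ |z|^{2n} dλ_t`. -/
noncomputable def bergmanMoment (t : ℝ) (n : ℕ) : ℝ :=
  Real.pi * ∫ x in Ioo 0 1, x ^ n * weightDensity t x

theorem integrableOn_pow_mul_weightDensity (ht : -1 < t) (n : ℕ) :
    IntegrableOn (fun x => x ^ n * weightDensity t x) (Ioo 0 1) := by
  refine (integrableOn_weightDensity ht).bdd_mul (c := 1) (by fun_prop) ?_
  filter_upwards [ae_restrict_mem measurableSet_Ioo] with x hx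
  rw [Real.norm_of_nonneg (pow_nonneg hx.1.le n)]
  exact pow_le_one₀ hx.1.le hx.2.le

theorem bergmanMoment_pos (ht : -1 < t) (n : ℕ) : 0 < bergmanMoment t n := by
  have hpi := Real.pi_pos
  refine mul_pos hpi ?_
  rw [← integral_Ioc_eq_integral_Ioo, ← intervalIntegral.integral_of_le zero_le_one]
  refine intervalIntegral.intervalIntegral_pos_of_pos_on
    ((intervalIntegrable_iff_integrableOn_Ioo_of_le zero_le_one).mpr
      (integrableOn_pow_mul_weightDensity ht n)) (fun x hx => ?_) zero_lt_one
  have h1 : 0 < 1 - x := by linarith [hx.2]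
  have h2 : 0 < t + 1 := by linarith
  have := hx.1
  unfold weightDensity
  positivity

theorem bergmanMoment_succ (ht : -1 < t) (n : ℕ) :
    (n + t + 2) * bergmanMoment t (n + 1) = (n + 1) * bergmanMoment t n := by
  have hi1 := (integrableOn_pow_mul_weightDensity ht n).const_mul ((n : ℝ) + 1)
  have hi2 := (integrableOn_pow_mul_weightDensity ht (n + 1)).const_mul ((n : ℝ) + t + 2)
  have h := setIntegral_Ioo_of_hasDerivAt zero_lt_one
    (f := fun x => (t + 1) / Real.pi * (x ^ (n + 1) * (1 - x) ^ (t + 1)))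
    (f' := fun x => (n + 1) * (x ^ n * weightDensity t x)
      - (n + t + 2) * (x ^ (n + 1) * weightDensity t x))
    (fa := 0) (fb := 0) ?_ (hi1.sub hi2) ?_ ?_
  · rw [integral_sub hi1 hi2, integral_const_mul, integral_const_mul, sub_zero, sub_eq_zero] at h
    unfold bergmanMoment
    rw [mul_left_comm, ← h]
    ring
  · intro x hx
    have h1x : 0 < 1 - x := by linarith [hx.2]
    refine (((hasDerivAt_pow (n + 1) x).mul (hasDerivAt_one_sub_rpow hx.2)).const_mul
      ((t + 1) / Real.pi)).congr_deriv ?_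
    rw [Real.rpow_add_one h1x.ne', weightDensity]
    simp only [Nat.add_sub_cancel]
    push_cast
    ring
  · have hc : ContinuousAt
        (fun x : ℝ => (t + 1) / Real.pi * (x ^ (n + 1) * (1 - x) ^ (t + 1))) 0 := by
      refine ContinuousAt.const_mul (ContinuousAt.mul (by fun_prop) ?_) _
      exact ContinuousAt.rpow_const (by fun_prop) (Or.inl (by simp))
    simpa using hc.tendsto.mono_left (nhdsWithin_le_nhds (s := Ioi 0))
  · have hc : ContinuousAt (fun x : ℝ => x ^ (n + 1)) 1 := by fun_prop
    have := ((hc.tendsto.mono_left (nhdsWithin_le_nhds (s := Iio 1))).mul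
      (tendsto_one_sub_rpow (by linarith : 0 < t + 1))).const_mul ((t + 1) / Real.pi)
    simpa using this

theorem integral_conj_pow_mul (ht : -1 < t) (n : ℕ) {q : ℂ → ℂ}
    (hq : DifferentiableOn ℂ q (Metric.ball 0 1))
    (hm : MemLp (fun z => z ^ n * q z) 2 (bergmanMeasure t)) :
    ∫ z, (starRingEnd ℂ) (z ^ n) * (z ^ n * q z) ∂bergmanMeasure t = bergmanMoment t n * q 0 := by
  have hb : MemLp (fun z : ℂ => z ^ n) 2 (bergmanMeasure t) :=
    memLp_bergmanMeasure_of_bound ht (C := 1) (by fun_prop) fun z hz => by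
      rw [norm_pow]
      exact pow_le_one₀ (norm_nonneg z) (mem_ball_zero_iff.mp hz).le
  have hint := (integrable_bergmanMeasure_iff ht).mp (integrable_conj_mul hb hm)
  have e : ∀ z : ℂ, (weightDensity t (‖z‖ ^ 2) : ℂ) * ((starRingEnd ℂ) (z ^ n) * (z ^ n * q z))
      = (((‖z‖ ^ 2) ^ n * weightDensity t (‖z‖ ^ 2) : ℝ) : ℂ) * q z := by
    intro z
    rw [map_pow, ← mul_assoc ((starRingEnd ℂ) z ^ n), ← mul_pow, Complex.conj_mul']
    push_cast
    ring
  rw [integral_bergmanMeasure ht]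
  simp only [e] at hint ⊢
  rw [setIntegral_ball_radial_mul_of_differentiableOn
    (κ := fun x => x ^ n * weightDensity t x) (integrableOn_pow_mul_weightDensity ht n) hq hint]
  rfl

theorem memLp_pow (ht : -1 < t) (n : ℕ) {p : ENNReal} :
    MemLp (fun z : ℂ => z ^ n) p (bergmanMeasure t) :=
  memLp_bergmanMeasure_of_bound ht (C := 1) (by fun_prop) fun z hz => by
    rw [norm_pow]
    exact pow_le_one₀ (norm_nonneg z) (mem_ball_zero_iff.mp hz).le

theorem integral_conj_pow_mul_pow (ht : -1 < t) (n m : ℕ) :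
    ∫ z, (starRingEnd ℂ) (z ^ n) * z ^ m ∂bergmanMeasure t
      = if n = m then (bergmanMoment t n : ℂ) else 0 := by
  have key : ∀ n k : ℕ, ∫ z, (starRingEnd ℂ) (z ^ n) * z ^ (n + k) ∂bergmanMeasure t
      = bergmanMoment t n * 0 ^ k := by
    intro n k
    have h := integral_conj_pow_mul ht n (q := fun z => z ^ k) (by fun_prop)
      (by simpa only [← pow_add] using memLp_pow ht (n + k))
    simpa only [← pow_add] using h
  rcases le_total n m with h | h
  · obtain ⟨k, rfl⟩ := Nat.exists_eq_add_of_le h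
    rw [key]
    rcases Nat.eq_zero_or_pos k with rfl | hk
    · simp
    · rw [zero_pow hk.ne', mul_zero, if_neg (by omega)]
  · obtain ⟨k, rfl⟩ := Nat.exists_eq_add_of_le h
    have h1 := congrArg (starRingEnd ℂ) (key m k)
    rw [← integral_conj] at h1
    simp only [map_mul, Complex.conj_conj, map_pow, map_zero, Complex.conj_ofReal] at h1
    simp only [map_pow]
    simp_rw [mul_comm ((starRingEnd ℂ) _ ^ (m + k))]
    rw [h1]
    rcases Nat.eq_zero_or_pos k with rfl | hk
    · simp
    · rw [zero_pow hk.ne', mul_zero, if_neg (by omega)]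

/-- The normalized monomial `z^n / √c_n`, where `c_n` is the `n`-th moment. -/
noncomputable def unitMonomial (t : ℝ) (n : ℕ) (z : ℂ) : ℂ :=
  ((Real.sqrt (bergmanMoment t n))⁻¹ : ℝ) * z ^ n

theorem differentiableOn_unitMonomial (n : ℕ) :
    DifferentiableOn ℂ (unitMonomial t n) (Metric.ball 0 1) := by
  unfold unitMonomial
  fun_prop

theorem memLp_unitMonomial (ht : -1 < t) (n : ℕ) :
    MemLp (unitMonomial t n) 2 (bergmanMeasure t) :=
  (memLp_pow ht n).const_mul _

/-- Completeness of the monomials. -/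
theorem eqOn_zero_of_forall_integral_conj_pow (ht : -1 < t) {h : ℂ → ℂ}
    (hh : DifferentiableOn ℂ h (Metric.ball 0 1)) (hm : MemLp h 2 (bergmanMeasure t))
    (h0 : ∀ n : ℕ, ∫ z, (starRingEnd ℂ) (z ^ n) * h z ∂bergmanMeasure t = 0) :
    EqOn h 0 (Metric.ball 0 1) := by
  have hnhds : Metric.ball (0 : ℂ) 1 ∈ 𝓝 (0 : ℂ) := Metric.ball_mem_nhds 0 one_pos
  -- `h` is divisible by every power of `z`, because the quotient vanishes at the origin
  have hdiv : ∀ n : ℕ, ∃ q : ℂ → ℂ, DifferentiableOn ℂ q (Metric.ball 0 1) ∧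
      ∀ z, h z = z ^ n * q z := by
    intro n
    induction n with
    | zero => exact ⟨h, hh, fun z => by simp⟩
    | succ n ih =>
      obtain ⟨q, hq, hqe⟩ := ih
      have hq0 : q 0 = 0 := by
        have h1 := integral_conj_pow_mul ht n hq (by simpa only [← hqe] using hm)
        simp only [← hqe] at h1
        rw [h0 n] at h1
        exact (mul_eq_zero.mp h1.symm).resolve_left
          (by exact_mod_cast (bergmanMoment_pos ht n).ne')
      refine ⟨dslope q 0, (Complex.differentiableOn_dslope hnhds).mpr hq, fun z => ?_⟩
      have := sub_smul_dslope q 0 z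
      rw [sub_zero, hq0, sub_zero, smul_eq_mul] at this
      rw [hqe z, pow_succ, mul_assoc, this]
  have han : AnalyticOnNhd ℂ h (Metric.ball 0 1) := hh.analyticOnNhd Metric.isOpen_ball
  have hord : analyticOrderAt h 0 = ⊤ := by
    rw [ENat.eq_top_iff_forall_ge]
    intro n
    rw [natCast_le_analyticOrderAt (han 0 (Metric.mem_ball_self one_pos))]
    obtain ⟨q, hq, hqe⟩ := hdiv n
    refine ⟨q, (hq.analyticOnNhd Metric.isOpen_ball) 0 (Metric.mem_ball_self one_pos), ?_⟩
    exact Eventually.of_forall fun z => by simp [hqe z]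
  exact han.eqOn_zero_of_preconnected_of_eventuallyEq_zero
    (convex_ball 0 1).isPreconnected (Metric.mem_ball_self one_pos)
    (analyticOrderAt_eq_top.mp hord)

theorem inner_toBergman {a b : ℂ → ℂ} (ha : DifferentiableOn ℂ a (Metric.ball 0 1))
    (hb : DifferentiableOn ℂ b (Metric.ball 0 1)) (ham : MemLp a 2 (bergmanMeasure t))
    (hbm : MemLp b 2 (bergmanMeasure t)) :
    (inner ℂ (toBergman t a ha ham) (toBergman t b hb hbm) : ℂ)
      = ∫ z, (starRingEnd ℂ) (a z) * b z ∂bergmanMeasure t :=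
  inner_eq_integral (coeFn_toBergman ha ham) (coeFn_toBergman hb hbm)

theorem integral_conj_unitMonomial_mul (ht : -1 < t) (n m : ℕ) :
    ∫ z, (starRingEnd ℂ) (unitMonomial t n z) * unitMonomial t m z ∂bergmanMeasure t
      = if n = m then 1 else 0 := by
  have e : ∀ z : ℂ, (starRingEnd ℂ) (unitMonomial t n z) * unitMonomial t m z
      = (((Real.sqrt (bergmanMoment t n))⁻¹ : ℝ) * ((Real.sqrt (bergmanMoment t m))⁻¹ : ℝ) : ℂ)
        * ((starRingEnd ℂ) (z ^ n) * z ^ m) := by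
    intro z
    rw [unitMonomial, unitMonomial, map_mul, Complex.conj_ofReal]
    ring
  simp_rw [e]
  rw [integral_const_mul, integral_conj_pow_mul_pow ht]
  split_ifs with h
  · subst h
    have hp := bergmanMoment_pos ht n
    rw [← Complex.ofReal_mul, ← Complex.ofReal_mul, ← mul_inv, Real.mul_self_sqrt hp.le,
      inv_mul_cancel₀ hp.ne', Complex.ofReal_one]
  · rw [mul_zero]

/-- The normalized monomials, as elements of the Bergman space. -/
noncomputable def bergmanMonomial (ht : -1 < t) (n : ℕ) : bergmanSpace t :=
  toBergman t (unitMonomial t n) (differentiableOn_unitMonomial n) (memLp_unitMonomial ht n)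

theorem orthonormal_bergmanMonomial (ht : -1 < t) : Orthonormal ℂ (bergmanMonomial ht) := by
  rw [orthonormal_iff_ite]
  intro n m
  rw [bergmanMonomial, bergmanMonomial, inner_toBergman, integral_conj_unitMonomial_mul ht]

theorem span_bergmanMonomial_orthogonal (ht : -1 < t) :
    (Submodule.span ℂ (Set.range (bergmanMonomial ht)))ᗮ = ⊥ := by
  rw [Submodule.eq_bot_iff]
  intro u hu
  have h0 : ∀ n : ℕ, ∫ z, (starRingEnd ℂ) (z ^ n) * holo u z ∂bergmanMeasure t = 0 := by
    intro n
    have h1 : (inner ℂ (bergmanMonomial ht n) u : ℂ) = 0 :=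
      (Submodule.mem_orthogonal _ _).mp hu _ (Submodule.subset_span ⟨n, rfl⟩)
    rw [Submodule.coe_inner, bergmanMonomial,
      inner_eq_integral (coeFn_toBergman _ _) (coeFn_eq_holo u)] at h1
    simp only [unitMonomial, map_mul, Complex.conj_ofReal, mul_assoc] at h1
    rw [integral_const_mul] at h1
    refine (mul_eq_zero.mp h1).resolve_left ?_
    have := Real.sqrt_pos.mpr (bergmanMoment_pos ht n)
    exact_mod_cast (inv_pos.mpr this).ne'
  have hz := eqOn_zero_of_forall_integral_conj_pow ht (differentiableOn_holo u) (memLp_holo u) h0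
  ext1
  rw [Submodule.coe_zero, Lp.eq_zero_iff_ae_eq_zero]
  filter_upwards [coeFn_eq_holo u, ae_mem_ball_bergmanMeasure] with z h1 h2
  rw [h1, hz h2]

/-- The normalized monomials form an orthonormal basis of the Bergman space. -/
noncomputable def monomialBasis (ht : -1 < t) : HilbertBasis ℕ ℂ (bergmanSpace t) :=
  HilbertBasis.mkOfOrthogonalEqBot (orthonormal_bergmanMonomial ht)
    (span_bergmanMonomial_orthogonal ht)

theorem monomialBasis_apply (ht : -1 < t) (n : ℕ) : monomialBasis ht n = bergmanMonomial ht n := by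
  rw [monomialBasis, HilbertBasis.coe_mkOfOrthogonalEqBot]

theorem coeFn_monomialBasis (ht : -1 < t) (n : ℕ) :
    (monomialBasis ht n : Lp ℂ 2 (bergmanMeasure t)) =ᵐ[bergmanMeasure t] unitMonomial t n := by
  rw [monomialBasis_apply]
  exact coeFn_toBergman _ _

end Monomials

/-! ### The reproducing kernel -/

section Kernel

variable {t : ℝ}

/-- The reproducing kernel at `z`, as a function of `w`: `⟨bergmanKernel t z, h⟩ = h z`. -/
noncomputable def bergmanKernel (t : ℝ) (z w : ℂ) : ℂ :=
  (1 - (starRingEnd ℂ) z * w) ^ (-(2 + t) : ℂ)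

theorem one_sub_conj_mul_mem_slitPlane {z w : ℂ} (hz : ‖z‖ < 1) (hw : ‖w‖ < 1) :
    1 - (starRingEnd ℂ) z * w ∈ Complex.slitPlane := by
  rw [sub_eq_add_neg]
  apply Complex.mem_slitPlane_of_norm_lt_one
  rw [norm_neg, norm_mul, RCLike.norm_conj]
  nlinarith [norm_nonneg z, norm_nonneg w]

theorem differentiableOn_bergmanKernel {z : ℂ} (hz : ‖z‖ < 1) :
    DifferentiableOn ℂ (bergmanKernel t z) (Metric.ball 0 1) := by
  unfold bergmanKernel
  refine DifferentiableOn.cpow_const (by fun_prop) fun w hw => ?_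
  exact one_sub_conj_mul_mem_slitPlane hz (mem_ball_zero_iff.mp hw)

theorem norm_bergmanKernel (z w : ℂ) :
    ‖bergmanKernel t z w‖ = ‖1 - (starRingEnd ℂ) z * w‖ ^ (-(2 + t)) := by
  rw [bergmanKernel, ← Complex.norm_cpow_real]
  push_cast
  rfl

theorem norm_bergmanKernel_le (ht : -1 < t) {z w : ℂ} (hz : ‖z‖ < 1) (hw : ‖w‖ < 1) :
    ‖bergmanKernel t z w‖ ≤ (1 - ‖z‖) ^ (-(2 + t)) := by
  rw [norm_bergmanKernel]
  refine Real.rpow_le_rpow_of_nonpos (by linarith) ?_ (by linarith)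
  have h1 := norm_sub_norm_le 1 ((starRingEnd ℂ) z * w)
  rw [norm_one, norm_mul, RCLike.norm_conj] at h1
  nlinarith [norm_nonneg z, norm_nonneg w]

theorem memLp_bergmanKernel (ht : -1 < t) {z : ℂ} (hz : ‖z‖ < 1) {p : ENNReal} :
    MemLp (bergmanKernel t z) p (bergmanMeasure t) :=
  memLp_bergmanMeasure_of_bound ht (differentiableOn_bergmanKernel hz).continuousOn
    fun _ hw => norm_bergmanKernel_le ht hz (mem_ball_zero_iff.mp hw)

theorem bergmanKernel_self (z : ℂ) (hz : ‖z‖ < 1) :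
    bergmanKernel t z z = ((1 - ‖z‖ ^ 2) ^ (-(2 + t)) : ℝ) := by
  rw [bergmanKernel, Complex.conj_mul', Complex.ofReal_cpow (by nlinarith [norm_nonneg z])]
  push_cast
  rfl

theorem bergmanKernel_mobius {z u : ℂ} (hz : ‖z‖ < 1) (hu : ‖u‖ < 1) :
    bergmanKernel t z (mobius z u) * bergmanKernel t z u
      = ((1 - ‖z‖ ^ 2) ^ (-(2 + t)) : ℝ) := by
  have hA : 0 < 1 - ‖z‖ ^ 2 := by nlinarith [norm_nonneg z]
  have hs := one_sub_conj_mul_mem_slitPlane hz hu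
  have h0 := Complex.slitPlane_ne_zero hs
  have hA0 : ((1 - ‖z‖ ^ 2 : ℝ) : ℂ) ≠ 0 := by exact_mod_cast hA.ne'
  have e : (1 - (‖z‖ ^ 2 : ℝ) : ℂ) = ((1 - ‖z‖ ^ 2 : ℝ) : ℂ) := by push_cast; rfl
  rw [bergmanKernel, bergmanKernel, one_sub_conj_mul_mobius hz hu.le, e, div_eq_mul_inv,
    Complex.cpow_def_of_ne_zero (mul_ne_zero hA0 (inv_ne_zero h0)),
    Complex.log_ofReal_mul hA (inv_ne_zero h0), Complex.log_inv _ (Complex.slitPlane_arg_ne_pi hs),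
    Complex.cpow_def_of_ne_zero h0, ← Complex.exp_add, Real.rpow_def_of_pos hA, Complex.ofReal_exp]
  congr 1
  push_cast
  ring

/-- The Bergman measure is quasi-invariant under the automorphism `φ_z`, with density the
normalized square of the reproducing kernel. -/
theorem mobiusJac_mul_weightDensity {z u : ℂ} (hz : ‖z‖ < 1) (hu : ‖u‖ < 1) :
    mobiusJac z u * weightDensity t (‖mobius z u‖ ^ 2)
      = (1 - ‖z‖ ^ 2) ^ (2 + t) * ‖bergmanKernel t z u‖ ^ 2 * weightDensity t (‖u‖ ^ 2) := by
  have hA : 0 < 1 - ‖z‖ ^ 2 := by nlinarith [norm_nonneg z]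
  have hB : 0 < 1 - ‖u‖ ^ 2 := by nlinarith [norm_nonneg u]
  have hN : 0 < ‖1 - (starRingEnd ℂ) z * u‖ :=
    norm_pos_iff.mpr (one_sub_conj_mul_ne_zero hz hu.le)
  rw [norm_bergmanKernel, weightDensity, weightDensity, one_sub_norm_mobius_sq hz hu.le, mobiusJac]
  set N := ‖1 - (starRingEnd ℂ) z * u‖
  rw [Real.div_rpow (by positivity) (by positivity), Real.mul_rpow hA.le hB.le,
    Real.rpow_add hA, Real.rpow_neg hN.le, Real.rpow_add hN, ← Real.rpow_natCast N 2,
    ← Real.rpow_mul hN.le, mul_comm ((2 : ℕ) : ℝ) t, Real.rpow_mul hN.le, Real.rpow_natCast]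
  have h1 : N ^ t ≠ 0 := (Real.rpow_pos_of_pos hN t).ne'
  have e1 : N ^ (2 : ℝ) = N ^ 2 := by exact_mod_cast Real.rpow_natCast N 2
  have e2 : (1 - ‖z‖ ^ 2) ^ (2 : ℝ) = (1 - ‖z‖ ^ 2) ^ 2 := by
    rw [← Real.rpow_natCast (1 - ‖z‖ ^ 2) 2, Nat.cast_ofNat]
  rw [e1, e2]
  generalize (1 - ‖z‖ ^ 2) ^ t = a
  generalize (1 - ‖u‖ ^ 2) ^ t = b
  generalize N ^ t = n at h1
  generalize (1 - ‖z‖ ^ 2) = c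
  field_simp

theorem integral_conj_bergmanKernel_mul (ht : -1 < t) {z : ℂ} (hz : ‖z‖ < 1) (F : ℂ → ℂ) :
    ∫ w, (starRingEnd ℂ) (bergmanKernel t z w) * F w ∂bergmanMeasure t
      = ∫ u, bergmanKernel t z u * F (mobius z u) ∂bergmanMeasure t ∧
    (Integrable (fun w => (starRingEnd ℂ) (bergmanKernel t z w) * F w) (bergmanMeasure t) ↔
      Integrable (fun u => bergmanKernel t z u * F (mobius z u)) (bergmanMeasure t)) := by
  have hA : 0 < 1 - ‖z‖ ^ 2 := by nlinarith [norm_nonneg z]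
  have e : ∀ u ∈ Metric.ball (0 : ℂ) 1, mobiusJac z u • ((weightDensity t (‖mobius z u‖ ^ 2) : ℂ) *
      ((starRingEnd ℂ) (bergmanKernel t z (mobius z u)) * F (mobius z u)))
      = (weightDensity t (‖u‖ ^ 2) : ℂ) * (bergmanKernel t z u * F (mobius z u)) := by
    intro u hu
    rw [mem_ball_zero_iff] at hu
    have h1 := mobiusJac_mul_weightDensity (t := t) hz hu
    have h2 := congrArg (starRingEnd ℂ) (bergmanKernel_mobius (t := t) hz hu)
    rw [map_mul, Complex.conj_ofReal] at h2
    have h3 : (1 - ‖z‖ ^ 2) ^ (2 + t) * (1 - ‖z‖ ^ 2) ^ (-(2 + t)) = 1 := by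
      rw [← Real.rpow_add hA, add_neg_cancel, Real.rpow_zero]
    rw [Complex.real_smul, ← mul_assoc, ← Complex.ofReal_mul, h1]
    push_cast
    have h4 := Complex.conj_mul' (bergmanKernel t z u)
    rw [← h4]
    calc _ = (((1 - ‖z‖ ^ 2) ^ (2 + t) : ℝ) : ℂ) *
          ((starRingEnd ℂ) (bergmanKernel t z (mobius z u)) *
            (starRingEnd ℂ) (bergmanKernel t z u)) * (bergmanKernel t z u *
              (weightDensity t (‖u‖ ^ 2) : ℂ) * F (mobius z u)) := by ring
      _ = _ := by
        rw [h2, ← Complex.ofReal_mul, h3, Complex.ofReal_one]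
        ring
  constructor
  · rw [integral_bergmanMeasure ht, integral_bergmanMeasure ht, ← integral_ball_mobius hz]
    exact setIntegral_congr_fun Metric.isOpen_ball.measurableSet e
  · rw [integrable_bergmanMeasure_iff ht, integrable_bergmanMeasure_iff ht,
      ← integrableOn_ball_mobius_iff hz]
    exact integrableOn_congr_fun e Metric.isOpen_ball.measurableSet

/-- Integrals against the normalized square of the reproducing kernel (Berezin transforms) after
the change of variables `w = φ_z u`. -/
theorem integral_norm_sq_bergmanKernel_mul (ht : -1 < t) {z : ℂ} (hz : ‖z‖ < 1) (F : ℂ → ℂ) :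
    ∫ w, (‖bergmanKernel t z w‖ ^ 2 : ℝ) * F w ∂bergmanMeasure t
      = ((1 - ‖z‖ ^ 2) ^ (-(2 + t)) : ℝ) * ∫ u, F (mobius z u) ∂bergmanMeasure t := by
  have h := (integral_conj_bergmanKernel_mul ht hz fun w => bergmanKernel t z w * F w).1
  rw [← integral_const_mul]
  calc _ = ∫ w, (starRingEnd ℂ) (bergmanKernel t z w) * (bergmanKernel t z w * F w)
        ∂bergmanMeasure t := by
        refine integral_congr_ae (Eventually.of_forall fun w => ?_)
        simp only
        rw [← mul_assoc, Complex.conj_mul']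
        push_cast
        rfl
    _ = _ := by
        rw [h]
        refine integral_congr_ae ?_
        filter_upwards [ae_mem_ball_bergmanMeasure] with u hu
        rw [← bergmanKernel_mobius hz (mem_ball_zero_iff.mp hu)]
        ring

theorem integral_conj_bergmanKernel_mul_of_differentiableOn (ht : -1 < t) {z : ℂ} (hz : ‖z‖ < 1)
    {h : ℂ → ℂ} (hh : DifferentiableOn ℂ h (Metric.ball 0 1))
    (hm : MemLp h 2 (bergmanMeasure t)) :
    ∫ w, (starRingEnd ℂ) (bergmanKernel t z w) * h w ∂bergmanMeasure t = h z := by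
  have hz' : z ∈ Metric.ball (0 : ℂ) 1 := mem_ball_zero_iff.mpr hz
  have hi := integrable_conj_mul (memLp_bergmanKernel ht hz) hm
  have hc := integral_conj_bergmanKernel_mul ht hz h
  have hi2 := (integrable_bergmanMeasure_iff ht).mp (hc.2.mp hi)
  have hd : DifferentiableOn ℂ (fun u => bergmanKernel t z u * h (mobius z u))
      (Metric.ball 0 1) :=
    (differentiableOn_bergmanKernel hz).mul
      (hh.comp (differentiableOn_mobius hz) fun u hu => mobius_mem_ball hz' hu)
  rw [hc.1, integral_bergmanMeasure ht,
    setIntegral_ball_radial_mul_of_differentiableOn (integrableOn_weightDensity ht) hd hi2,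
    pi_mul_setIntegral_weightDensity ht, mobius_zero_right, bergmanKernel]
  simp

/-- The reproducing kernel as an element of the Bergman space. -/
noncomputable def kernelVector (ht : -1 < t) {z : ℂ} (hz : ‖z‖ < 1) : bergmanSpace t :=
  toBergman t (bergmanKernel t z) (differentiableOn_bergmanKernel hz) (memLp_bergmanKernel ht hz)

theorem inner_kernelVector (ht : -1 < t) {z : ℂ} (hz : ‖z‖ < 1) (u : bergmanSpace t) :
    (inner ℂ (kernelVector ht hz) u : ℂ) = holo u z := by
  rw [Submodule.coe_inner, kernelVector, inner_eq_integral (coeFn_toBergman _ _) (coeFn_eq_holo u),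
    integral_conj_bergmanKernel_mul_of_differentiableOn ht hz (differentiableOn_holo u)
      (memLp_holo u)]

theorem inner_kernelVector_toBergman (ht : -1 < t) {z : ℂ} (hz : ‖z‖ < 1) {h : ℂ → ℂ}
    (hh : DifferentiableOn ℂ h (Metric.ball 0 1)) (hm : MemLp h 2 (bergmanMeasure t)) :
    (inner ℂ (kernelVector ht hz) (toBergman t h hh hm) : ℂ) = h z := by
  rw [Submodule.coe_inner, kernelVector, inner_eq_integral (coeFn_toBergman _ _)
    (coeFn_toBergman _ _), integral_conj_bergmanKernel_mul_of_differentiableOn ht hz hh hm]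

/-- The projection onto the Bergman space is the integral operator defined by the reproducing
kernel. -/
theorem holo_projection (ht : -1 < t) {z : ℂ} (hz : ‖z‖ < 1) {u : Lp ℂ 2 (bergmanMeasure t)}
    {φ : ℂ → ℂ} (hu : u =ᵐ[bergmanMeasure t] φ) :
    holo ((bergmanSpace t).orthogonalProjectionOnto u) z
      = ∫ w, (starRingEnd ℂ) (bergmanKernel t z w) * φ w ∂bergmanMeasure t := by
  rw [← inner_kernelVector ht hz,
    Submodule.inner_orthogonalProjectionOnto_eq_of_mem_left, kernelVector,
    inner_eq_integral (coeFn_toBergman _ _) hu]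

theorem norm_sq_kernelVector (ht : -1 < t) {z : ℂ} (hz : ‖z‖ < 1) :
    ‖kernelVector ht hz‖ ^ 2 = (1 - ‖z‖ ^ 2) ^ (-(2 + t)) := by
  have h := inner_kernelVector_toBergman ht hz (differentiableOn_bergmanKernel (t := t) hz)
    (memLp_bergmanKernel ht hz)
  rw [bergmanKernel_self z hz] at h
  have h2 := inner_self_eq_norm_sq_to_K (𝕜 := ℂ) (kernelVector ht hz)
  rw [kernelVector] at h2 h
  rw [kernelVector]
  rw [h] at h2
  rw [← Complex.ofReal_inj]
  push_cast
  exact h2.symm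

theorem inner_monomialBasis_kernelVector (ht : -1 < t) {z : ℂ} (hz : ‖z‖ < 1) (n : ℕ) :
    (inner ℂ (kernelVector ht hz) (monomialBasis ht n) : ℂ) = unitMonomial t n z := by
  rw [monomialBasis_apply, bergmanMonomial, inner_kernelVector_toBergman]

theorem hasSum_norm_sq_unitMonomial (ht : -1 < t) {z : ℂ} (hz : ‖z‖ < 1) :
    HasSum (fun n => ‖unitMonomial t n z‖ ^ 2) ((1 - ‖z‖ ^ 2) ^ (-(2 + t))) := by
  have h := (monomialBasis ht).hasSum_norm_inner_sq (kernelVector ht hz)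
  rw [norm_sq_kernelVector] at h
  refine h.congr_fun fun n => ?_
  rw [← inner_monomialBasis_kernelVector ht hz,
    ← inner_conj_symm (𝕜 := ℂ) (kernelVector ht hz) (monomialBasis ht n), RCLike.norm_conj]

/-- Parseval's identity against the expansion of the reproducing kernel in monomials. -/
theorem hasSum_inner_mul_conj_unitMonomial (ht : -1 < t) {z : ℂ} (hz : ‖z‖ < 1)
    (v : Lp ℂ 2 (bergmanMeasure t)) :
    HasSum (fun n => (inner ℂ v (monomialBasis ht n : Lp ℂ 2 (bergmanMeasure t)) : ℂ)
      * (starRingEnd ℂ) (unitMonomial t n z))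
      (inner ℂ v (kernelVector ht hz : Lp ℂ 2 (bergmanMeasure t))) := by
  have h := (monomialBasis ht).hasSum_inner_mul_inner
    ((bergmanSpace t).orthogonalProjectionOnto v) (kernelVector ht hz)
  rw [Submodule.inner_orthogonalProjectionOnto_eq_of_mem_right] at h
  refine h.congr_fun fun n => ?_
  rw [Submodule.inner_orthogonalProjectionOnto_eq_of_mem_right,
    ← inner_monomialBasis_kernelVector ht hz,
    inner_conj_symm (𝕜 := ℂ) (monomialBasis ht n) (kernelVector ht hz)]

end Kernel

/-! ### Hankel operators -/

section Hankel

variable {t : ℝ}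

open Classical in
/-- Multiplication by an essentially bounded symbol, as an operator from the Bergman space to
`L²`; for other symbols the value `0` is a convention. -/
noncomputable def symbolMul (t : ℝ) (g : ℂ → ℂ) : bergmanSpace t →L[ℂ] Lp ℂ 2 (bergmanMeasure t) :=
  if hg : MemLp g ⊤ (bergmanMeasure t) then
    bergmanMul t (hg.toLp g) ∘L (bergmanSpace t).subtypeL
  else 0

/-- The Hankel operator `H_g = (1 - P) M_g` from the Bergman space to `L²`. -/
noncomputable def hankel (t : ℝ) (g : ℂ → ℂ) : bergmanSpace t →L[ℂ] Lp ℂ 2 (bergmanMeasure t) :=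
  symbolMul t g -
    (bergmanSpace t).subtypeL ∘L (bergmanSpace t).orthogonalProjectionOnto ∘L symbolMul t g

theorem coeFn_symbolMul {g : ℂ → ℂ} (hg : MemLp g ⊤ (bergmanMeasure t)) (u : bergmanSpace t)
    {h : ℂ → ℂ} (hu : (u : Lp ℂ 2 (bergmanMeasure t)) =ᵐ[bergmanMeasure t] h) :
    symbolMul t g u =ᵐ[bergmanMeasure t] fun z => g z * h z := by
  rw [symbolMul, dif_pos hg]
  have h1 := (ContinuousLinearMap.mul ℂ ℂ).coeFn_holder (r := 2) (hg.toLp g)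
    (u : Lp ℂ 2 (bergmanMeasure t))
  filter_upwards [h1, hg.coeFn_toLp, hu] with z h2 h3 h4
  rw [← h3, ← h4]
  exact h2

theorem toeplitz_eq {g : ℂ → ℂ} (hg : MemLp g ⊤ (bergmanMeasure t)) :
    toeplitz t g = (bergmanSpace t).orthogonalProjectionOnto ∘L symbolMul t g := by
  rw [toeplitz, dif_pos hg, symbolMul, dif_pos hg]

theorem hankel_apply (g : ℂ → ℂ) (u : bergmanSpace t) :
    hankel t g u = symbolMul t g u -
      ((bergmanSpace t).orthogonalProjectionOnto (symbolMul t g u) : Lp ℂ 2 (bergmanMeasure t)) :=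
  rfl

theorem inner_hankel_hankel_eq (f g : ℂ → ℂ) (u v : bergmanSpace t) :
    (inner ℂ (hankel t f u) (hankel t g v) : ℂ) = inner ℂ (symbolMul t f u) (hankel t g v) := by
  rw [hankel_apply f u, inner_sub_left, sub_eq_self, hankel_apply, inner_sub_right,
    ← Submodule.coe_inner, Submodule.inner_orthogonalProjectionOnto_eq_of_mem_left, sub_self]

theorem inner_hankel_hankel (f g : ℂ → ℂ) (u v : bergmanSpace t) :
    (inner ℂ (hankel t f u) (hankel t g v) : ℂ) = inner ℂ (symbolMul t f u) (symbolMul t g v) -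
      inner ℂ ((bergmanSpace t).orthogonalProjectionOnto (symbolMul t f u))
        ((bergmanSpace t).orthogonalProjectionOnto (symbolMul t g v)) := by
  rw [inner_hankel_hankel_eq, hankel_apply, inner_sub_right,
    Submodule.inner_orthogonalProjectionOnto_eq_of_mem_right]

theorem inner_symbolMul {f g : ℂ → ℂ} (hf : MemLp f ⊤ (bergmanMeasure t))
    (hg : MemLp g ⊤ (bergmanMeasure t)) {u v : bergmanSpace t} {a b : ℂ → ℂ}
    (hu : (u : Lp ℂ 2 (bergmanMeasure t)) =ᵐ[bergmanMeasure t] a)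
    (hv : (v : Lp ℂ 2 (bergmanMeasure t)) =ᵐ[bergmanMeasure t] b) :
    (inner ℂ (symbolMul t f u) (symbolMul t g v) : ℂ)
      = ∫ z, (starRingEnd ℂ) (f z * a z) * (g z * b z) ∂bergmanMeasure t :=
  inner_eq_integral (coeFn_symbolMul hf u hu) (coeFn_symbolMul hg v hv)

theorem memLp_conj {f : ℂ → ℂ} {p : ENNReal} (hf : MemLp f p (bergmanMeasure t)) :
    MemLp (fun z => (starRingEnd ℂ) (f z)) p (bergmanMeasure t) := hf.star

/-- The semi-commutator is a product of two Hankel operators. -/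
theorem semiCommutator_eq {f g : ℂ → ℂ} (hf : MemLp f ⊤ (bergmanMeasure t))
    (hg : MemLp g ⊤ (bergmanMeasure t)) :
    semiCommutator t f g = -(ContinuousLinearMap.adjoint (hankel t fun z => (starRingEnd ℂ) (f z))
      ∘L hankel t g) := by
  have hfg : MemLp (fun z => f z * g z) ⊤ (bergmanMeasure t) := hg.mul (r := ⊤) hf
  ext1 v
  refine ext_inner_left ℂ fun u => ?_
  have e1 : (inner ℂ (symbolMul t (fun z => (starRingEnd ℂ) (f z)) u) (symbolMul t g v) : ℂ)
      = inner ℂ (u : Lp ℂ 2 (bergmanMeasure t)) (symbolMul t (fun z => f z * g z) v) := by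
    rw [inner_symbolMul (memLp_conj hf) hg (coeFn_eq_holo u) (coeFn_eq_holo v),
      inner_eq_integral (coeFn_eq_holo u) (coeFn_symbolMul hfg v (coeFn_eq_holo v))]
    refine integral_congr_ae (Eventually.of_forall fun z => ?_)
    simp only [map_mul, Complex.conj_conj]
    ring
  have e2 : (inner ℂ (symbolMul t (fun z => (starRingEnd ℂ) (f z)) u)
      (toeplitz t g v : Lp ℂ 2 (bergmanMeasure t)) : ℂ)
      = inner ℂ (u : Lp ℂ 2 (bergmanMeasure t)) (symbolMul t f (toeplitz t g v)) := by
    rw [inner_eq_integral (coeFn_symbolMul (memLp_conj hf) u (coeFn_eq_holo u))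
      (coeFn_eq_holo (toeplitz t g v)), inner_eq_integral (coeFn_eq_holo u)
      (coeFn_symbolMul hf _ (coeFn_eq_holo (toeplitz t g v)))]
    refine integral_congr_ae (Eventually.of_forall fun z => ?_)
    simp only [map_mul, Complex.conj_conj]
    ring
  rw [neg_apply, inner_neg_right, ContinuousLinearMap.comp_apply,
    ContinuousLinearMap.adjoint_inner_right, inner_hankel_hankel_eq, hankel_apply, inner_sub_right,
    e1]
  rw [toeplitz_eq hg, ContinuousLinearMap.comp_apply] at e2
  rw [e2, semiCommutator, sub_apply, inner_sub_right, ContinuousLinearMap.comp_apply,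
    toeplitz_eq hf, toeplitz_eq hfg, toeplitz_eq hg, ContinuousLinearMap.comp_apply,
    ContinuousLinearMap.comp_apply, ContinuousLinearMap.comp_apply,
    Submodule.inner_orthogonalProjectionOnto_eq_of_mem_left,
    Submodule.inner_orthogonalProjectionOnto_eq_of_mem_left]
  ring

theorem continuousOn_of_norm_sub_le {g : ℂ → ℂ} {L : ℝ}
    (hg : ∀ z ∈ Metric.ball (0 : ℂ) 1, ∀ w ∈ Metric.ball (0 : ℂ) 1, ‖g z - g w‖ ≤ L * ‖z - w‖) :
    ContinuousOn g (Metric.ball 0 1) := by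
  have : LipschitzOnWith (Real.toNNReal L) g (Metric.ball 0 1) :=
    LipschitzOnWith.of_dist_le_mul fun z hz w hw => by
      rw [dist_eq_norm, dist_eq_norm]
      exact (hg z hz w hw).trans (mul_le_mul_of_nonneg_right (Real.le_coe_toNNReal L)
        (norm_nonneg _))
  exact this.continuousOn

theorem norm_le_of_norm_sub_le {g : ℂ → ℂ} {L : ℝ}
    (hg : ∀ z ∈ Metric.ball (0 : ℂ) 1, ∀ w ∈ Metric.ball (0 : ℂ) 1, ‖g z - g w‖ ≤ L * ‖z - w‖)
    {z : ℂ} (hz : z ∈ Metric.ball (0 : ℂ) 1) : ‖g z‖ ≤ ‖g 0‖ + |L| := by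
  have h1 := hg z hz 0 (Metric.mem_ball_self one_pos)
  have h2 : ‖z‖ < 1 := mem_ball_zero_iff.mp hz
  have h3 := norm_sub_norm_le (g z) (g 0)
  rw [sub_zero] at h1
  have h4 : L * ‖z‖ ≤ |L| := by
    calc L * ‖z‖ ≤ |L| * ‖z‖ := mul_le_mul_of_nonneg_right (le_abs_self L) (norm_nonneg z)
      _ ≤ |L| * 1 := mul_le_mul_of_nonneg_left h2.le (abs_nonneg L)
      _ = |L| := mul_one _
  linarith

theorem memLp_of_norm_sub_le (ht : -1 < t) {g : ℂ → ℂ} {L : ℝ} {p : ENNReal}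
    (hg : ∀ z ∈ Metric.ball (0 : ℂ) 1, ∀ w ∈ Metric.ball (0 : ℂ) 1, ‖g z - g w‖ ≤ L * ‖z - w‖) :
    MemLp g p (bergmanMeasure t) :=
  memLp_bergmanMeasure_of_bound ht (continuousOn_of_norm_sub_le hg) fun _ hz =>
    norm_le_of_norm_sub_le hg hz

theorem memLp_kernel_mul_conj_sub (ht : -1 < t) {g : ℂ → ℂ} (hg : MemLp g 2 (bergmanMeasure t))
    {z : ℂ} (hz : ‖z‖ < 1) :
    MemLp (fun w => bergmanKernel t z w * (starRingEnd ℂ) (g z - g w)) 2 (bergmanMeasure t) := by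
  have := isFiniteMeasure_bergmanMeasure ht
  exact MemLp.mul (p := ⊤) (q := 2) (memLp_conj ((memLp_const (g z)).sub hg))
    (memLp_bergmanKernel ht hz)

/-- `H_g h` is given by the kernel `(g z - g w) ⟨k_w, k_z⟩`. -/
theorem coeFn_hankel (ht : -1 < t) {g : ℂ → ℂ} (hg : MemLp g ⊤ (bergmanMeasure t))
    (hg2 : MemLp g 2 (bergmanMeasure t)) (u : bergmanSpace t) :
    ∀ᵐ z ∂bergmanMeasure t, ∀ hz : ‖z‖ < 1,
      hankel t g u z = inner ℂ ((memLp_kernel_mul_conj_sub ht hg2 hz).toLp _)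
        (u : Lp ℂ 2 (bergmanMeasure t)) := by
  have h1 := coeFn_symbolMul hg u (coeFn_eq_holo u)
  have h2 := coeFn_eq_holo ((bergmanSpace t).orthogonalProjectionOnto (symbolMul t g u))
  rw [hankel_apply]
  filter_upwards [Lp.coeFn_sub (symbolMul t g u)
    ((bergmanSpace t).orthogonalProjectionOnto (symbolMul t g u) : Lp ℂ 2 (bergmanMeasure t)),
    h1, h2] with z h3 h4 h5 hz
  rw [h3, Pi.sub_apply, h4, h5, holo_projection ht hz h1,
    inner_eq_integral (memLp_kernel_mul_conj_sub ht hg2 hz).coeFn_toLp (coeFn_eq_holo u)]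
  have hi1 := (integrable_conj_mul (memLp_bergmanKernel ht hz) (memLp_holo u)).const_mul (g z)
  have hi2 := integrable_conj_mul (memLp_bergmanKernel (t := t) ht hz)
    ((memLp_congr_ae h1).mp (Lp.memLp _))
  have e := integral_conj_bergmanKernel_mul_of_differentiableOn ht hz (differentiableOn_holo u)
    (memLp_holo u)
  rw [← e, ← integral_const_mul, ← integral_sub hi1 hi2]
  refine integral_congr_ae (Eventually.of_forall fun w => ?_)
  simp only [map_mul, Complex.conj_conj]
  ring

theorem enorm_sq_eq_lintegral (u : Lp ℂ 2 (bergmanMeasure t)) :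
    ‖u‖ₑ ^ 2 = ∫⁻ z, ‖u z‖ₑ ^ 2 ∂bergmanMeasure t := by
  have h := eLpNorm_nnreal_pow_eq_lintegral (f := u) (μ := bergmanMeasure t) (p := 2) two_ne_zero
  rw [Lp.enorm_def]
  simpa using h

theorem tsum_enorm_inner_sq_le (ht : -1 < t) (v : Lp ℂ 2 (bergmanMeasure t)) :
    ∑' n, ‖(inner ℂ v (monomialBasis ht n : Lp ℂ 2 (bergmanMeasure t)) : ℂ)‖ₑ ^ 2 ≤ ‖v‖ₑ ^ 2 := by
  have h := (monomialBasis ht).tsum_enorm_inner_sq ((bergmanSpace t).orthogonalProjectionOnto v)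
  have h2 : ‖(bergmanSpace t).orthogonalProjectionOnto v‖ₑ ≤ ‖v‖ₑ := by
    rw [enorm_le_iff_norm_le]
    exact Submodule.norm_orthogonalProjectionOnto_apply_le _ v
  calc _ = ‖(bergmanSpace t).orthogonalProjectionOnto v‖ₑ ^ 2 := by
        rw [← h]
        refine tsum_congr fun n => ?_
        rw [Submodule.inner_orthogonalProjectionOnto_eq_of_mem_left, ← inner_conj_symm,
          RCLike.enorm_conj]
    _ ≤ _ := by gcongr

theorem tsum_enorm_inner_sq_of_mem (ht : -1 < t) (u : bergmanSpace t) :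
    ∑' n, ‖(inner ℂ (u : Lp ℂ 2 (bergmanMeasure t))
      (monomialBasis ht n : Lp ℂ 2 (bergmanMeasure t)) : ℂ)‖ₑ ^ 2
      = ‖(u : Lp ℂ 2 (bergmanMeasure t))‖ₑ ^ 2 := by
  have h := (monomialBasis ht).tsum_enorm_inner_sq u
  have e : ‖(u : Lp ℂ 2 (bergmanMeasure t))‖ₑ = ‖u‖ₑ := rfl
  rw [e, ← h]
  refine tsum_congr fun n => ?_
  rw [← Submodule.coe_inner, ← inner_conj_symm (𝕜 := ℂ) u, RCLike.enorm_conj]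

theorem hsSum_hankel_eq_lintegral (ht : -1 < t) (g : ℂ → ℂ) :
    hsSum (monomialBasis ht) (hankel t g)
      = ∫⁻ z, ∑' n, ‖hankel t g (monomialBasis ht n) z‖ₑ ^ 2 ∂bergmanMeasure t := by
  rw [lintegral_tsum]
  · exact tsum_congr fun n => enorm_sq_eq_lintegral _
  · intro n
    exact (Lp.aestronglyMeasurable _).enorm.pow_const 2

/-- Domination of the Hilbert–Schmidt norm of a Hankel operator with Lipschitz symbol by the one
with symbol `z̄`: Bessel's inequality for the former kernel, Parseval's identity for the
latter, which is antiholomorphic. -/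
theorem hsSum_hankel_le_mul (ht : -1 < t) {g : ℂ → ℂ} {L : ℝ}
    (hg : ∀ z ∈ Metric.ball (0 : ℂ) 1, ∀ w ∈ Metric.ball (0 : ℂ) 1, ‖g z - g w‖ ≤ L * ‖z - w‖) :
    hsSum (monomialBasis ht) (hankel t g) ≤ ENNReal.ofReal (L ^ 2) *
      hsSum (monomialBasis ht) (hankel t fun z => (starRingEnd ℂ) z) := by
  have hL : 0 ≤ L := by
    have h1 := hg (1 / 2 : ℝ) (by simp; norm_num) 0 (by simp)
    have h2 : (0 : ℝ) ≤ L * (1 / 2) := by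
      refine (norm_nonneg _).trans (h1.trans (le_of_eq ?_))
      simp
    linarith
  have hc : ∀ z ∈ Metric.ball (0 : ℂ) 1, ∀ w ∈ Metric.ball (0 : ℂ) 1,
      ‖(starRingEnd ℂ) z - (starRingEnd ℂ) w‖ ≤ 1 * ‖z - w‖ := fun z _ w _ => by
    rw [← map_sub, RCLike.norm_conj, one_mul]
  rw [hsSum_hankel_eq_lintegral ht,
    hsSum_hankel_eq_lintegral ht,
    ← lintegral_const_mul' _ _ ENNReal.ofReal_ne_top]
  refine lintegral_mono_ae ?_
  have h1 := ae_all_iff.mpr fun n => coeFn_hankel ht (memLp_of_norm_sub_le ht hg)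
    (memLp_of_norm_sub_le ht hg) (monomialBasis ht n)
  have h2 := ae_all_iff.mpr fun n => coeFn_hankel ht (memLp_of_norm_sub_le ht hc)
    (memLp_of_norm_sub_le ht hc) (monomialBasis ht n)
  filter_upwards [h1, h2, ae_mem_ball_bergmanMeasure] with z h1 h2 hz
  have hz' := mem_ball_zero_iff.mp hz
  simp only [h1 _ hz', h2 _ hz']
  have hd : DifferentiableOn ℂ (fun w => bergmanKernel t z w *
      (starRingEnd ℂ) ((starRingEnd ℂ) z - (starRingEnd ℂ) w)) (Metric.ball 0 1) := by
    refine (differentiableOn_bergmanKernel hz').mul ?_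
    simp only [map_sub, Complex.conj_conj]
    fun_prop
  refine (tsum_enorm_inner_sq_le ht _).trans ?_
  have h3 := tsum_enorm_inner_sq_of_mem ht
    (toBergman t _ hd (memLp_kernel_mul_conj_sub ht (memLp_of_norm_sub_le ht hc) hz'))
  rw [toBergman] at h3
  simp only at h3
  rw [h3, ENNReal.ofReal_pow hL, ← mul_pow]
  gcongr
  rw [← ofReal_norm, ← ofReal_norm, ← ENNReal.ofReal_mul hL]
  refine ENNReal.ofReal_le_ofReal (Lp.norm_le_mul_norm_of_ae_le_mul ?_)
  filter_upwards [(memLp_kernel_mul_conj_sub ht (memLp_of_norm_sub_le ht hg) hz').coeFn_toLp,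
    (memLp_kernel_mul_conj_sub ht (memLp_of_norm_sub_le ht hc) hz').coeFn_toLp,
    ae_mem_ball_bergmanMeasure] with w e1 e2 hw
  rw [e1, e2, norm_mul, norm_mul, RCLike.norm_conj, RCLike.norm_conj, ← map_sub, RCLike.norm_conj]
  calc _ ≤ ‖bergmanKernel t z w‖ * (L * ‖z - w‖) := by gcongr; exact hg z hz w hw
    _ = _ := by ring

end Hankel

/-! ### Hankel operators with antiholomorphic monomial symbols -/

section ConjPow

variable {t : ℝ}

theorem norm_pow_sub_pow_le (n : ℕ) {z w : ℂ} (hz : ‖z‖ ≤ 1) (hw : ‖w‖ ≤ 1) :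
    ‖z ^ n - w ^ n‖ ≤ n * ‖z - w‖ := by
  rw [← Commute.geom_sum₂_mul (Commute.all z w) n, norm_mul]
  refine mul_le_mul_of_nonneg_right ?_ (norm_nonneg _)
  refine (norm_sum_le_of_le _ (f := fun i => z ^ i * w ^ (n - 1 - i)) (n := fun _ => 1)
    fun i _ => ?_).trans (by simp)
  rw [norm_mul, norm_pow, norm_pow]
  exact mul_le_one₀ (pow_le_one₀ (norm_nonneg z) hz) (by positivity)
    (pow_le_one₀ (norm_nonneg w) hw)

theorem memLp_conj_pow (ht : -1 < t) (n : ℕ) {p : ENNReal} :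
    MemLp (fun z : ℂ => (starRingEnd ℂ) (z ^ n)) p (bergmanMeasure t) :=
  memLp_conj (memLp_pow ht n)

/-- The quotient of moments `c_{k+n}/c_k`. -/
noncomputable def momentRatio (t : ℝ) (n k : ℕ) : ℝ := bergmanMoment t (k + n) / bergmanMoment t k

theorem tendsto_momentRatio (ht : -1 < t) (n : ℕ) :
    Tendsto (momentRatio t n) atTop (𝓝 1) := by
  have h1 : Tendsto (momentRatio t 1) atTop (𝓝 1) := by
    have e : momentRatio t 1 = fun k : ℕ => 1 - (t + 1) / (k + (t + 2)) := by
      ext k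
      have h := bergmanMoment_succ ht k
      have h2 := (bergmanMoment_pos ht k).ne'
      have h3 : (k : ℝ) + (t + 2) ≠ 0 := by
        have : (0 : ℝ) ≤ k := Nat.cast_nonneg k
        linarith
      rw [momentRatio, div_eq_iff h2]
      field_simp
      linarith
    rw [e]
    have h2 : Tendsto (fun k : ℕ => (k : ℝ) + (t + 2)) atTop atTop :=
      tendsto_atTop_add_const_right _ _ tendsto_natCast_atTop_atTop
    simpa using (h2.const_div_atTop (t + 1)).const_sub 1
  induction n with
  | zero =>
    refine tendsto_const_nhds.congr fun k => ?_
    exact (div_self (bergmanMoment_pos ht k).ne').symm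
  | succ n ih =>
    have h2 := (h1.comp (tendsto_add_atTop_nat n)).mul ih
    rw [one_mul] at h2
    refine h2.congr fun k => ?_
    have := (bergmanMoment_pos ht (k + n)).ne'
    simp only [Function.comp_apply, momentRatio]
    rw [div_mul_div_cancel₀ this, add_assoc]

theorem inner_symbolMul_conj_pow (ht : -1 < t) (n m k : ℕ) :
    (inner ℂ (symbolMul t (fun z => (starRingEnd ℂ) (z ^ n)) (monomialBasis ht k))
      (symbolMul t (fun z => (starRingEnd ℂ) (z ^ m)) (monomialBasis ht k)) : ℂ)
      = if n = m then (momentRatio t n k : ℂ) else 0 := by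
  rw [inner_symbolMul (memLp_conj_pow ht n) (memLp_conj_pow ht m) (coeFn_monomialBasis ht k)
    (coeFn_monomialBasis ht k)]
  have hp := bergmanMoment_pos ht k
  have e : ∀ z : ℂ, (starRingEnd ℂ) ((starRingEnd ℂ) (z ^ n) * unitMonomial t k z) *
      ((starRingEnd ℂ) (z ^ m) * unitMonomial t k z)
      = ((bergmanMoment t k)⁻¹ : ℝ) * ((starRingEnd ℂ) (z ^ (m + k)) * z ^ (n + k)) := by
    intro z
    rw [← Real.mul_self_sqrt hp.le, mul_inv]
    simp only [unitMonomial, map_mul, Complex.conj_conj, Complex.conj_ofReal, pow_add,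
      Complex.ofReal_mul]
    ring
  simp_rw [e]
  rw [integral_const_mul, integral_conj_pow_mul_pow ht]
  by_cases h : n = m
  · subst h
    simp only [if_true, momentRatio]
    rw [← Complex.ofReal_mul, inv_mul_eq_div, add_comm n k]
  · rw [if_neg (by omega), if_neg h, mul_zero]

theorem inner_monomialBasis_symbolMul_conj_pow (ht : -1 < t) (n k j : ℕ) :
    (inner ℂ (monomialBasis ht j) ((bergmanSpace t).orthogonalProjectionOnto
      (symbolMul t (fun z => (starRingEnd ℂ) (z ^ n)) (monomialBasis ht k))) : ℂ)
      = if j + n = k then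
          (((Real.sqrt (bergmanMoment t j))⁻¹ * Real.sqrt (bergmanMoment t k) : ℝ) : ℂ)
        else 0 := by
  rw [Submodule.inner_orthogonalProjectionOnto_eq_of_mem_left,
    inner_eq_integral (coeFn_monomialBasis ht j)
      (coeFn_symbolMul (memLp_conj_pow ht n) _ (coeFn_monomialBasis ht k))]
  have hp := bergmanMoment_pos ht k
  have e : ∀ z : ℂ, (starRingEnd ℂ) (unitMonomial t j z) *
      ((starRingEnd ℂ) (z ^ n) * unitMonomial t k z)
      = ((Real.sqrt (bergmanMoment t j))⁻¹ * (Real.sqrt (bergmanMoment t k))⁻¹ : ℝ) *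
        ((starRingEnd ℂ) (z ^ (j + n)) * z ^ k) := by
    intro z
    simp only [unitMonomial, map_mul, Complex.conj_ofReal, pow_add, Complex.ofReal_mul]
    ring
  simp_rw [e]
  rw [integral_const_mul, integral_conj_pow_mul_pow ht]
  split_ifs with h
  · rw [h, ← Complex.ofReal_mul, mul_assoc]
    congr 2
    have := (Real.sqrt_pos.mpr hp).ne'
    rw [inv_mul_eq_div, div_eq_iff this, Real.mul_self_sqrt hp.le]
  · rw [mul_zero]

theorem inner_projection_conj_pow (ht : -1 < t) (n m k : ℕ) :
    (inner ℂ ((bergmanSpace t).orthogonalProjectionOnto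
        (symbolMul t (fun z => (starRingEnd ℂ) (z ^ n)) (monomialBasis ht k)))
      ((bergmanSpace t).orthogonalProjectionOnto
        (symbolMul t (fun z => (starRingEnd ℂ) (z ^ m)) (monomialBasis ht k))) : ℂ)
      = if n = m ∧ n ≤ k then (momentRatio t n (k - n) : ℂ) else 0 := by
  have h := (monomialBasis ht).hasSum_inner_mul_inner
    ((bergmanSpace t).orthogonalProjectionOnto
        (symbolMul t (fun z => (starRingEnd ℂ) (z ^ n)) (monomialBasis ht k)))
    ((bergmanSpace t).orthogonalProjectionOnto
        (symbolMul t (fun z => (starRingEnd ℂ) (z ^ m)) (monomialBasis ht k)))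
  refine h.unique ?_
  have e : ∀ j : ℕ, (inner ℂ ((bergmanSpace t).orthogonalProjectionOnto
        (symbolMul t (fun z => (starRingEnd ℂ) (z ^ n)) (monomialBasis ht k)))
        (monomialBasis ht j) : ℂ) *
      inner ℂ (monomialBasis ht j) ((bergmanSpace t).orthogonalProjectionOnto
        (symbolMul t (fun z => (starRingEnd ℂ) (z ^ m)) (monomialBasis ht k)))
      = if n = m ∧ j + n = k then (momentRatio t n j : ℂ) else 0 := by
    intro j
    rw [← inner_conj_symm (𝕜 := ℂ) _ (monomialBasis ht j),
      inner_monomialBasis_symbolMul_conj_pow, inner_monomialBasis_symbolMul_conj_pow]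
    by_cases h1 : j + n = k
    · by_cases h2 : n = m
      · subst h2
        rw [if_pos h1, if_pos ⟨rfl, h1⟩, Complex.conj_ofReal, ← Complex.ofReal_mul, momentRatio, h1,
          mul_mul_mul_comm, ← mul_inv, Real.mul_self_sqrt (bergmanMoment_pos ht _).le,
          Real.mul_self_sqrt (bergmanMoment_pos ht _).le, inv_mul_eq_div]
      · rw [if_neg (by omega : ¬ j + m = k), mul_zero, if_neg (by tauto)]
    · rw [if_neg h1, map_zero, zero_mul, if_neg (by tauto)]
  simp_rw [e]
  by_cases hnm : n = m
  · by_cases hk : n ≤ k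
    · rw [if_pos ⟨hnm, hk⟩]
      have := hasSum_ite_eq (k - n) (momentRatio t n (k - n) : ℂ)
      refine this.congr_fun fun j => ?_
      by_cases hj : j = k - n
      · rw [if_pos ⟨hnm, by omega⟩, if_pos hj, hj]
      · rw [if_neg hj, if_neg (by omega)]
    · rw [if_neg (by tauto)]
      refine hasSum_zero.congr_fun fun j => ?_
      rw [if_neg (by omega)]
  · rw [if_neg (by tauto)]
    refine hasSum_zero.congr_fun fun j => ?_
    rw [if_neg (by tauto)]

theorem inner_hankel_conj_pow (ht : -1 < t) (n m k : ℕ) :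
    (inner ℂ (hankel t (fun z => (starRingEnd ℂ) (z ^ n)) (monomialBasis ht k))
      (hankel t (fun z => (starRingEnd ℂ) (z ^ m)) (monomialBasis ht k)) : ℂ)
      = if n = m then ((momentRatio t n k - if n ≤ k then momentRatio t n (k - n) else 0 : ℝ) : ℂ)
        else 0 := by
  rw [inner_hankel_hankel, inner_symbolMul_conj_pow, inner_projection_conj_pow]
  by_cases h : n = m
  · by_cases hk : n ≤ k <;> simp [h, h ▸ hk]
  · simp [h]

theorem sum_range_momentRatio_sub (n N : ℕ) :
    ∑ k ∈ Finset.range (N + n),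
      (momentRatio t n k - if n ≤ k then momentRatio t n (k - n) else 0)
      = ∑ i ∈ Finset.range n, momentRatio t n (N + i) := by
  induction N with
  | zero =>
    rw [zero_add]
    refine Finset.sum_congr rfl fun i hi => ?_
    rw [if_neg (by have := Finset.mem_range.mp hi; omega), sub_zero, zero_add]
  | succ N ih =>
    rw [show N + 1 + n = N + n + 1 by ring, Finset.sum_range_succ, ih, if_pos (by omega),
      show N + n - n = N by omega]
    have h1 := Finset.sum_range_succ (fun i => momentRatio t n (N + i)) n
    have h2 := Finset.sum_range_succ' (fun i => momentRatio t n (N + i)) n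
    have h3 : ∑ i ∈ Finset.range n, momentRatio t n (N + 1 + i)
        = ∑ i ∈ Finset.range n, momentRatio t n (N + (i + 1)) :=
      Finset.sum_congr rfl fun i _ => by rw [add_assoc, add_comm 1 i]
    rw [h3]
    rw [add_zero] at h2
    linarith

/-- The squared Hilbert–Schmidt norm of the Hankel operator with symbol `z̄ⁿ` is `n`: the sum over
the monomial basis telescopes, and the quotients of moments tend to one. -/
theorem hasSum_norm_sq_hankel_conj_pow (ht : -1 < t) (n : ℕ) :
    HasSum (fun k => ‖hankel t (fun z => (starRingEnd ℂ) (z ^ n)) (monomialBasis ht k)‖ ^ 2)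
      (n : ℝ) := by
  have e : ∀ k, ‖hankel t (fun z => (starRingEnd ℂ) (z ^ n)) (monomialBasis ht k)‖ ^ 2
      = momentRatio t n k - if n ≤ k then momentRatio t n (k - n) else 0 := by
    intro k
    have h1 := inner_hankel_conj_pow ht n n k
    rw [if_pos rfl, inner_self_eq_norm_sq_to_K] at h1
    rw [← Complex.ofReal_inj, ← h1]
    norm_cast
  rw [hasSum_iff_tendsto_nat_of_nonneg fun k => by positivity, ← tendsto_add_atTop_iff_nat n]
  simp_rw [e, sum_range_momentRatio_sub]
  have h := tendsto_finsetSum (Finset.range n) fun i _ =>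
    (tendsto_momentRatio ht n).comp (tendsto_add_atTop_nat i)
  simpa using h

/-- Hankel operators with different symbols `z̄ⁿ` are orthogonal in the Hilbert–Schmidt norm. -/
theorem tsum_inner_hankel_conj_pow (ht : -1 < t) (n m : ℕ) :
    ∑' k, (inner ℂ (hankel t (fun z => (starRingEnd ℂ) (z ^ n)) (monomialBasis ht k))
      (hankel t (fun z => (starRingEnd ℂ) (z ^ m)) (monomialBasis ht k)) : ℂ)
      = if n = m then (n : ℂ) else 0 := by
  split_ifs with h
  · subst h
    have h1 := Complex.hasSum_ofReal.mpr (hasSum_norm_sq_hankel_conj_pow ht n)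
    rw [Complex.ofReal_natCast] at h1
    rw [← h1.tsum_eq]
    refine tsum_congr fun k => ?_
    rw [inner_self_eq_norm_sq_to_K]
    norm_cast
  · simp_rw [inner_hankel_conj_pow, if_neg h]
    exact tsum_zero

/-- The Hilbert–Schmidt norm of a Hankel operator is at most the Lipschitz constant of its
symbol. -/
theorem hsSum_hankel_le (ht : -1 < t) {g : ℂ → ℂ} {L : ℝ}
    (hg : ∀ z ∈ Metric.ball (0 : ℂ) 1, ∀ w ∈ Metric.ball (0 : ℂ) 1, ‖g z - g w‖ ≤ L * ‖z - w‖) :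
    hsSum (monomialBasis ht) (hankel t g) ≤ ENNReal.ofReal (L ^ 2) := by
  refine (hsSum_hankel_le_mul ht hg).trans (le_of_eq ?_)
  have h := hasSum_norm_sq_hankel_conj_pow ht 1
  simp only [pow_one, Nat.cast_one] at h
  rw [hsSum_eq_ofReal_tsum (hsSum_ne_top_of_summable h.summable), h.tsum_eq, ENNReal.ofReal_one,
    mul_one]

theorem hsSum_hankel_ne_top (ht : -1 < t) {g : ℂ → ℂ} {L : ℝ}
    (hg : ∀ z ∈ Metric.ball (0 : ℂ) 1, ∀ w ∈ Metric.ball (0 : ℂ) 1, ‖g z - g w‖ ≤ L * ‖z - w‖) :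
    hsSum (monomialBasis ht) (hankel t g) ≠ ⊤ :=
  ne_top_of_le_ne_top ENNReal.ofReal_ne_top (hsSum_hankel_le ht hg)

theorem tsum_norm_sq_hankel_le (ht : -1 < t) {g : ℂ → ℂ} {L : ℝ}
    (hg : ∀ z ∈ Metric.ball (0 : ℂ) 1, ∀ w ∈ Metric.ball (0 : ℂ) 1, ‖g z - g w‖ ≤ L * ‖z - w‖) :
    ∑' k, ‖hankel t g (monomialBasis ht k)‖ ^ 2 ≤ L ^ 2 := by
  have h := hsSum_hankel_le ht hg
  rw [hsSum_eq_ofReal_tsum (hsSum_hankel_ne_top ht hg)] at h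
  exact (ENNReal.ofReal_le_ofReal_iff (sq_nonneg L)).mp h

end ConjPow

/-! ### Green's formula in hyperbolic coordinates -/

section GreenMobius

variable {t : ℝ}

theorem mobiusJac_le {z u : ℂ} (hz : ‖z‖ < 1) (hu : ‖u‖ < 1) :
    mobiusJac z u ≤ (1 - ‖z‖ ^ 2) ^ 2 / (1 - ‖z‖) ^ 4 := by
  have h1 := norm_sub_norm_le 1 ((starRingEnd ℂ) z * u)
  rw [norm_one, norm_mul, RCLike.norm_conj] at h1
  have h2 : 1 - ‖z‖ ≤ ‖1 - (starRingEnd ℂ) z * u‖ := by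
    nlinarith [norm_nonneg z, norm_nonneg u]
  have h3 : 0 < 1 - ‖z‖ := by linarith
  unfold mobiusJac
  gcongr

theorem continuousOn_mobiusJac {z : ℂ} (hz : ‖z‖ < 1) :
    ContinuousOn (mobiusJac z) (Metric.ball 0 1) := by
  unfold mobiusJac
  refine ContinuousOn.div (by fun_prop) (by fun_prop) fun u hu => ?_
  have := norm_pos_iff.mpr (one_sub_conj_mul_ne_zero hz (mem_ball_zero_iff.mp hu).le)
  positivity

/-- Green's formula for radial kernels, transported by the automorphism `φ_z`. -/
theorem setIntegral_ball_radial_mul_comp_mobius {κ : ℝ → ℝ} (hκ : IntegrableOn κ (Ioo 0 1))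
    {G : ℂ → ℂ} (hG : ContDiffOn ℝ 2 G (Metric.ball 0 1))
    {C : ℝ} (hC : ∀ z ∈ Metric.ball (0 : ℂ) 1, ‖G z‖ ≤ C)
    {M : ℝ} (hM : ∀ z ∈ Metric.ball (0 : ℂ) 1, ‖Laplacian.laplacian G z‖ ≤ M)
    {z : ℂ} (hz : ‖z‖ < 1) :
    ∫ u in Metric.ball (0 : ℂ) 1, (κ (‖u‖ ^ 2) : ℂ) * G (mobius z u)
      = (Real.pi * ∫ x in Ioo 0 1, κ x : ℝ) * G z +
        ∫ w in Metric.ball (0 : ℂ) 1,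
          (radialPotential κ (‖mobius z w‖ ^ 2) : ℂ) * Laplacian.laplacian G w := by
  have hz' : z ∈ Metric.ball (0 : ℂ) 1 := mem_ball_zero_iff.mpr hz
  have h := setIntegral_ball_radial_mul_eq hκ (contDiffOn_comp_mobius hG hz)
    (C := C) (fun u hu => hC _ (mobius_mem_ball hz' hu))
    (M := (1 - ‖z‖ ^ 2) ^ 2 / (1 - ‖z‖) ^ 4 * M) fun u hu => by
      rw [laplacian_comp_mobius hG hz hu, norm_mul, Complex.norm_real,
        Real.norm_of_nonneg (mobiusJac_nonneg _ _)]
      have := hM _ (mobius_mem_ball hz' hu)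
      gcongr
      exact mobiusJac_le hz (mem_ball_zero_iff.mp hu)
  simp only [Function.comp_apply, mobius_zero_right] at h
  rw [h, ← integral_ball_mobius hz (fun w => (radialPotential κ (‖mobius z w‖ ^ 2) : ℂ) *
    Laplacian.laplacian G w)]
  congr 1
  refine setIntegral_congr_fun Metric.isOpen_ball.measurableSet fun u hu => ?_
  rw [laplacian_comp_mobius hG hz hu, mobius_mobius hz (mem_ball_zero_iff.mp hu).le,
    Complex.real_smul]
  ring

theorem integrableOn_radialPotential_mobius {κ : ℝ → ℝ} (hκ : IntegrableOn κ (Ioo 0 1))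
    {z : ℂ} (hz : ‖z‖ < 1) :
    IntegrableOn (fun w => radialPotential κ (‖mobius z w‖ ^ 2)) (Metric.ball 0 1) := by
  rw [← integrableOn_ball_mobius_iff hz]
  have h := (integrableOn_comp_norm_sq (integrableOn_radialPotential hκ)).bdd_mul
    ((continuousOn_mobiusJac hz).aestronglyMeasurable Metric.isOpen_ball.measurableSet)
    (c := (1 - ‖z‖ ^ 2) ^ 2 / (1 - ‖z‖) ^ 4) (by
      filter_upwards [ae_restrict_mem Metric.isOpen_ball.measurableSet] with u hu
      rw [Real.norm_of_nonneg (mobiusJac_nonneg _ _)]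
      exact mobiusJac_le hz (mem_ball_zero_iff.mp hu))
  refine IntegrableOn.congr_fun h (fun u hu => ?_) Metric.isOpen_ball.measurableSet
  rw [mobius_mobius hz (mem_ball_zero_iff.mp hu).le, smul_eq_mul]

theorem hasFDerivAt_conj (z : ℂ) :
    HasFDerivAt (fun w : ℂ => (starRingEnd ℂ) w) (Complex.conjCLE : ℂ →L[ℝ] ℂ) z :=
  (Complex.conjCLE : ℂ →L[ℝ] ℂ).hasFDerivAt

theorem contDiff_norm_sq_complex : ContDiff ℝ 2 fun w : ℂ => ((‖w‖ ^ 2 : ℝ) : ℂ) :=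
  Complex.ofRealCLM.contDiff.comp (contDiff_norm_sq ℝ)

theorem laplacian_norm_sq (z : ℂ) :
    Laplacian.laplacian (fun w : ℂ => ((‖w‖ ^ 2 : ℝ) : ℂ)) z = 4 := by
  have e : (fun w : ℂ => ((‖w‖ ^ 2 : ℝ) : ℂ)) = fun w => w * (starRingEnd ℂ) w := by
    ext w
    rw [Complex.mul_conj']
    push_cast
    rfl
  have hd : ∀ w v : ℂ, fderiv ℝ (fun w : ℂ => ((‖w‖ ^ 2 : ℝ) : ℂ)) w v
      = w * (starRingEnd ℂ) v + (starRingEnd ℂ) w * v := by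
    intro w v
    have h : HasFDerivAt (fun w : ℂ => w * (starRingEnd ℂ) w) _ w :=
      (hasFDerivAt_id w).mul (hasFDerivAt_conj w)
    rw [e, h.fderiv]
    simp
  have hd2 : ∀ u v : ℂ, fderiv ℝ (fun w : ℂ => w * (starRingEnd ℂ) v + (starRingEnd ℂ) w * v) z u
      = u * (starRingEnd ℂ) v + (starRingEnd ℂ) u * v := by
    intro u v
    have h : HasFDerivAt (fun w : ℂ => w * (starRingEnd ℂ) v + (starRingEnd ℂ) w * v) _ z :=
      ((hasFDerivAt_id z).mul_const ((starRingEnd ℂ) v)).add ((hasFDerivAt_conj z).mul_const v)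
    rw [h.fderiv]
    simp [mul_comm]
  rw [laplacian_eq_fderiv_fderiv, fderiv_fderiv_apply contDiff_norm_sq_complex.contDiffAt,
    fderiv_fderiv_apply contDiff_norm_sq_complex.contDiffAt]
  simp only [hd, hd2]
  simp
  norm_num

theorem norm_mobius_sq_mem_Ioo {z w : ℂ} (hz : ‖z‖ < 1) (hw : ‖w‖ < 1) (h : w ≠ z) :
    ‖mobius z w‖ ^ 2 ∈ Ioo (0 : ℝ) 1 := by
  have h1 : mobius z w ≠ 0 :=
    div_ne_zero (sub_ne_zero.mpr h.symm) (one_sub_conj_mul_ne_zero hz hw.le)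
  have h2 := norm_mobius_lt_one hz hw
  have h3 := norm_pos_iff.mpr h1
  exact ⟨by positivity, by nlinarith⟩

theorem ae_norm_mobius_sq_mem_Ioo {z : ℂ} (hz : ‖z‖ < 1) :
    ∀ᵐ w ∂volume.restrict (Metric.ball (0 : ℂ) 1), ‖mobius z w‖ ^ 2 ∈ Ioo (0 : ℝ) 1 := by
  have h1 : ∀ᵐ w ∂volume.restrict (Metric.ball (0 : ℂ) 1), w ≠ z :=
    ae_restrict_of_ae (compl_mem_ae_iff.mpr (measure_singleton z))
  filter_upwards [h1, ae_restrict_mem Metric.isOpen_ball.measurableSet] with w h2 h3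
  exact norm_mobius_sq_mem_Ioo hz (mem_ball_zero_iff.mp h3) h2

theorem radialPotential_mobius_ae_eq (ht : -1 < t) {z : ℂ} (hz : ‖z‖ < 1) :
    (fun w => radialPotential (invariantDensity t) (‖mobius z w‖ ^ 2))
      =ᵐ[volume.restrict (Metric.ball (0 : ℂ) 1)] fun w => rhoKernel t (‖mobius z w‖ ^ 2) := by
  filter_upwards [ae_norm_mobius_sq_mem_Ioo hz] with w hw
  exact radialPotential_invariantDensity ht hw

theorem integrableOn_rhoKernel_mobius (ht : -1 < t) {z : ℂ} (hz : ‖z‖ < 1) :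
    IntegrableOn (fun w => rhoKernel t (‖mobius z w‖ ^ 2)) (Metric.ball 0 1) :=
  (integrable_congr (radialPotential_mobius_ae_eq ht hz)).mp
    (integrableOn_radialPotential_mobius (integrableOn_invariantDensity ht) hz)

theorem integrableOn_invariantDensity_norm_sq_mul (ht : -1 < t) {G : ℂ → ℝ}
    (hG : ContinuousOn G (Metric.ball 0 1)) {C : ℝ} (hC : ∀ z ∈ Metric.ball (0 : ℂ) 1, |G z| ≤ C) :
    IntegrableOn (fun u => invariantDensity t (‖u‖ ^ 2) * G u) (Metric.ball (0 : ℂ) 1) := by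
  refine (integrableOn_comp_norm_sq (integrableOn_invariantDensity ht)).mul_bdd (c := C)
    (hG.aestronglyMeasurable Metric.isOpen_ball.measurableSet) ?_
  filter_upwards [ae_restrict_mem Metric.isOpen_ball.measurableSet] with u hu using hC u hu

/-- Green's formula for the function `|w|²`, whose Laplacian is the constant `4`, computes the
integral of `ρ_t(|φ_z w|²)` over `w`. -/
theorem four_mul_setIntegral_rhoKernel_mobius (ht : -1 < t) {z : ℂ} (hz : ‖z‖ < 1) :
    4 * ∫ w in Metric.ball (0 : ℂ) 1, rhoKernel t (‖mobius z w‖ ^ 2)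
      = ∫ u in Metric.ball (0 : ℂ) 1,
        invariantDensity t (‖u‖ ^ 2) * (‖mobius z u‖ ^ 2 - ‖z‖ ^ 2) := by
  have hz' : z ∈ Metric.ball (0 : ℂ) 1 := mem_ball_zero_iff.mpr hz
  have hk := integrableOn_invariantDensity ht
  have h := setIntegral_ball_radial_mul_comp_mobius hk
    contDiff_norm_sq_complex.contDiffOn (C := 1) (fun w hw => by
      rw [Complex.norm_real, Real.norm_of_nonneg (by positivity)]
      rw [mem_ball_zero_iff] at hw
      nlinarith [norm_nonneg w]) (M := 4) (fun w _ => by rw [laplacian_norm_sq]; simp) hz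
  simp only [laplacian_norm_sq] at h
  have e1 : ∫ u in Metric.ball (0 : ℂ) 1, invariantDensity t (‖u‖ ^ 2) * ‖mobius z u‖ ^ 2
      = (Real.pi * ∫ x in Ioo 0 1, invariantDensity t x) * ‖z‖ ^ 2 +
        4 * ∫ w in Metric.ball (0 : ℂ) 1, radialPotential (invariantDensity t) (‖mobius z w‖ ^ 2) := by
    rw [integral_mul_const, mul_comm _ (4 : ℂ)] at h
    simp only [← Complex.ofReal_mul] at h
    rw [integral_complex_ofReal, integral_complex_ofReal] at h
    exact_mod_cast h
  rw [integral_congr_ae (radialPotential_mobius_ae_eq ht hz)] at e1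
  have hc1 : ContinuousOn (fun u => ‖mobius z u‖ ^ 2) (Metric.ball 0 1) :=
    (differentiableOn_mobius hz).continuousOn.norm.pow 2
  have hi1 := integrableOn_invariantDensity_norm_sq_mul ht hc1 (C := 1) fun u hu => by
    rw [abs_of_nonneg (by positivity)]
    have := norm_mobius_lt_one hz (mem_ball_zero_iff.mp hu)
    nlinarith [norm_nonneg (mobius z u)]
  have hi2 := integrableOn_invariantDensity_norm_sq_mul ht
    (continuousOn_const (c := ‖z‖ ^ 2)) (C := ‖z‖ ^ 2) fun u hu => by
      rw [abs_of_nonneg (by positivity)]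
  simp_rw [mul_sub]
  rw [integral_sub hi1 hi2, e1, integral_mul_const, setIntegral_comp_norm_sq hk.1]
  ring

theorem setIntegral_rhoKernel_mobius_le (ht : -1 < t) {z : ℂ} (hz : ‖z‖ < 1) :
    ∫ w in Metric.ball (0 : ℂ) 1, rhoKernel t (‖mobius z w‖ ^ 2)
      ≤ 1 / (8 * Real.pi * Real.sqrt (t + 2)) := by
  have hpi := Real.pi_pos
  have ht2 : 0 < t + 2 := by linarith
  set d := Real.sqrt (t + 2) with hd
  have hd0 : 0 < d := Real.sqrt_pos.mpr ht2
  have hdd : d ^ 2 = t + 2 := Real.sq_sqrt ht2.le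
  have hk := integrableOn_invariantDensity ht
  have h4 := four_mul_setIntegral_rhoKernel_mobius ht hz
  have hc1 : ContinuousOn (fun u => ‖mobius z u‖ ^ 2 - ‖z‖ ^ 2) (Metric.ball 0 1) :=
    ((differentiableOn_mobius hz).continuousOn.norm.pow 2).sub continuousOn_const
  have hi1 := integrableOn_invariantDensity_norm_sq_mul ht hc1 (C := 1) fun u hu => by
    have h1 := norm_mobius_lt_one hz (mem_ball_zero_iff.mp hu)
    rw [abs_le]
    constructor <;> nlinarith [norm_nonneg (mobius z u), norm_nonneg z]
  have hi2 := (integrableOn_comp_norm_sq hk).const_mul (1 / d)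
  have hi3 := (integrableOn_invariantDensity_norm_sq_mul ht
    (G := fun u => ‖u‖ ^ 2) (by fun_prop) (C := 1) fun u hu => by
      rw [abs_of_nonneg (by positivity)]
      rw [mem_ball_zero_iff] at hu
      nlinarith [norm_nonneg u]).const_mul d
  -- `2|u| ≤ 1/d + d|u|²`, with the optimal choice of `d`
  have hle : ∫ u in Metric.ball (0 : ℂ) 1,
        invariantDensity t (‖u‖ ^ 2) * (‖mobius z u‖ ^ 2 - ‖z‖ ^ 2)
      ≤ ∫ u in Metric.ball (0 : ℂ) 1, (1 / d * invariantDensity t (‖u‖ ^ 2)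
        + d * (invariantDensity t (‖u‖ ^ 2) * ‖u‖ ^ 2)) := by
    refine integral_mono_ae hi1 (hi2.add hi3) ?_
    have h0 : ∀ᵐ u ∂volume.restrict (Metric.ball (0 : ℂ) 1), ‖mobius 0 u‖ ^ 2 ∈ Ioo (0 : ℝ) 1 :=
      ae_norm_mobius_sq_mem_Ioo (by simp)
    filter_upwards [h0, ae_restrict_mem Metric.isOpen_ball.measurableSet] with u hu hub
    have hu' : ‖u‖ ^ 2 ∈ Ioo (0 : ℝ) 1 := by simpa [mobius] using hu
    have h1 := invariantDensity_nonneg ht hu'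
    have h2 := norm_mobius_sq_sub_le hz (mem_ball_zero_iff.mp hub)
    have h3 : 2 * ‖u‖ ≤ 1 / d + d * ‖u‖ ^ 2 := by
      rw [div_add' _ _ _ hd0.ne', le_div_iff₀ hd0]
      nlinarith [sq_nonneg (d * ‖u‖ - 1)]
    nlinarith [mul_le_mul_of_nonneg_left (h2.trans h3) h1]
  rw [integral_add hi2 hi3, integral_const_mul, integral_const_mul,
    setIntegral_comp_norm_sq hk.1] at hle
  have e : ∫ u in Metric.ball (0 : ℂ) 1, invariantDensity t (‖u‖ ^ 2) * ‖u‖ ^ 2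
      = Real.pi * ∫ x in Ioo 0 1, x * invariantDensity t x := by
    rw [← setIntegral_comp_norm_sq (κ := fun x => x * invariantDensity t x)
      (hk.bdd_mul (c := 1) (by fun_prop) (by
        filter_upwards [ae_restrict_mem measurableSet_Ioo] with x hx
        rw [Real.norm_of_nonneg hx.1.le]
        exact hx.2.le)).1]
    simp_rw [mul_comm]
  rw [e, pi_mul_setIntegral_invariantDensity ht, ← h4] at hle
  have h5 := pi_mul_setIntegral_mul_invariantDensity_le ht
  have h6 := mul_le_mul_of_nonneg_left h5 hd0.le
  have h7 : d * (1 / (4 * Real.pi * (t + 2))) = 1 / d * (1 / (4 * Real.pi)) := by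
    rw [← hdd]
    field_simp
  have h8 : 1 / (8 * Real.pi * d) = 1 / d * (1 / (4 * Real.pi)) / 2 := by
    field_simp
    norm_num
  rw [h8]
  linarith

theorem measurable_intervalIntegral_left {F : ℝ → ℝ → ℝ} (hF : Measurable (Function.uncurry F)) :
    Measurable fun s => ∫ x in s..1, F s x := by
  have h : ∀ S : Set (ℝ × ℝ), MeasurableSet S →
      Measurable fun s : ℝ => ∫ x in {x | (s, x) ∈ S}, F s x := by
    intro S hS
    have h1 : StronglyMeasurable (S.indicator (Function.uncurry F)) :=
      hF.stronglyMeasurable.indicator hS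
    have h2 := (StronglyMeasurable.integral_prod_right (ν := volume)
      (f := fun s x => S.indicator (Function.uncurry F) (s, x)) h1).measurable
    have e : (fun s : ℝ => ∫ x in {x | (s, x) ∈ S}, F s x)
        = fun s => ∫ x, S.indicator (Function.uncurry F) (s, x) := by
      ext s
      exact (integral_indicator (measurable_prodMk_left hS)).symm
    rw [e]
    exact h2
  have h1 := h {p | p.1 < p.2 ∧ p.2 ≤ 1}
    ((measurableSet_lt measurable_fst measurable_snd).inter
      (measurableSet_le measurable_snd measurable_const))
  have h2 := h {p | 1 < p.2 ∧ p.2 ≤ p.1}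
    ((measurableSet_lt measurable_const measurable_snd).inter
      (measurableSet_le measurable_snd measurable_fst))
  exact h1.sub h2

theorem measurable_berezinKernel : Measurable (berezinKernel t) := by
  refine (measurable_intervalIntegral_left (F := fun _ y => (1 - y) ^ (t + 1) * y⁻¹) ?_).const_mul _
  unfold Function.uncurry
  fun_prop

theorem measurable_rhoKernel : Measurable (rhoKernel t) := by
  refine (measurable_intervalIntegral_left
    (F := fun s x => (1 - x) ^ t * x⁻¹ * kernelF s x) ?_).const_mul _
  unfold Function.uncurry kernelF
  fun_prop

theorem measurable_norm_mobius_sq : Measurable fun p : ℂ × ℂ => ‖mobius p.1 p.2‖ ^ 2 := by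
  unfold mobius
  have h1 : Measurable fun p : ℂ × ℂ => p.1 - p.2 := by fun_prop
  have h2 : Measurable fun p : ℂ × ℂ => 1 - (starRingEnd ℂ) p.1 * p.2 := by fun_prop
  exact (h1.div h2).norm.pow_const 2

theorem rhoKernel_mobius_nonneg_ae (ht : -1 < t) {z : ℂ} (hz : ‖z‖ < 1) :
    ∀ᵐ w ∂volume.restrict (Metric.ball (0 : ℂ) 1), 0 ≤ rhoKernel t (‖mobius z w‖ ^ 2) := by
  filter_upwards [ae_norm_mobius_sq_mem_Ioo hz] with w hw using (rhoKernel_pos ht hw).le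

theorem isFiniteMeasure_restrict_ball :
    IsFiniteMeasure (volume.restrict (Metric.ball (0 : ℂ) 1)) :=
  ⟨by rw [Measure.restrict_apply_univ]; exact measure_ball_lt_top⟩

theorem setIntegral_norm_rhoKernel_mobius_le (ht : -1 < t) {z : ℂ} (hz : ‖z‖ < 1) :
    ∫ w in Metric.ball (0 : ℂ) 1, ‖rhoKernel t (‖mobius z w‖ ^ 2)‖
      ≤ 1 / (8 * Real.pi * Real.sqrt (t + 2)) := by
  refine le_of_eq_of_le (integral_congr_ae ?_) (setIntegral_rhoKernel_mobius_le ht hz)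
  filter_upwards [rhoKernel_mobius_nonneg_ae ht hz] with w hw using Real.norm_of_nonneg hw

theorem integrable_rhoKernel_mobius_prod (ht : -1 < t) :
    Integrable (fun p : ℂ × ℂ => rhoKernel t (‖mobius p.1 p.2‖ ^ 2))
      ((volume.restrict (Metric.ball (0 : ℂ) 1)).prod
        (volume.restrict (Metric.ball (0 : ℂ) 1))) := by
  have := isFiniteMeasure_restrict_ball
  have hm : AEStronglyMeasurable (fun p : ℂ × ℂ => rhoKernel t (‖mobius p.1 p.2‖ ^ 2))
      ((volume.restrict (Metric.ball (0 : ℂ) 1)).prod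
        (volume.restrict (Metric.ball (0 : ℂ) 1))) :=
    (measurable_rhoKernel.comp measurable_norm_mobius_sq).aestronglyMeasurable
  rw [integrable_prod_iff hm]
  refine ⟨?_, ?_⟩
  · filter_upwards [ae_restrict_mem Metric.isOpen_ball.measurableSet] with z hz
    exact integrableOn_rhoKernel_mobius ht (mem_ball_zero_iff.mp hz)
  · refine Integrable.of_bound hm.norm.integral_prod_right'
      (1 / (8 * Real.pi * Real.sqrt (t + 2))) ?_
    filter_upwards [ae_restrict_mem Metric.isOpen_ball.measurableSet] with z hz
    rw [Real.norm_of_nonneg (integral_nonneg fun _ => norm_nonneg _)]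
    exact setIntegral_norm_rhoKernel_mobius_le ht (mem_ball_zero_iff.mp hz)

theorem integral_norm_rhoKernel_mobius_prod_le (ht : -1 < t) :
    ∫ p, ‖rhoKernel t (‖mobius p.1 p.2‖ ^ 2)‖
      ∂((volume.restrict (Metric.ball (0 : ℂ) 1)).prod
        (volume.restrict (Metric.ball (0 : ℂ) 1))) ≤ 1 / (8 * Real.sqrt (t + 2)) := by
  have := isFiniteMeasure_restrict_ball
  have hi := (integrable_rhoKernel_mobius_prod ht).norm
  rw [integral_prod _ hi]
  have h1 : ∫ z in Metric.ball (0 : ℂ) 1, ∫ w in Metric.ball (0 : ℂ) 1,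
        ‖rhoKernel t (‖mobius z w‖ ^ 2)‖
      ≤ ∫ z in Metric.ball (0 : ℂ) 1, 1 / (8 * Real.pi * Real.sqrt (t + 2)) := by
    refine setIntegral_mono_on hi.integral_prod_left (integrable_const _)
      Metric.isOpen_ball.measurableSet fun z hz => ?_
    exact setIntegral_norm_rhoKernel_mobius_le ht (mem_ball_zero_iff.mp hz)
  refine h1.trans (le_of_eq ?_)
  rw [setIntegral_const, Measure.real, Complex.volume_ball]
  have := Real.pi_pos
  have h2 : 0 < Real.sqrt (t + 2) := Real.sqrt_pos.mpr (by linarith)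
  simp
  field_simp

end GreenMobius

/-! ### The trace as an integral of Laplacians -/

/-- Functions of class `C²` on the open disk which are Lipschitz with constant `L` and whose
Laplacian is bounded by `M`. -/
structure DiskSmooth (f : ℂ → ℂ) (L M : ℝ) : Prop where
  contDiffOn : ContDiffOn ℝ 2 f (Metric.ball 0 1)
  norm_sub_le : ∀ z ∈ Metric.ball (0 : ℂ) 1, ∀ w ∈ Metric.ball (0 : ℂ) 1,
    ‖f z - f w‖ ≤ L * ‖z - w‖
  norm_laplacian_le : ∀ z ∈ Metric.ball (0 : ℂ) 1, ‖Laplacian.laplacian f z‖ ≤ M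

section TraceFormula

variable {t : ℝ}

/-- The sum `∑ ⟨H_{f̄} e_k, H_g e_k⟩` over the monomial basis; its negative is the trace of the
semi-commutator. -/
noncomputable def hankelPairing (ht : -1 < t) (f g : ℂ → ℂ) : ℂ :=
  ∑' k, inner ℂ (hankel t (fun z => (starRingEnd ℂ) (f z)) (monomialBasis ht k))
    (hankel t g (monomialBasis ht k))

theorem norm_conj_sub_conj_le {f : ℂ → ℂ} {L : ℝ}
    (hf : ∀ z ∈ Metric.ball (0 : ℂ) 1, ∀ w ∈ Metric.ball (0 : ℂ) 1, ‖f z - f w‖ ≤ L * ‖z - w‖) :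
    ∀ z ∈ Metric.ball (0 : ℂ) 1, ∀ w ∈ Metric.ball (0 : ℂ) 1,
      ‖(starRingEnd ℂ) (f z) - (starRingEnd ℂ) (f w)‖ ≤ L * ‖z - w‖ := fun z hz w hw => by
  rw [← map_sub, RCLike.norm_conj]
  exact hf z hz w hw

theorem hasTrace_semiCommutator (ht : -1 < t) {f g : ℂ → ℂ} {L L' : ℝ}
    (hf : ∀ z ∈ Metric.ball (0 : ℂ) 1, ∀ w ∈ Metric.ball (0 : ℂ) 1, ‖f z - f w‖ ≤ L * ‖z - w‖)
    (hg : ∀ z ∈ Metric.ball (0 : ℂ) 1, ∀ w ∈ Metric.ball (0 : ℂ) 1, ‖g z - g w‖ ≤ L' * ‖z - w‖) :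
    HasTrace (semiCommutator t f g) (-hankelPairing ht f g) := by
  rw [semiCommutator_eq (memLp_of_norm_sub_le ht hf) (memLp_of_norm_sub_le ht hg)]
  exact hasTrace_neg_adjoint_comp (monomialBasis ht)
    (hsSum_hankel_ne_top ht (norm_conj_sub_conj_le hf)) (hsSum_hankel_ne_top ht hg)

theorem lintegral_boundary_decay_ne_top (ht : -1 < t) {f : ℂ → ℂ} {C : ℝ}
    (hC : ∀ z ∈ Metric.ball (0 : ℂ) 1, ‖f z‖ ≤ C * (1 - ‖z‖ ^ 2)) :
    ∫⁻ z, ‖f z‖ₑ ^ 2 * ∑' n, ‖unitMonomial t n z‖ₑ ^ 2 ∂bergmanMeasure t ≠ ⊤ := by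
  have hi : Integrable (fun z : ℂ => ((C ^ 2 * (1 - ‖z‖ ^ 2) ^ (-t) : ℝ) : ℂ))
      (bergmanMeasure t) := by
    rw [integrable_bergmanMeasure_iff ht]
    have := isFiniteMeasure_restrict_ball
    have hc : IntegrableOn (fun _ : ℂ => (((t + 1) / Real.pi * C ^ 2 : ℝ) : ℂ))
        (Metric.ball 0 1) := integrable_const _
    refine IntegrableOn.congr_fun hc (fun z hz => ?_) Metric.isOpen_ball.measurableSet
    have hA : 0 < 1 - ‖z‖ ^ 2 := by
      rw [mem_ball_zero_iff] at hz
      nlinarith [norm_nonneg z]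
    have h1 : (1 - ‖z‖ ^ 2) ^ t * (1 - ‖z‖ ^ 2) ^ (-t) = 1 := by
      rw [← Real.rpow_add hA, add_neg_cancel, Real.rpow_zero]
    rw [weightDensity, ← Complex.ofReal_mul]
    congr 1
    linear_combination -((t + 1) / Real.pi * C ^ 2) * h1
  refine ne_top_of_le_ne_top hi.2.ne (lintegral_mono_ae ?_)
  filter_upwards [ae_mem_ball_bergmanMeasure] with z hz
  have hz' := mem_ball_zero_iff.mp hz
  have hA : 0 < 1 - ‖z‖ ^ 2 := by nlinarith [norm_nonneg z]
  have h1 := hasSum_norm_sq_unitMonomial ht hz'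
  have h2 : ∑' n, ‖unitMonomial t n z‖ₑ ^ 2 = ENNReal.ofReal ((1 - ‖z‖ ^ 2) ^ (-(2 + t))) := by
    rw [← h1.tsum_eq, ENNReal.ofReal_tsum_of_nonneg (fun n => by positivity) h1.summable]
    simp [ENNReal.ofReal_pow]
  have h3 : ‖f z‖ ^ 2 ≤ (C * (1 - ‖z‖ ^ 2)) ^ 2 := by
    gcongr
    exact hC z hz
  rw [h2, ← ofReal_norm, ← ENNReal.ofReal_pow (norm_nonneg _),
    ← ENNReal.ofReal_mul (by positivity), ← ofReal_norm, Complex.norm_real,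
    Real.norm_of_nonneg (by positivity)]
  refine ENNReal.ofReal_le_ofReal ?_
  have h4 : (1 - ‖z‖ ^ 2) ^ 2 * (1 - ‖z‖ ^ 2) ^ (-(2 + t)) = (1 - ‖z‖ ^ 2) ^ (-t) := by
    rw [← Real.rpow_natCast, ← Real.rpow_add hA]
    congr 1
    push_cast
    ring
  calc ‖f z‖ ^ 2 * (1 - ‖z‖ ^ 2) ^ (-(2 + t))
      ≤ (C * (1 - ‖z‖ ^ 2)) ^ 2 * (1 - ‖z‖ ^ 2) ^ (-(2 + t)) := by gcongr
    _ = _ := by rw [mul_pow, mul_assoc, h4]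

/-- For a symbol `f` vanishing to first order at the boundary, the sum over the basis can be
carried out under the integral. -/
theorem hankelPairing_eq_integral (ht : -1 < t) {f g : ℂ → ℂ} {C L : ℝ}
    (hf : ContinuousOn f (Metric.ball 0 1))
    (hC : ∀ z ∈ Metric.ball (0 : ℂ) 1, ‖f z‖ ≤ C * (1 - ‖z‖ ^ 2))
    (hg : ∀ z ∈ Metric.ball (0 : ℂ) 1, ∀ w ∈ Metric.ball (0 : ℂ) 1, ‖g z - g w‖ ≤ L * ‖z - w‖) :
    hankelPairing ht f g = ∫ z, f z * ∫ w, (‖bergmanKernel t z w‖ ^ 2 : ℝ) * (g z - g w)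
      ∂bergmanMeasure t ∂bergmanMeasure t := by
  have hfm : MemLp f ⊤ (bergmanMeasure t) := by
    refine memLp_bergmanMeasure_of_bound ht hf (C := |C|) fun z hz => (hC z hz).trans ?_
    have h1 : 0 ≤ 1 - ‖z‖ ^ 2 := by
      rw [mem_ball_zero_iff] at hz
      nlinarith [norm_nonneg z]
    nlinarith [le_abs_self C, abs_nonneg C, sq_nonneg ‖z‖]
  set F : ℕ → ℂ → ℂ := fun n z =>
    f z * (starRingEnd ℂ) (unitMonomial t n z) * hankel t g (monomialBasis ht n) z with hF
  have hFm : ∀ n, AEStronglyMeasurable (F n) (bergmanMeasure t) := fun n =>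
    (hfm.1.mul (memLp_conj (memLp_unitMonomial ht n)).1).mul (Lp.aestronglyMeasurable _)
  have hterm : ∀ n, (inner ℂ (hankel t (fun z => (starRingEnd ℂ) (f z)) (monomialBasis ht n))
      (hankel t g (monomialBasis ht n)) : ℂ) = ∫ z, F n z ∂bergmanMeasure t := by
    intro n
    rw [inner_hankel_hankel_eq, inner_eq_integral
      (coeFn_symbolMul (memLp_conj hfm) _ (coeFn_monomialBasis ht n)) (ae_eq_refl _)]
    refine integral_congr_ae (Eventually.of_forall fun z => ?_)
    simp only [map_mul, Complex.conj_conj, hF]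
  have hsum : ∑' n, ∫⁻ z, ‖F n z‖ₑ ∂bergmanMeasure t ≠ ⊤ := by
    have h1 : ∀ n, ∫⁻ z, ‖F n z‖ₑ ∂bergmanMeasure t
        ≤ (∫⁻ z, ‖f z‖ₑ ^ 2 * ‖unitMonomial t n z‖ₑ ^ 2 ∂bergmanMeasure t)
          + ‖hankel t g (monomialBasis ht n)‖ₑ ^ 2 := by
      intro n
      rw [enorm_sq_eq_lintegral, ← lintegral_add_right']
      · refine lintegral_mono fun z => ?_
        simp only [hF]
        rw [enorm_mul, enorm_mul, RCLike.enorm_conj, ← mul_pow]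
        generalize ‖f z‖ₑ * ‖unitMonomial t n z‖ₑ = a
        generalize ‖hankel t g (monomialBasis ht n) z‖ₑ = b
        rcases le_total a b with h | h
        · calc a * b ≤ b * b := by gcongr
            _ ≤ a ^ 2 + b ^ 2 := by rw [← sq]; exact le_add_self
        · calc a * b ≤ a * a := by gcongr
            _ ≤ a ^ 2 + b ^ 2 := by rw [← sq]; exact le_self_add
      · exact (Lp.aestronglyMeasurable _).enorm.pow_const 2
    refine ne_top_of_le_ne_top ?_ (ENNReal.tsum_le_tsum h1)
    rw [ENNReal.tsum_add, ← lintegral_tsum]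
    · refine ENNReal.add_ne_top.mpr ⟨?_, hsSum_hankel_ne_top ht hg⟩
      simp_rw [ENNReal.tsum_mul_left]
      exact lintegral_boundary_decay_ne_top ht hC
    · intro n
      exact (hfm.1.enorm.pow_const 2).mul ((memLp_unitMonomial ht n).1.enorm.pow_const 2)
  rw [hankelPairing]
  simp_rw [hterm]
  rw [← integral_tsum hFm hsum]
  refine integral_congr_ae ?_
  have h1 := ae_all_iff.mpr fun n => coeFn_hankel ht (memLp_of_norm_sub_le ht hg)
    (memLp_of_norm_sub_le ht hg) (monomialBasis ht n)
  filter_upwards [h1, ae_mem_ball_bergmanMeasure] with z h1 hz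
  have hz' := mem_ball_zero_iff.mp hz
  simp only [hF, h1 _ hz']
  simp_rw [mul_assoc]
  rw [tsum_mul_left]
  congr 1
  have h2 := hasSum_inner_mul_conj_unitMonomial ht hz'
    ((memLp_kernel_mul_conj_sub ht (memLp_of_norm_sub_le ht hg) hz').toLp _)
  simp_rw [mul_comm ((starRingEnd ℂ) _)]
  rw [h2.tsum_eq, kernelVector, inner_eq_integral (MemLp.coeFn_toLp _) (coeFn_toBergman _ _)]
  refine integral_congr_ae (Eventually.of_forall fun w => ?_)
  simp only [map_mul, Complex.conj_conj]
  rw [mul_right_comm, Complex.conj_mul']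
  push_cast
  ring

theorem DiskSmooth.norm_le {f : ℂ → ℂ} {L M : ℝ} (hf : DiskSmooth f L M) :
    ∀ z ∈ Metric.ball (0 : ℂ) 1, ‖f z‖ ≤ ‖f 0‖ + |L| := fun _ hz =>
  norm_le_of_norm_sub_le hf.norm_sub_le hz

theorem integral_norm_sq_bergmanKernel_mul_sub (ht : -1 < t) {g : ℂ → ℂ} {L M : ℝ}
    (hg : DiskSmooth g L M) {z : ℂ} (hz : ‖z‖ < 1) :
    ∫ w, (‖bergmanKernel t z w‖ ^ 2 : ℝ) * (g z - g w) ∂bergmanMeasure t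
      = -(((1 - ‖z‖ ^ 2) ^ (-(2 + t)) : ℝ) * ∫ w in Metric.ball (0 : ℂ) 1,
        (berezinKernel t (‖mobius z w‖ ^ 2) : ℂ) * Laplacian.laplacian g w) := by
  have := isFiniteMeasure_bergmanMeasure ht
  have hz' : z ∈ Metric.ball (0 : ℂ) 1 := mem_ball_zero_iff.mpr hz
  have hgm : MemLp (fun u => g (mobius z u)) 1 (bergmanMeasure t) :=
    memLp_bergmanMeasure_of_bound ht
      (hg.contDiffOn.continuousOn.comp (differentiableOn_mobius hz).continuousOn
        fun u hu => mobius_mem_ball hz' hu) fun u hu => hg.norm_le _ (mobius_mem_ball hz' hu)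
  have h1 : ∫ _u : ℂ, g z ∂bergmanMeasure t = g z := by
    have h2 := integral_conj_pow_mul_pow ht 0 0
    simp only [pow_zero, map_one, mul_one, if_true, bergmanMoment, one_mul,
      pi_mul_setIntegral_weightDensity ht] at h2
    have h3 := integral_const_mul (μ := bergmanMeasure t) (g z) fun _ : ℂ => (1 : ℂ)
    rw [h2] at h3
    simpa using h3
  rw [integral_norm_sq_bergmanKernel_mul ht hz fun w => g z - g w, ← mul_neg]
  congr 1
  rw [integral_sub (integrable_const _) (memLp_one_iff_integrable.mp hgm), h1,
    integral_bergmanMeasure ht, setIntegral_ball_radial_mul_comp_mobius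
      (integrableOn_weightDensity ht) hg.contDiffOn hg.norm_le hg.norm_laplacian_le hz,
    pi_mul_setIntegral_weightDensity ht, Complex.ofReal_one, one_mul, sub_add_cancel_left]
  congr 1
  refine integral_congr_ae ?_
  filter_upwards [ae_norm_mobius_sq_mem_Ioo hz] with w hw
  rw [radialPotential_weightDensity ht hw]

/-- The density `(t+1)/π (1 - |z|²)⁻²` of the invariant measure times the Berezin kernel. -/
noncomputable def invariantKernel (t : ℝ) (z w : ℂ) : ℝ :=
  (t + 1) / Real.pi * (((1 - ‖z‖ ^ 2) ^ 2)⁻¹ * berezinKernel t (‖mobius z w‖ ^ 2))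

theorem mobiusJac_smul_invariantKernel {w u : ℂ} (hw : ‖w‖ < 1) (hu : ‖u‖ < 1) :
    mobiusJac w u * invariantKernel t (mobius w u) w = invariantDensity t (‖u‖ ^ 2) := by
  have hA : 0 < 1 - ‖w‖ ^ 2 := by nlinarith [norm_nonneg w]
  have hB : 0 < 1 - ‖u‖ ^ 2 := by nlinarith [norm_nonneg u]
  have hN : 0 < ‖1 - (starRingEnd ℂ) w * u‖ :=
    norm_pos_iff.mpr (one_sub_conj_mul_ne_zero hw hu.le)
  rw [invariantKernel, norm_mobius_comm (mobius w u) w, mobius_mobius hw hu.le, one_sub_norm_mobius_sq hw hu.le,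
    mobiusJac, invariantDensity]
  field_simp

theorem integral_invariantKernel_mul {w : ℂ} (hw : ‖w‖ < 1) (F : ℂ → ℂ) :
    ∫ z in Metric.ball (0 : ℂ) 1, (invariantKernel t z w : ℂ) * F z
      = ∫ u in Metric.ball (0 : ℂ) 1, (invariantDensity t (‖u‖ ^ 2) : ℂ) * F (mobius w u) := by
  rw [← integral_ball_mobius hw]
  refine setIntegral_congr_fun Metric.isOpen_ball.measurableSet fun u hu => ?_
  rw [← mobiusJac_smul_invariantKernel hw (mem_ball_zero_iff.mp hu), Complex.real_smul]
  push_cast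
  ring

theorem integrableOn_invariantKernel (ht : -1 < t) {w : ℂ} (hw : ‖w‖ < 1) :
    IntegrableOn (fun z => invariantKernel t z w) (Metric.ball 0 1) := by
  rw [← integrableOn_ball_mobius_iff hw]
  refine IntegrableOn.congr_fun (integrableOn_comp_norm_sq (integrableOn_invariantDensity ht))
    (fun u hu => ?_) Metric.isOpen_ball.measurableSet
  rw [smul_eq_mul, mobiusJac_smul_invariantKernel hw (mem_ball_zero_iff.mp hu)]

theorem setIntegral_norm_invariantKernel (ht : -1 < t) {w : ℂ} (hw : ‖w‖ < 1) :
    ∫ z in Metric.ball (0 : ℂ) 1, ‖invariantKernel t z w‖ = 1 / (4 * Real.pi) := by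
  have h1 : ∫ z in Metric.ball (0 : ℂ) 1, ‖invariantKernel t z w‖
      = ∫ z in Metric.ball (0 : ℂ) 1, invariantKernel t z w := by
    refine integral_congr_ae ?_
    filter_upwards [ae_norm_mobius_sq_mem_Ioo hw] with z hz
    rw [norm_mobius_comm] at hz
    refine Real.norm_of_nonneg (mul_nonneg (div_nonneg (by linarith) Real.pi_pos.le)
      (mul_nonneg (by positivity) (berezinKernel_nonneg hz)))
  rw [h1, ← integral_ball_mobius hw, ← pi_mul_setIntegral_invariantDensity ht,
    ← setIntegral_comp_norm_sq (integrableOn_invariantDensity ht).1]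
  refine setIntegral_congr_fun Metric.isOpen_ball.measurableSet fun u hu => ?_
  rw [smul_eq_mul, mobiusJac_smul_invariantKernel hw (mem_ball_zero_iff.mp hu)]

theorem measurable_invariantKernel :
    Measurable fun p : ℂ × ℂ => invariantKernel t p.1 p.2 := by
  unfold invariantKernel
  have h1 : Measurable fun p : ℂ × ℂ => berezinKernel t (‖mobius p.1 p.2‖ ^ 2) :=
    measurable_berezinKernel.comp measurable_norm_mobius_sq
  have h2 : Measurable fun p : ℂ × ℂ => ((1 - ‖p.1‖ ^ 2) ^ 2)⁻¹ := by fun_prop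
  exact (h2.mul h1).const_mul _

theorem integrable_invariantKernel_prod (ht : -1 < t) :
    Integrable (fun p : ℂ × ℂ => invariantKernel t p.1 p.2)
      ((volume.restrict (Metric.ball (0 : ℂ) 1)).prod
        (volume.restrict (Metric.ball (0 : ℂ) 1))) := by
  have := isFiniteMeasure_restrict_ball
  have hm : AEStronglyMeasurable (fun p : ℂ × ℂ => invariantKernel t p.1 p.2)
      ((volume.restrict (Metric.ball (0 : ℂ) 1)).prod
        (volume.restrict (Metric.ball (0 : ℂ) 1))) :=
    measurable_invariantKernel.aestronglyMeasurable
  rw [integrable_prod_iff' hm]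
  refine ⟨?_, ?_⟩
  · filter_upwards [ae_restrict_mem Metric.isOpen_ball.measurableSet] with w hw
    exact integrableOn_invariantKernel ht (mem_ball_zero_iff.mp hw)
  · refine (integrable_const (1 / (4 * Real.pi))).congr ?_
    filter_upwards [ae_restrict_mem Metric.isOpen_ball.measurableSet] with w hw
    exact (setIntegral_norm_invariantKernel ht (mem_ball_zero_iff.mp hw)).symm

theorem aestronglyMeasurable_restrict_ball {f : ℂ → ℂ} (hf : ContinuousOn f (Metric.ball 0 1)) :
    AEStronglyMeasurable f (volume.restrict (Metric.ball (0 : ℂ) 1)) :=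
  hf.aestronglyMeasurable Metric.isOpen_ball.measurableSet

theorem integrable_mul_prod_of_bound {K : ℂ × ℂ → ℝ}
    (hK : Integrable K ((volume.restrict (Metric.ball (0 : ℂ) 1)).prod
        (volume.restrict (Metric.ball (0 : ℂ) 1)))) {a b : ℂ → ℂ}
    (ha : ContinuousOn a (Metric.ball 0 1)) (hb : ContinuousOn b (Metric.ball 0 1)) {A B : ℝ}
    (hA : ∀ z ∈ Metric.ball (0 : ℂ) 1, ‖a z‖ ≤ A) (hB : ∀ z ∈ Metric.ball (0 : ℂ) 1, ‖b z‖ ≤ B) :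
    Integrable (fun p : ℂ × ℂ => (K p : ℂ) * (a p.1 * b p.2))
      ((volume.restrict (Metric.ball (0 : ℂ) 1)).prod
        (volume.restrict (Metric.ball (0 : ℂ) 1))) := by
  have := isFiniteMeasure_restrict_ball
  have hK' : Integrable (fun p => (K p : ℂ)) ((volume.restrict (Metric.ball (0 : ℂ) 1)).prod
        (volume.restrict (Metric.ball (0 : ℂ) 1))) := hK.ofReal
  refine hK'.mul_bdd (c := A * B) ?_ ?_
  · exact (aestronglyMeasurable_restrict_ball ha).comp_fst.mul
      (aestronglyMeasurable_restrict_ball hb).comp_snd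
  · rw [Measure.prod_restrict]
    filter_upwards [ae_restrict_mem (Metric.isOpen_ball.measurableSet.prod
      Metric.isOpen_ball.measurableSet)] with p hp
    rw [norm_mul]
    have h0 := (norm_nonneg _).trans (hA p.1 hp.1)
    exact mul_le_mul (hA p.1 hp.1) (hB p.2 hp.2) (norm_nonneg _) h0

theorem integrable_laplacianIntegrand (ht : -1 < t) {f g : ℂ → ℂ} {L M L' M' : ℝ}
    (hf : DiskSmooth f L M) (hg : DiskSmooth g L' M') :
    Integrable (laplacianIntegrand t f g) ((volume.restrict (Metric.ball (0 : ℂ) 1)).prod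
        (volume.restrict (Metric.ball (0 : ℂ) 1))) := by
  have h := integrable_mul_prod_of_bound (integrable_rhoKernel_mobius_prod ht)
    (continuousOn_laplacian hf.contDiffOn) (continuousOn_laplacian hg.contDiffOn)
    hf.norm_laplacian_le hg.norm_laplacian_le
  refine h.congr (Eventually.of_forall fun p => ?_)
  simp only [laplacianIntegrand]
  ring

/-- The double integral of the two Laplacians. -/
noncomputable def laplacianTerm (t : ℝ) (f g : ℂ → ℂ) : ℂ :=
  ∫ p in Metric.ball (0 : ℂ) 1 ×ˢ Metric.ball (0 : ℂ) 1, laplacianIntegrand t f g p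

theorem laplacianTerm_eq (t : ℝ) (f g : ℂ → ℂ) :
    laplacianTerm t f g = ∫ p, laplacianIntegrand t f g p
      ∂((volume.restrict (Metric.ball (0 : ℂ) 1)).prod
        (volume.restrict (Metric.ball (0 : ℂ) 1))) := by
  rw [laplacianTerm, Measure.volume_eq_prod, Measure.prod_restrict]

/-- The trace formula when the first symbol vanishes at the boundary: both variables are integrated
by Green's formula, with a Möbius change of variables in between. -/
theorem neg_hankelPairing_eq (ht : -1 < t) {f g : ℂ → ℂ} {L M L' M' C : ℝ}
    (hf : DiskSmooth f L M) (hC : ∀ z ∈ Metric.ball (0 : ℂ) 1, ‖f z‖ ≤ C * (1 - ‖z‖ ^ 2))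
    (hg : DiskSmooth g L' M') :
    -hankelPairing ht f g
      = 1 / (4 * Real.pi) * (∫ z in Metric.ball (0 : ℂ) 1, f z * Laplacian.laplacian g z)
        + laplacianTerm t f g := by
  have hfin := isFiniteMeasure_restrict_ball
  have hk := integrableOn_invariantDensity ht
  have hcf := hf.contDiffOn.continuousOn
  have hcg := continuousOn_laplacian hg.contDiffOn
  have hprod := integrable_mul_prod_of_bound (integrable_invariantKernel_prod ht) hcf hcg
    hf.norm_le hg.norm_laplacian_le
  have hrho := integrable_laplacianIntegrand ht hf hg
  have e1 : -hankelPairing ht f g = ∫ z in Metric.ball (0 : ℂ) 1, ∫ w in Metric.ball (0 : ℂ) 1,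
      (invariantKernel t z w : ℂ) * (f z * Laplacian.laplacian g w) := by
    rw [hankelPairing_eq_integral ht hcf hC hg.norm_sub_le, integral_bergmanMeasure ht,
      ← integral_neg]
    refine setIntegral_congr_fun Metric.isOpen_ball.measurableSet fun z hz => ?_
    rw [mem_ball_zero_iff] at hz
    have hA : 0 < 1 - ‖z‖ ^ 2 := by nlinarith [norm_nonneg z]
    have h1 : weightDensity t (‖z‖ ^ 2) * (1 - ‖z‖ ^ 2) ^ (-(2 + t))
        = (t + 1) / Real.pi * ((1 - ‖z‖ ^ 2) ^ 2)⁻¹ := by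
      rw [weightDensity, mul_assoc, ← Real.rpow_add hA, ← Real.rpow_natCast (1 - ‖z‖ ^ 2) 2,
        ← Real.rpow_neg hA.le]
      congr 2
      push_cast
      ring
    have h2 : ∀ w, (invariantKernel t z w : ℂ) * (f z * Laplacian.laplacian g w)
        = ((weightDensity t (‖z‖ ^ 2) * (1 - ‖z‖ ^ 2) ^ (-(2 + t)) : ℝ) : ℂ) * f z *
          ((berezinKernel t (‖mobius z w‖ ^ 2) : ℂ) * Laplacian.laplacian g w) := by
      intro w
      rw [h1, invariantKernel]
      push_cast
      ring
    simp only [h2]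
    rw [integral_const_mul, integral_norm_sq_bergmanKernel_mul_sub ht hg hz]
    push_cast
    ring
  have e2 : ∀ w ∈ Metric.ball (0 : ℂ) 1, ∫ z in Metric.ball (0 : ℂ) 1,
        (invariantKernel t z w : ℂ) * (f z * Laplacian.laplacian g w)
      = 1 / (4 * Real.pi) * (f w * Laplacian.laplacian g w)
        + ∫ z in Metric.ball (0 : ℂ) 1, laplacianIntegrand t f g (z, w) := by
    intro w hw
    rw [mem_ball_zero_iff] at hw
    simp_rw [← mul_assoc]
    rw [integral_mul_const, integral_invariantKernel_mul hw,
      setIntegral_ball_radial_mul_comp_mobius hk hf.contDiffOn hf.norm_le hf.norm_laplacian_le hw,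
      pi_mul_setIntegral_invariantDensity ht, add_mul, ← integral_mul_const]
    congr 1
    · push_cast
      ring
    · refine integral_congr_ae ?_
      filter_upwards [ae_norm_mobius_sq_mem_Ioo hw] with z hz
      rw [radialPotential_invariantDensity ht hz, norm_mobius_comm, laplacianIntegrand]
  have e3 : ∫ z in Metric.ball (0 : ℂ) 1, ∫ w in Metric.ball (0 : ℂ) 1,
      (invariantKernel t z w : ℂ) * (f z * Laplacian.laplacian g w)
      = ∫ w in Metric.ball (0 : ℂ) 1, ∫ z in Metric.ball (0 : ℂ) 1,
      (invariantKernel t z w : ℂ) * (f z * Laplacian.laplacian g w) :=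
    integral_integral_swap hprod
  have hfg : IntegrableOn (fun w => f w * Laplacian.laplacian g w) (Metric.ball 0 1) := by
    refine Integrable.of_bound (aestronglyMeasurable_restrict_ball (hcf.mul hcg))
      ((‖f 0‖ + |L|) * M') ?_
    filter_upwards [ae_restrict_mem Metric.isOpen_ball.measurableSet] with w hw
    rw [norm_mul]
    have h0 := (norm_nonneg _).trans (hf.norm_le w hw)
    exact mul_le_mul (hf.norm_le w hw) (hg.norm_laplacian_le w hw) (norm_nonneg _) h0
  rw [e1, e3, setIntegral_congr_fun Metric.isOpen_ball.measurableSet e2,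
    integral_add (hfg.const_mul _) hrho.integral_prod_right, integral_const_mul, laplacianTerm_eq,
    integral_prod_symm _ hrho]

end TraceFormula

/-! ### The area term and Stokes' formula -/

section Stokes

/-- The extension by zero of a function vanishing to first order at the boundary of the disk is
globally Lipschitz. -/
theorem exists_lipschitzWith_indicator_ball {F : ℂ → ℂ} {B C : ℝ}
    (hF : ∀ z ∈ Metric.ball (0 : ℂ) 1, DifferentiableAt ℝ F z)
    (hB : ∀ z ∈ Metric.ball (0 : ℂ) 1, ‖fderiv ℝ F z‖ ≤ B)
    (hC : ∀ z ∈ Metric.ball (0 : ℂ) 1, ‖F z‖ ≤ C * (1 - ‖z‖ ^ 2)) :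
    ∃ K, LipschitzWith K ((Metric.ball (0 : ℂ) 1).indicator F) := by
  have h0 : (0 : ℂ) ∈ Metric.ball (0 : ℂ) 1 := by simp
  have hB0 : 0 ≤ B := (norm_nonneg _).trans (hB 0 h0)
  have hC0 : 0 ≤ C := by simpa using (norm_nonneg _).trans (hC 0 h0)
  have hout : ∀ z ∈ Metric.ball (0 : ℂ) 1, ∀ w ∉ Metric.ball (0 : ℂ) 1,
      ‖F z‖ ≤ (B + 2 * C) * ‖z - w‖ := by
    intro z hz w hw
    rw [mem_ball_zero_iff] at hw
    have hz' := mem_ball_zero_iff.mp hz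
    have h1 := norm_sub_norm_le w z
    rw [norm_sub_rev] at h1
    have h2 : 1 - ‖z‖ ^ 2 ≤ 2 * ‖z - w‖ := by nlinarith [norm_nonneg z]
    calc ‖F z‖ ≤ C * (1 - ‖z‖ ^ 2) := hC z hz
      _ ≤ C * (2 * ‖z - w‖) := by gcongr
      _ ≤ _ := by nlinarith [mul_nonneg hB0 (norm_nonneg (z - w))]
  refine ⟨Real.toNNReal (B + 2 * C), LipschitzWith.of_dist_le_mul fun z w => ?_⟩
  rw [dist_eq_norm, dist_eq_norm, Real.coe_toNNReal _ (by positivity)]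
  by_cases hz : z ∈ Metric.ball (0 : ℂ) 1 <;> by_cases hw : w ∈ Metric.ball (0 : ℂ) 1
  · rw [indicator_of_mem hz, indicator_of_mem hw]
    refine ((convex_ball (0 : ℂ) 1).norm_image_sub_le_of_norm_fderiv_le hF hB hw hz).trans ?_
    nlinarith [mul_nonneg hC0 (norm_nonneg (z - w))]
  · rw [indicator_of_mem hz, indicator_of_notMem hw, sub_zero]
    exact hout z hz w hw
  · rw [indicator_of_notMem hz, indicator_of_mem hw, zero_sub, norm_neg, norm_sub_rev]
    exact hout w hw z hz
  · rw [indicator_of_notMem hz, indicator_of_notMem hw, sub_zero, norm_zero]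
    positivity

theorem integrableOn_fderiv_apply {F : ℂ → ℂ} {B : ℝ}
    (hB : ∀ z ∈ Metric.ball (0 : ℂ) 1, ‖fderiv ℝ F z‖ ≤ B) (v : ℂ) :
    IntegrableOn (fun z => fderiv ℝ F z v) (Metric.ball 0 1) := by
  have := isFiniteMeasure_restrict_ball
  refine Integrable.of_bound (measurable_fderiv_apply_const ℝ F v).aestronglyMeasurable
    (B * ‖v‖) ?_
  filter_upwards [ae_restrict_mem Metric.isOpen_ball.measurableSet] with z hz
  exact (fderiv ℝ F z).le_of_opNorm_le (hB z hz) v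

/-- The derivative of a function vanishing at the boundary of the disk has integral zero. -/
theorem setIntegral_fderiv_apply_eq_zero {F : ℂ → ℂ} {B C : ℝ}
    (hF : ∀ z ∈ Metric.ball (0 : ℂ) 1, DifferentiableAt ℝ F z)
    (hB : ∀ z ∈ Metric.ball (0 : ℂ) 1, ‖fderiv ℝ F z‖ ≤ B)
    (hC : ∀ z ∈ Metric.ball (0 : ℂ) 1, ‖F z‖ ≤ C * (1 - ‖z‖ ^ 2)) (v : ℂ) :
    ∫ z in Metric.ball (0 : ℂ) 1, fderiv ℝ F z v = 0 := by
  obtain ⟨K, hK⟩ := exists_lipschitzWith_indicator_ball hF hB hC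
  have hsphere : ∀ᵐ z : ℂ, z ∉ Metric.sphere (0 : ℂ) 1 :=
    measure_eq_zero_iff_ae_notMem.mp (Measure.addHaar_sphere volume (0 : ℂ) 1)
  have key : ∀ l : ℂ →L[ℝ] ℝ, ∫ z in Metric.ball (0 : ℂ) 1, l (fderiv ℝ F z v) = 0 := by
    intro l
    set g : ℂ → ℝ := fun z => l ((Metric.ball (0 : ℂ) 1).indicator F z) with hg
    have hsupp : HasCompactSupport g := by
      refine HasCompactSupport.intro (isCompact_closedBall (0 : ℂ) 1) fun z hz => ?_
      rw [hg]
      simp only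
      rw [indicator_of_notMem fun h => hz (Metric.ball_subset_closedBall h), map_zero]
    have h := (LipschitzWith.const (1 : ℝ)).integral_lineDeriv_mul_eq (μ := volume)
      (l.lipschitz.comp hK) hsupp (-v)
    rw [neg_neg] at h
    have h1 : ∀ x : ℂ, lineDeriv ℝ (fun _ : ℂ => (1 : ℝ)) x (-v) = 0 := fun x => by
      simp [lineDeriv]
    simp only [h1, zero_mul, integral_zero, mul_one] at h
    rw [h, ← integral_indicator Metric.isOpen_ball.measurableSet]
    refine integral_congr_ae ?_
    filter_upwards [hsphere] with z hz
    by_cases hzb : z ∈ Metric.ball (0 : ℂ) 1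
    · rw [indicator_of_mem hzb]
      have h2 : (l ∘ (Metric.ball (0 : ℂ) 1).indicator F) =ᶠ[𝓝 z] l ∘ F := by
        filter_upwards [Metric.isOpen_ball.mem_nhds hzb] with w hw
        simp only [Function.comp_apply]
        rw [indicator_of_mem hw]
      have h3 : HasFDerivAt (l ∘ F) (l ∘L fderiv ℝ F z) z :=
        l.hasFDerivAt.comp z (hF z hzb).hasFDerivAt
      rw [((h3.congr_of_eventuallyEq h2).hasLineDerivAt v).lineDeriv]
      rfl
    · rw [indicator_of_notMem hzb]
      have hzc : z ∈ (Metric.closedBall (0 : ℂ) 1)ᶜ := by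
        intro h
        rcases Metric.mem_closedBall.mp h |>.lt_or_eq with h | h
        · exact hzb h
        · exact hz h
      have h2 : (l ∘ (Metric.ball (0 : ℂ) 1).indicator F) =ᶠ[𝓝 z] fun _ => 0 := by
        filter_upwards [Metric.isClosed_closedBall.isOpen_compl.mem_nhds hzc] with w hw
        simp only [Function.comp_apply]
        rw [indicator_of_notMem fun h => hw (Metric.ball_subset_closedBall h), map_zero]
      have h3 : HasFDerivAt (fun _ : ℂ => (0 : ℝ)) (0 : ℂ →L[ℝ] ℝ) z := hasFDerivAt_const _ _
      rw [((h3.congr_of_eventuallyEq h2).hasLineDerivAt v).lineDeriv]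
      rfl
  have hi := integrableOn_fderiv_apply hB v
  refine Complex.ext ?_ ?_
  · have h1 := Complex.reCLM.integral_comp_comm hi
    rw [key] at h1
    exact h1.symm
  · have h1 := Complex.imCLM.integral_comp_comm hi
    rw [key] at h1
    exact h1.symm

theorem DiskSmooth.norm_fderiv_le {f : ℂ → ℂ} {L M : ℝ} (hf : DiskSmooth f L M) {z : ℂ}
    (hz : z ∈ Metric.ball (0 : ℂ) 1) : ‖fderiv ℝ f z‖ ≤ L := by
  have h0 : (0 : ℂ) ∈ Metric.ball (0 : ℂ) 1 := by simp
  have hL : 0 ≤ L := by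
    have h1 : ((1 / 2 : ℝ) : ℂ) ∈ Metric.ball (0 : ℂ) 1 := by
      rw [mem_ball_zero_iff, Complex.norm_real]
      norm_num
    have h2 := (norm_nonneg _).trans (hf.norm_sub_le _ h1 0 h0)
    rw [sub_zero, Complex.norm_real] at h2
    norm_num at h2
    linarith
  refine norm_fderiv_le_of_lip' ℝ hL ?_
  filter_upwards [Metric.isOpen_ball.mem_nhds hz] with w hw
  exact hf.norm_sub_le w hw z hz

theorem DiskSmooth.contDiffAt {f : ℂ → ℂ} {L M : ℝ} (hf : DiskSmooth f L M) {z : ℂ}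
    (hz : z ∈ Metric.ball (0 : ℂ) 1) : ContDiffAt ℝ 2 f z :=
  hf.contDiffOn.contDiffAt (Metric.isOpen_ball.mem_nhds hz)

theorem DiskSmooth.differentiableAt {f : ℂ → ℂ} {L M : ℝ} (hf : DiskSmooth f L M) {z : ℂ}
    (hz : z ∈ Metric.ball (0 : ℂ) 1) : DifferentiableAt ℝ f z :=
  (hf.contDiffAt hz).differentiableAt (by norm_num)

/-- The term `(1/2πi) ∫ ∂f ∧ ∂̄g` of the trace formula. -/
noncomputable def areaTerm (f g : ℂ → ℂ) : ℂ :=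
  1 / (2 * Real.pi * Complex.I) * diskIntegral (wedgeForm (delForm f) (delbarForm g))

theorem areaCoeff_wedgeForm (f g : ℂ → ℂ) (z : ℂ) :
    areaCoeff (wedgeForm (delForm f) (delbarForm g)) z
      = -2 * Complex.I * (delForm f z 1 * delbarForm g z 1) := by
  have h1 : fderiv ℝ f z (-1) = -fderiv ℝ f z 1 := map_neg _ _
  have h2 : fderiv ℝ g z (-1) = -fderiv ℝ g z 1 := map_neg _ _
  simp only [areaCoeff, wedgeForm, delForm, delbarForm, mul_one, Complex.I_mul_I, h1, h2]
  linear_combination ((fderiv ℝ f z 1 * fderiv ℝ g z Complex.I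
    - fderiv ℝ f z Complex.I * fderiv ℝ g z 1
    - 2 * Complex.I * fderiv ℝ f z Complex.I * fderiv ℝ g z Complex.I) / 4) * Complex.I_sq

theorem areaTerm_eq (f g : ℂ → ℂ) :
    areaTerm f g = -(1 / Real.pi) * ∫ z in Metric.ball (0 : ℂ) 1,
      delForm f z 1 * delbarForm g z 1 := by
  rw [areaTerm, diskIntegral]
  simp_rw [areaCoeff_wedgeForm]
  rw [integral_const_mul]
  have := Complex.I_ne_zero
  have hpi : (Real.pi : ℂ) ≠ 0 := by exact_mod_cast Real.pi_ne_zero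
  field_simp

theorem norm_delForm_le {f : ℂ → ℂ} {z : ℂ} {L : ℝ} (h : ‖fderiv ℝ f z‖ ≤ L) :
    ‖delForm f z 1‖ ≤ L := by
  have h1 := (fderiv ℝ f z).le_of_opNorm_le h 1
  have h2 := (fderiv ℝ f z).le_of_opNorm_le h Complex.I
  rw [norm_one, mul_one] at h1
  rw [Complex.norm_I, mul_one] at h2
  rw [delForm, norm_div, Complex.norm_ofNat, div_le_iff₀ two_pos, mul_one]
  refine (norm_sub_le _ _).trans ?_
  rw [norm_mul, Complex.norm_I, one_mul]
  linarith

theorem norm_delbarForm_le {f : ℂ → ℂ} {z : ℂ} {L : ℝ} (h : ‖fderiv ℝ f z‖ ≤ L) :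
    ‖delbarForm f z 1‖ ≤ L := by
  have h1 := (fderiv ℝ f z).le_of_opNorm_le h 1
  have h2 := (fderiv ℝ f z).le_of_opNorm_le h Complex.I
  rw [norm_one, mul_one] at h1
  rw [Complex.norm_I, mul_one] at h2
  rw [delbarForm, norm_div, Complex.norm_ofNat, div_le_iff₀ two_pos, mul_one]
  refine (norm_add_le _ _).trans ?_
  rw [norm_mul, Complex.norm_I, one_mul]
  linarith

theorem measurable_delForm (f : ℂ → ℂ) : Measurable fun z => delForm f z 1 :=
  ((measurable_fderiv_apply_const ℝ f 1).sub
    ((measurable_fderiv_apply_const ℝ f _).const_mul _)).div_const _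

theorem measurable_delbarForm (f : ℂ → ℂ) : Measurable fun z => delbarForm f z 1 :=
  ((measurable_fderiv_apply_const ℝ f 1).add
    ((measurable_fderiv_apply_const ℝ f _).const_mul _)).div_const _

theorem norm_delForm_mul_delbarForm_le {f g : ℂ → ℂ} {L M L' M' : ℝ} (hf : DiskSmooth f L M)
    (hg : DiskSmooth g L' M') {z : ℂ} (hz : z ∈ Metric.ball (0 : ℂ) 1) :
    ‖delForm f z 1 * delbarForm g z 1‖ ≤ L * L' := by
  rw [norm_mul]
  have h1 := norm_delForm_le (hf.norm_fderiv_le hz)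
  exact mul_le_mul h1 (norm_delbarForm_le (hg.norm_fderiv_le hz)) (norm_nonneg _)
    ((norm_nonneg _).trans h1)

theorem integrableOn_delForm_mul_delbarForm {f g : ℂ → ℂ} {L M L' M' : ℝ}
    (hf : DiskSmooth f L M) (hg : DiskSmooth g L' M') :
    IntegrableOn (fun z => delForm f z 1 * delbarForm g z 1) (Metric.ball 0 1) := by
  have := isFiniteMeasure_restrict_ball
  refine Integrable.of_bound
    ((measurable_delForm f).mul (measurable_delbarForm g)).aestronglyMeasurable (L * L') ?_
  filter_upwards [ae_restrict_mem Metric.isOpen_ball.measurableSet] with z hz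
  exact norm_delForm_mul_delbarForm_le hf hg hz

theorem norm_areaTerm_le {f g : ℂ → ℂ} {L M L' M' : ℝ} (hf : DiskSmooth f L M)
    (hg : DiskSmooth g L' M') : ‖areaTerm f g‖ ≤ L * L' := by
  have h := norm_setIntegral_le_of_norm_le_const (measure_ball_lt_top (μ := volume))
    (fun z hz => norm_delForm_mul_delbarForm_le hf hg hz)
  have hv : volume.real (Metric.ball (0 : ℂ) 1) = Real.pi := by
    simp [Measure.real, Complex.volume_ball]
  rw [hv] at h
  rw [areaTerm_eq, norm_mul, norm_neg, norm_div, norm_one, Complex.norm_real,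
    Real.norm_of_nonneg Real.pi_pos.le, one_div_mul_eq_div, div_le_iff₀ Real.pi_pos]
  exact h

theorem norm_laplacianTerm_le {t : ℝ} (ht : -1 < t) {f g : ℂ → ℂ} {L M L' M' : ℝ}
    (hf : DiskSmooth f L M) (hg : DiskSmooth g L' M') :
    ‖laplacianTerm t f g‖ ≤ M * M' * (1 / (8 * Real.sqrt (t + 2))) := by
  rw [laplacianTerm_eq]
  have h0 : (0 : ℂ) ∈ Metric.ball (0 : ℂ) 1 := by simp
  have hM := (norm_nonneg _).trans (hf.norm_laplacian_le 0 h0)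
  have hM' := (norm_nonneg _).trans (hg.norm_laplacian_le 0 h0)
  refine (norm_integral_le_of_norm_le ((integrable_rhoKernel_mobius_prod ht).norm.const_mul
    (M * M')) ?_).trans ?_
  · rw [Measure.prod_restrict]
    filter_upwards [ae_restrict_mem (Metric.isOpen_ball.measurableSet.prod
      Metric.isOpen_ball.measurableSet)] with p hp
    rw [laplacianIntegrand, norm_mul, norm_mul, Complex.norm_real, mul_assoc, mul_comm]
    refine mul_le_mul_of_nonneg_right ?_ (norm_nonneg _)
    exact mul_le_mul (hf.norm_laplacian_le _ hp.1) (hg.norm_laplacian_le _ hp.2)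
      (norm_nonneg _) hM
  · rw [integral_const_mul]
    exact mul_le_mul_of_nonneg_left (integral_norm_rhoKernel_mobius_prod_le ht)
      (mul_nonneg hM hM')

/-- Stokes' formula: when `f` vanishes at the boundary, `∂f ∧ ∂̄g` may be replaced by
`-f ∂∂̄g`, and `∂∂̄` is a quarter of the Laplacian. -/
theorem areaTerm_eq_integral_mul_laplacian {f g : ℂ → ℂ} {L M L' M' B C : ℝ}
    (hf : DiskSmooth f L M) (hC : ∀ z ∈ Metric.ball (0 : ℂ) 1, ‖f z‖ ≤ C * (1 - ‖z‖ ^ 2))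
    (hg : DiskSmooth g L' M')
    (hB : ∀ z ∈ Metric.ball (0 : ℂ) 1, ‖fderiv ℝ (fderiv ℝ g) z‖ ≤ B) :
    areaTerm f g
      = 1 / (4 * Real.pi) * ∫ z in Metric.ball (0 : ℂ) 1, f z * Laplacian.laplacian g z := by
  have h0 : (0 : ℂ) ∈ Metric.ball (0 : ℂ) 1 := by simp
  have hC0 : 0 ≤ C := by simpa using (norm_nonneg _).trans (hC 0 h0)
  have hL0 : 0 ≤ L := (norm_nonneg _).trans (hf.norm_fderiv_le h0)
  have hL'0 : 0 ≤ L' := (norm_nonneg _).trans (hg.norm_fderiv_le h0)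
  have hB0 : 0 ≤ B := (norm_nonneg (fderiv ℝ (fderiv ℝ g) 0)).trans (hB 0 h0)
  have hCz : ∀ z ∈ Metric.ball (0 : ℂ) 1, ‖f z‖ ≤ C := fun z hz =>
    (hC z hz).trans (by nlinarith [mul_nonneg hC0 (sq_nonneg ‖z‖)])
  set F : ℂ → ℂ := fun z => f z * delbarForm g z 1 with hFdef
  have hdd : ∀ z ∈ Metric.ball (0 : ℂ) 1, HasFDerivAt (fderiv ℝ g) (fderiv ℝ (fderiv ℝ g) z) z :=
    fun z hz => (((hg.contDiffAt hz).fderiv_right (m := 1) (by norm_num)).differentiableAt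
      (by norm_num)).hasFDerivAt
  set D : ℂ → ℂ →L[ℝ] ℂ := fun z =>
    (2⁻¹ : ℂ) • ((fderiv ℝ (fderiv ℝ g) z).flip 1 +
      Complex.I • (fderiv ℝ (fderiv ℝ g) z).flip Complex.I) with hD
  have hder : ∀ z ∈ Metric.ball (0 : ℂ) 1, HasFDerivAt (fun w => delbarForm g w 1) (D z) z := by
    intro z hz
    have h1 : HasFDerivAt (fun w => fderiv ℝ g w 1) ((fderiv ℝ (fderiv ℝ g) z).flip 1) z := by
      simpa using (hdd z hz).clm_apply (hasFDerivAt_const (1 : ℂ) z)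
    have h2 : HasFDerivAt (fun w => fderiv ℝ g w Complex.I)
        ((fderiv ℝ (fderiv ℝ g) z).flip Complex.I) z := by
      simpa using (hdd z hz).clm_apply (hasFDerivAt_const Complex.I z)
    refine ((h1.add (h2.const_smul Complex.I)).const_smul (2⁻¹ : ℂ)).congr_of_eventuallyEq ?_
    refine Eventually.of_forall fun w => ?_
    simp only [delbarForm, mul_one, Pi.add_apply, Pi.smul_apply, smul_eq_mul]
    ring
  have hDn : ∀ z ∈ Metric.ball (0 : ℂ) 1, ∀ v, ‖D z v‖ ≤ B * ‖v‖ := by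
    intro z hz v
    have h1 := (fderiv ℝ (fderiv ℝ g) z).le_of_opNorm₂_le_of_le (hB z hz) le_rfl
      (norm_one (α := ℂ)).le (x := v)
    have h2 := (fderiv ℝ (fderiv ℝ g) z).le_of_opNorm₂_le_of_le (hB z hz) le_rfl
      Complex.norm_I.le (x := v)
    have h3 : D z v = 2⁻¹ * (fderiv ℝ (fderiv ℝ g) z v 1 +
        Complex.I * fderiv ℝ (fderiv ℝ g) z v Complex.I) := rfl
    rw [h3, norm_mul, norm_inv, Complex.norm_ofNat, inv_mul_le_iff₀ two_pos]
    refine (norm_add_le _ _).trans ?_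
    rw [norm_mul, Complex.norm_I, one_mul]
    linarith
  have hFder : ∀ z ∈ Metric.ball (0 : ℂ) 1,
      HasFDerivAt F (f z • D z + delbarForm g z 1 • fderiv ℝ f z) z := fun z hz =>
    (hf.differentiableAt hz).hasFDerivAt.mul (hder z hz)
  have hval : ∀ z ∈ Metric.ball (0 : ℂ) 1, ∀ v,
      fderiv ℝ F z v = f z * D z v + delbarForm g z 1 * fderiv ℝ f z v := by
    intro z hz v
    rw [(hFder z hz).fderiv]
    rfl
  have hFB : ∀ z ∈ Metric.ball (0 : ℂ) 1, ‖fderiv ℝ F z‖ ≤ C * B + L' * L := by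
    intro z hz
    refine ContinuousLinearMap.opNorm_le_bound _ (by positivity) fun v => ?_
    rw [hval z hz v]
    refine (norm_add_le _ _).trans ?_
    rw [norm_mul (f z) (D z v), norm_mul (delbarForm g z 1), add_mul, mul_assoc, mul_assoc]
    refine add_le_add (mul_le_mul (hCz z hz) (hDn z hz v) (norm_nonneg _) hC0)
      (mul_le_mul (norm_delbarForm_le (hg.norm_fderiv_le hz))
        ((fderiv ℝ f z).le_of_opNorm_le (hf.norm_fderiv_le hz) v) (norm_nonneg _) hL'0)
  have hFC : ∀ z ∈ Metric.ball (0 : ℂ) 1, ‖F z‖ ≤ C * L' * (1 - ‖z‖ ^ 2) := by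
    intro z hz
    rw [hFdef]
    simp only
    rw [norm_mul, mul_right_comm]
    exact mul_le_mul (hC z hz) (norm_delbarForm_le (hg.norm_fderiv_le hz)) (norm_nonneg _)
      ((norm_nonneg _).trans (hC z hz))
  have hFd := fun z hz => (hFder z hz).differentiableAt
  have e1 := setIntegral_fderiv_apply_eq_zero hFd hFB hFC 1
  have e2 := setIntegral_fderiv_apply_eq_zero hFd hFB hFC Complex.I
  have i1 := integrableOn_fderiv_apply hFB 1
  have i2 := integrableOn_fderiv_apply hFB Complex.I
  have e3 : ∫ z in Metric.ball (0 : ℂ) 1,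
      (fderiv ℝ F z 1 - Complex.I * fderiv ℝ F z Complex.I) = 0 := by
    rw [integral_sub i1 (i2.const_mul _), integral_const_mul, e1, e2, mul_zero, sub_zero]
  have e4 : ∀ z ∈ Metric.ball (0 : ℂ) 1,
      fderiv ℝ F z 1 - Complex.I * fderiv ℝ F z Complex.I
        = 2 * (delForm f z 1 * delbarForm g z 1) + 2⁻¹ * (f z * Laplacian.laplacian g z) := by
    intro z hz
    have hsymm := ((hg.contDiffAt hz).isSymmSndFDerivAt (by simp)) 1 Complex.I
    have h3 : ∀ v, D z v = 2⁻¹ * (fderiv ℝ (fderiv ℝ g) z v 1 +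
        Complex.I * fderiv ℝ (fderiv ℝ g) z v Complex.I) := fun v => rfl
    rw [hval z hz, hval z hz, h3, h3, laplacian_eq_fderiv_fderiv, delForm, mul_one]
    rw [hsymm]
    linear_combination (-2⁻¹ * f z * fderiv ℝ (fderiv ℝ g) z Complex.I Complex.I) * Complex.I_sq
  have hfg : IntegrableOn (fun w => f w * Laplacian.laplacian g w) (Metric.ball 0 1) := by
    have := isFiniteMeasure_restrict_ball
    refine Integrable.of_bound (aestronglyMeasurable_restrict_ball
      (hf.contDiffOn.continuousOn.mul (continuousOn_laplacian hg.contDiffOn))) (C * M') ?_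
    filter_upwards [ae_restrict_mem Metric.isOpen_ball.measurableSet] with w hw
    rw [norm_mul]
    exact mul_le_mul (hCz w hw) (hg.norm_laplacian_le w hw) (norm_nonneg _) hC0
  rw [setIntegral_congr_fun Metric.isOpen_ball.measurableSet e4,
    integral_add ((integrableOn_delForm_mul_delbarForm hf hg).const_mul _) (hfg.const_mul _),
    integral_const_mul, integral_const_mul] at e3
  rw [areaTerm_eq]
  have hpi : (Real.pi : ℂ) ≠ 0 := by exact_mod_cast Real.pi_ne_zero
  field_simp
  linear_combination -2 * e3

end Stokes

/-! ### The defect of the trace formula -/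

section Defect

variable {t : ℝ}

theorem DiskSmooth.nonneg {f : ℂ → ℂ} {L M : ℝ} (hf : DiskSmooth f L M) : 0 ≤ L :=
  (norm_nonneg _).trans (hf.norm_fderiv_le (Metric.mem_ball_self one_pos))

theorem DiskSmooth.mono {f : ℂ → ℂ} {L M L' M' : ℝ} (hf : DiskSmooth f L M) (hL : L ≤ L')
    (hM : M ≤ M') : DiskSmooth f L' M' where
  contDiffOn := hf.contDiffOn
  norm_sub_le z hz w hw := (hf.norm_sub_le z hz w hw).trans
    (mul_le_mul_of_nonneg_right hL (norm_nonneg _))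
  norm_laplacian_le z hz := (hf.norm_laplacian_le z hz).trans hM

theorem laplacian_add_const_mul {f h : ℂ → ℂ} {z : ℂ} (hf : ContDiffAt ℝ 2 f z)
    (hh : ContDiffAt ℝ 2 h z) (c : ℂ) :
    Laplacian.laplacian (fun w => f w + c * h w) z
      = Laplacian.laplacian f z + c * Laplacian.laplacian h z := by
  have h1 := hf.laplacian_add (hh.const_smul c)
  have h2 : Laplacian.laplacian (fun y => c • h y) z = c • Laplacian.laplacian h z :=
    InnerProductSpace.laplacian_smul c hh
  rw [h2] at h1
  exact h1

theorem DiskSmooth.add_const_mul {f h : ℂ → ℂ} {L M L' M' : ℝ} (hf : DiskSmooth f L M)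
    (hh : DiskSmooth h L' M') (c : ℂ) :
    DiskSmooth (fun z => f z + c * h z) (L + ‖c‖ * L') (M + ‖c‖ * M') where
  contDiffOn := hf.contDiffOn.add (contDiffOn_const.mul hh.contDiffOn)
  norm_sub_le z hz w hw := by
    have e : f z + c * h z - (f w + c * h w) = (f z - f w) + c * (h z - h w) := by ring
    rw [e, add_mul, mul_assoc]
    refine (norm_add_le _ _).trans (add_le_add (hf.norm_sub_le z hz w hw) ?_)
    rw [norm_mul]
    exact mul_le_mul_of_nonneg_left (hh.norm_sub_le z hz w hw) (norm_nonneg _)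
  norm_laplacian_le z hz := by
    rw [laplacian_add_const_mul (hf.contDiffAt hz) (hh.contDiffAt hz)]
    refine (norm_add_le _ _).trans (add_le_add (hf.norm_laplacian_le z hz) ?_)
    rw [norm_mul]
    exact mul_le_mul_of_nonneg_left (hh.norm_laplacian_le z hz) (norm_nonneg _)

theorem laplacian_conj (f : ℂ → ℂ) (z : ℂ) :
    Laplacian.laplacian (fun w => (starRingEnd ℂ) (f w)) z
      = (starRingEnd ℂ) (Laplacian.laplacian f z) :=
  congr_fun (InnerProductSpace.laplacian_CLE_comp_left (l := Complex.conjCLE) (f := f)) z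

theorem fderiv_conj_apply (f : ℂ → ℂ) (z v : ℂ) :
    fderiv ℝ (fun w => (starRingEnd ℂ) (f w)) z v = (starRingEnd ℂ) (fderiv ℝ f z v) := by
  have h : fderiv ℝ (Complex.conjCLE ∘ f) z = _ := Complex.conjCLE.comp_fderiv
  exact congr($h v)

theorem DiskSmooth.conj {f : ℂ → ℂ} {L M : ℝ} (hf : DiskSmooth f L M) :
    DiskSmooth (fun z => (starRingEnd ℂ) (f z)) L M where
  contDiffOn := Complex.conjCLE.contDiff.comp_contDiffOn hf.contDiffOn
  norm_sub_le := norm_conj_sub_conj_le hf.norm_sub_le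
  norm_laplacian_le z hz := by
    rw [laplacian_conj, RCLike.norm_conj]
    exact hf.norm_laplacian_le z hz

theorem delForm_conj (f : ℂ → ℂ) (z : ℂ) :
    delForm (fun w => (starRingEnd ℂ) (f w)) z 1 = (starRingEnd ℂ) (delbarForm f z 1) := by
  simp only [delForm, delbarForm, fderiv_conj_apply, map_div₀, map_add, map_mul, Complex.conj_I,
    map_ofNat, mul_one]
  ring

theorem delbarForm_conj (f : ℂ → ℂ) (z : ℂ) :
    delbarForm (fun w => (starRingEnd ℂ) (f w)) z 1 = (starRingEnd ℂ) (delForm f z 1) := by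
  simp only [delForm, delbarForm, fderiv_conj_apply, map_div₀, map_sub, map_mul, Complex.conj_I,
    map_ofNat, mul_one]
  ring

theorem delForm_add_const_mul {f h : ℂ → ℂ} {z : ℂ} (hf : DifferentiableAt ℝ f z)
    (hh : DifferentiableAt ℝ h z) (c : ℂ) :
    delForm (fun w => f w + c * h w) z 1 = delForm f z 1 + c * delForm h z 1 := by
  have h1 : HasFDerivAt (fun w => f w + c * h w) (fderiv ℝ f z + c • fderiv ℝ h z) z :=
    hf.hasFDerivAt.add (hh.hasFDerivAt.const_smul c)
  simp only [delForm, h1.fderiv, add_apply, smul_apply, smul_eq_mul]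
  ring

theorem symbolMul_add_const_mul {f h : ℂ → ℂ} (hf : MemLp f ⊤ (bergmanMeasure t))
    (hh : MemLp h ⊤ (bergmanMeasure t)) (c : ℂ) (u : bergmanSpace t) :
    symbolMul t (fun z => f z + c * h z) u = symbolMul t f u + c • symbolMul t h u := by
  have hfh : MemLp (fun z => f z + c * h z) ⊤ (bergmanMeasure t) := hf.add (hh.const_mul c)
  refine Lp.ext ?_
  filter_upwards [coeFn_symbolMul hfh u (coeFn_eq_holo u), coeFn_symbolMul hf u (coeFn_eq_holo u),
    coeFn_symbolMul hh u (coeFn_eq_holo u), Lp.coeFn_add (symbolMul t f u) (c • symbolMul t h u),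
    Lp.coeFn_smul c (symbolMul t h u)] with z h1 h2 h3 h4 h5
  rw [h1, h4, Pi.add_apply, h5, Pi.smul_apply, h2, h3, smul_eq_mul]
  ring

theorem hankel_add_const_mul {f h : ℂ → ℂ} (hf : MemLp f ⊤ (bergmanMeasure t))
    (hh : MemLp h ⊤ (bergmanMeasure t)) (c : ℂ) (u : bergmanSpace t) :
    hankel t (fun z => f z + c * h z) u = hankel t f u + c • hankel t h u := by
  simp only [hankel_apply, symbolMul_add_const_mul hf hh, map_add, map_smul, Submodule.coe_add,
    Submodule.coe_smul, smul_sub]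
  abel

theorem summable_inner_hankel (ht : -1 < t) {f g : ℂ → ℂ} {L M L' M' : ℝ}
    (hf : DiskSmooth f L M) (hg : DiskSmooth g L' M') :
    Summable fun k => ‖(inner ℂ (hankel t (fun z => (starRingEnd ℂ) (f z)) (monomialBasis ht k))
      (hankel t g (monomialBasis ht k)) : ℂ)‖ :=
  summable_norm_inner_of_hsSum_ne_top (hsSum_hankel_ne_top ht hf.conj.norm_sub_le)
    (hsSum_hankel_ne_top ht hg.norm_sub_le)

theorem hankelPairing_add_const_mul (ht : -1 < t) {f h g : ℂ → ℂ} {L M L' M' L₁ M₁ : ℝ}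
    (hf : DiskSmooth f L M) (hh : DiskSmooth h L' M') (hg : DiskSmooth g L₁ M₁) (c : ℂ) :
    hankelPairing ht (fun z => f z + c * h z) g
      = hankelPairing ht f g + c * hankelPairing ht h g := by
  have h1 := (summable_inner_hankel ht hf hg).of_norm
  have h2 := (summable_inner_hankel ht hh hg).of_norm
  rw [hankelPairing, hankelPairing, hankelPairing, ← tsum_mul_left,
    ← h1.tsum_add (h2.mul_left c)]
  refine tsum_congr fun k => ?_
  simp only [map_add, map_mul]
  rw [hankel_add_const_mul (memLp_of_norm_sub_le ht hf.conj.norm_sub_le)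
    (memLp_of_norm_sub_le ht hh.conj.norm_sub_le), inner_add_left, inner_smul_left,
    Complex.conj_conj]

theorem areaTerm_add_const_mul {f h g : ℂ → ℂ} {L M L' M' L₁ M₁ : ℝ}
    (hf : DiskSmooth f L M) (hh : DiskSmooth h L' M') (hg : DiskSmooth g L₁ M₁) (c : ℂ) :
    areaTerm (fun z => f z + c * h z) g = areaTerm f g + c * areaTerm h g := by
  have e : ∀ z ∈ Metric.ball (0 : ℂ) 1,
      delForm (fun w => f w + c * h w) z 1 * delbarForm g z 1
        = delForm f z 1 * delbarForm g z 1 + c * (delForm h z 1 * delbarForm g z 1) := by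
    intro z hz
    rw [delForm_add_const_mul (hf.differentiableAt hz) (hh.differentiableAt hz)]
    ring
  rw [areaTerm_eq, areaTerm_eq, areaTerm_eq,
    setIntegral_congr_fun Metric.isOpen_ball.measurableSet e,
    integral_add (integrableOn_delForm_mul_delbarForm hf hg)
      ((integrableOn_delForm_mul_delbarForm hh hg).const_mul c), integral_const_mul]
  ring

theorem laplacianTerm_add_const_mul (ht : -1 < t) {f h g : ℂ → ℂ} {L M L' M' L₁ M₁ : ℝ}
    (hf : DiskSmooth f L M) (hh : DiskSmooth h L' M') (hg : DiskSmooth g L₁ M₁) (c : ℂ) :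
    laplacianTerm t (fun z => f z + c * h z) g
      = laplacianTerm t f g + c * laplacianTerm t h g := by
  have i1 := integrable_laplacianIntegrand ht hf hg
  have i2 := integrable_laplacianIntegrand ht hh hg
  rw [Measure.prod_restrict, ← Measure.volume_eq_prod] at i1 i2
  rw [laplacianTerm, laplacianTerm, laplacianTerm, ← integral_const_mul,
    ← integral_add i1 (i2.const_mul c)]
  refine setIntegral_congr_fun (Metric.isOpen_ball.measurableSet.prod
    Metric.isOpen_ball.measurableSet) fun p hp => ?_
  simp only [laplacianIntegrand]
  rw [laplacian_add_const_mul (hf.contDiffAt hp.1) (hh.contDiffAt hp.1)]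
  ring

theorem hankelPairing_conj (ht : -1 < t) (f g : ℂ → ℂ) :
    hankelPairing ht (fun z => (starRingEnd ℂ) (g z)) (fun z => (starRingEnd ℂ) (f z))
      = (starRingEnd ℂ) (hankelPairing ht f g) := by
  rw [hankelPairing, hankelPairing, Complex.conj_tsum]
  refine tsum_congr fun k => ?_
  simp only [Complex.conj_conj]
  exact (inner_conj_symm (𝕜 := ℂ) _ _).symm

theorem areaTerm_conj (f g : ℂ → ℂ) :
    areaTerm (fun z => (starRingEnd ℂ) (g z)) (fun z => (starRingEnd ℂ) (f z))
      = (starRingEnd ℂ) (areaTerm f g) := by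
  simp_rw [areaTerm_eq, delForm_conj, delbarForm_conj, ← map_mul]
  rw [integral_conj, map_mul, map_neg, map_div₀, map_one, Complex.conj_ofReal]
  simp_rw [mul_comm (delbarForm g _ 1)]

theorem laplacianTerm_conj (t : ℝ) (f g : ℂ → ℂ) :
    laplacianTerm t (fun z => (starRingEnd ℂ) (g z)) (fun z => (starRingEnd ℂ) (f z))
      = (starRingEnd ℂ) (laplacianTerm t f g) := by
  rw [laplacianTerm_eq, laplacianTerm_eq, ← integral_conj, ← integral_prod_swap]
  refine integral_congr_ae ?_
  rw [Measure.prod_restrict]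
  filter_upwards [ae_restrict_mem (Metric.isOpen_ball.measurableSet.prod
    Metric.isOpen_ball.measurableSet)] with p hp
  simp only [laplacianIntegrand, laplacian_conj, Prod.fst_swap, Prod.snd_swap, map_mul,
    Complex.conj_ofReal]
  rw [norm_mobius_comm p.2 p.1]
  ring

/-- The difference of the two sides of the trace formula. -/
noncomputable def traceDefect (ht : -1 < t) (f g : ℂ → ℂ) : ℂ :=
  hankelPairing ht f g + areaTerm f g + laplacianTerm t f g

theorem traceDefect_add_const_mul (ht : -1 < t) {f h g : ℂ → ℂ} {L M L' M' L₁ M₁ : ℝ}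
    (hf : DiskSmooth f L M) (hh : DiskSmooth h L' M') (hg : DiskSmooth g L₁ M₁) (c : ℂ) :
    traceDefect ht (fun z => f z + c * h z) g = traceDefect ht f g + c * traceDefect ht h g := by
  rw [traceDefect, hankelPairing_add_const_mul ht hf hh hg, areaTerm_add_const_mul hf hh hg,
    laplacianTerm_add_const_mul ht hf hh hg, traceDefect, traceDefect]
  ring

theorem traceDefect_conj (ht : -1 < t) (f g : ℂ → ℂ) :
    traceDefect ht (fun z => (starRingEnd ℂ) (g z)) (fun z => (starRingEnd ℂ) (f z))
      = (starRingEnd ℂ) (traceDefect ht f g) := by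
  rw [traceDefect, hankelPairing_conj, areaTerm_conj, laplacianTerm_conj, traceDefect, map_add,
    map_add]

theorem traceDefect_eq_zero_of_boundary_decay (ht : -1 < t) {f g : ℂ → ℂ} {L M L' M' B C : ℝ}
    (hf : DiskSmooth f L M) (hC : ∀ z ∈ Metric.ball (0 : ℂ) 1, ‖f z‖ ≤ C * (1 - ‖z‖ ^ 2))
    (hg : DiskSmooth g L' M')
    (hB : ∀ z ∈ Metric.ball (0 : ℂ) 1, ‖fderiv ℝ (fderiv ℝ g) z‖ ≤ B) :
    traceDefect ht f g = 0 := by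
  have h := neg_hankelPairing_eq ht hf hC hg
  rw [← areaTerm_eq_integral_mul_laplacian hf hC hg hB] at h
  rw [traceDefect]
  linear_combination -h

theorem norm_hankelPairing_le (ht : -1 < t) {f g : ℂ → ℂ} {L M L' M' : ℝ} (hL : 0 < L)
    (hf : DiskSmooth f L M) (hg : DiskSmooth g L' M') :
    ‖hankelPairing ht f g‖ ≤ L * ((1 + L' ^ 2) / 2) := by
  have s0 := summable_inner_hankel ht hf hg
  have s1 := (summable_of_hsSum_ne_top (hsSum_hankel_ne_top ht hf.conj.norm_sub_le)).mul_left L⁻¹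
  have s2 := (summable_of_hsSum_ne_top (hsSum_hankel_ne_top ht hg.norm_sub_le)).mul_left L
  have b1 := tsum_norm_sq_hankel_le ht hf.conj.norm_sub_le
  have b2 := tsum_norm_sq_hankel_le ht hg.norm_sub_le
  calc ‖hankelPairing ht f g‖
      ≤ ∑' k, ‖(inner ℂ (hankel t (fun z => (starRingEnd ℂ) (f z)) (monomialBasis ht k))
          (hankel t g (monomialBasis ht k)) : ℂ)‖ := norm_tsum_le_tsum_norm s0
    _ ≤ ∑' k, (L⁻¹ * ‖hankel t (fun z => (starRingEnd ℂ) (f z)) (monomialBasis ht k)‖ ^ 2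
          + L * ‖hankel t g (monomialBasis ht k)‖ ^ 2) / 2 := by
        refine s0.tsum_le_tsum (fun k => (norm_inner_le_norm _ _).trans ?_)
          ((s1.add s2).div_const 2)
        generalize ‖hankel t (fun z => (starRingEnd ℂ) (f z)) (monomialBasis ht k)‖ = a
        generalize ‖hankel t g (monomialBasis ht k)‖ = b
        have h := mul_nonneg (inv_nonneg.mpr hL.le) (sq_nonneg (a - L * b))
        have e : L⁻¹ * (a - L * b) ^ 2 = L⁻¹ * a ^ 2 + L * b ^ 2 - 2 * (a * b) := by
          field_simp
          ring
        linarith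
    _ ≤ (L⁻¹ * L ^ 2 + L * L' ^ 2) / 2 := by
        rw [tsum_div_const, s1.tsum_add s2, tsum_mul_left, tsum_mul_left]
        gcongr
    _ = L * ((1 + L' ^ 2) / 2) := by
        field_simp

/-- For a harmonic symbol `f` the defect is controlled by the Lipschitz constant of `f`. -/
theorem norm_traceDefect_le (ht : -1 < t) {f g : ℂ → ℂ} {L L' M' : ℝ} (hL : 0 < L)
    (hf : DiskSmooth f L 0) (hg : DiskSmooth g L' M') :
    ‖traceDefect ht f g‖ ≤ L * ((1 + L' ^ 2) / 2 + L') := by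
  have h1 := norm_hankelPairing_le ht hL hf hg
  have h2 := norm_areaTerm_le hf hg
  have h3 := norm_laplacianTerm_le ht hf hg
  rw [zero_mul, zero_mul] at h3
  have h4 := norm_add₃_le (a := hankelPairing ht f g) (b := areaTerm f g)
    (c := laplacianTerm t f g)
  rw [traceDefect]
  linarith

/-- A holomorphic symbol preserves the Bergman space. -/
theorem hankel_eq_zero_of_differentiableOn {h : ℂ → ℂ} (hm : MemLp h ⊤ (bergmanMeasure t))
    (hd : DifferentiableOn ℂ h (Metric.ball 0 1)) (u : bergmanSpace t) : hankel t h u = 0 := by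
  have hmem : symbolMul t h u ∈ bergmanSpace t :=
    ⟨fun z => h z * holo u z, hd.mul (differentiableOn_holo u),
      coeFn_symbolMul hm u (coeFn_eq_holo u)⟩
  rw [hankel_apply, sub_eq_zero]
  exact (Submodule.starProjection_eq_self_iff.mpr hmem).symm

theorem delbarForm_eq_zero {h : ℂ → ℂ} {z : ℂ} (hd : DifferentiableAt ℂ h z) :
    delbarForm h z 1 = 0 := by
  rw [delbarForm, (hasFDerivAt_real_of_hasDerivAt hd.hasDerivAt).fderiv]
  simp
  linear_combination deriv h z * Complex.I_sq

/-- The trace formula holds for conjugate holomorphic `f`: all terms vanish. -/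
theorem traceDefect_conj_eq_zero (ht : -1 < t) {h g : ℂ → ℂ} {L L' M' : ℝ}
    (hh : DiskSmooth h L 0) (hd : DifferentiableOn ℂ h (Metric.ball 0 1))
    (hg : DiskSmooth g L' M') :
    traceDefect ht (fun z => (starRingEnd ℂ) (h z)) g = 0 := by
  have h1 : hankelPairing ht (fun z => (starRingEnd ℂ) (h z)) g = 0 := by
    rw [hankelPairing, ← tsum_zero]
    refine tsum_congr fun k => ?_
    simp only [Complex.conj_conj]
    rw [hankel_eq_zero_of_differentiableOn (memLp_of_norm_sub_le ht hh.norm_sub_le) hd,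
      inner_zero_left]
  have h2 : areaTerm (fun z => (starRingEnd ℂ) (h z)) g = 0 := by
    rw [areaTerm_eq, setIntegral_eq_zero_of_forall_eq_zero, mul_zero]
    intro z hz
    rw [delForm_conj, delbarForm_eq_zero (hd.differentiableAt (Metric.isOpen_ball.mem_nhds hz)),
      map_zero, zero_mul]
  have h3 := norm_laplacianTerm_le ht hh.conj hg
  rw [zero_mul, zero_mul, norm_le_zero_iff] at h3
  rw [traceDefect, h1, h2, h3]
  simp

theorem traceDefect_eq_zero_of_forall_exists (ht : -1 < t) {f g : ℂ → ℂ} {L' M' : ℝ}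
    (hg : DiskSmooth g L' M')
    (h : ∀ ε > 0, ∃ f', DiskSmooth f' ε 0 ∧ traceDefect ht f' g = traceDefect ht f g) :
    traceDefect ht f g = 0 := by
  have hK : 0 < (1 + L' ^ 2) / 2 + L' := by nlinarith [hg.nonneg, sq_nonneg L']
  refine norm_le_zero_iff.mp (le_of_forall_pos_le_add fun ε hε => ?_)
  obtain ⟨f', hf', he⟩ := h (ε / ((1 + L' ^ 2) / 2 + L')) (by positivity)
  have h1 := norm_traceDefect_le ht (by positivity) hf' hg
  rwa [he, div_mul_cancel₀ _ hK.ne', ← zero_add ε] at h1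

end Defect

/-! ### Harmonic symbols -/

section Harmonic

variable {t : ℝ}

theorem DiskSmooth.of_differentiableOn {h : ℂ → ℂ} {L : ℝ}
    (hd : DifferentiableOn ℂ h (Metric.ball 0 1))
    (hL : ∀ z ∈ Metric.ball (0 : ℂ) 1, ∀ w ∈ Metric.ball (0 : ℂ) 1, ‖h z - h w‖ ≤ L * ‖z - w‖) :
    DiskSmooth h L 0 where
  contDiffOn := (hd.contDiffOn Metric.isOpen_ball).restrict_scalars ℝ
  norm_sub_le := hL
  norm_laplacian_le z hz := by
    have h1 := (hd.analyticAt (Metric.isOpen_ball.mem_nhds hz)).harmonicAt.2.self_of_nhds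
    rw [h1, Pi.zero_apply, norm_zero]

theorem diskSmooth_pow (n : ℕ) : DiskSmooth (fun z => z ^ n) n 0 :=
  .of_differentiableOn (by fun_prop) fun _ hz _ hw =>
    norm_pow_sub_pow_le n (mem_ball_zero_iff.mp hz).le (mem_ball_zero_iff.mp hw).le

theorem delForm_eq_deriv {h : ℂ → ℂ} {z : ℂ} (hd : DifferentiableAt ℂ h z) :
    delForm h z 1 = deriv h z := by
  rw [delForm, (hasFDerivAt_real_of_hasDerivAt hd.hasDerivAt).fderiv]
  simp
  linear_combination (-deriv h z / 2) * Complex.I_sq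

theorem setIntegral_ball_conj_pow_mul_pow (n m : ℕ) :
    ∫ z in Metric.ball (0 : ℂ) 1, (starRingEnd ℂ) (z ^ n) * z ^ m
      = if n = m then (Real.pi / (n + 1) : ℂ) else 0 := by
  have hpi : (Real.pi : ℂ) ≠ 0 := by exact_mod_cast Real.pi_ne_zero
  have h := integral_conj_pow_mul_pow (t := 0) (by norm_num) n m
  have hw : ∀ x, weightDensity 0 x = 1 / Real.pi := fun x => by simp [weightDensity]
  have hm : bergmanMoment 0 n = 1 / (n + 1) := by
    have h1 : ∫ x in Ioo (0 : ℝ) 1, x ^ n = 1 / (n + 1) := by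
      rw [← integral_Ioc_eq_integral_Ioo, ← intervalIntegral.integral_of_le zero_le_one,
        integral_pow]
      simp
    simp only [bergmanMoment, hw]
    rw [integral_mul_const, h1]
    field_simp
  rw [integral_bergmanMeasure (by norm_num)] at h
  simp only [hw] at h
  rw [integral_const_mul, hm] at h
  push_cast at h
  rw [one_div_mul_eq_div, div_eq_iff hpi] at h
  rw [h]
  split_ifs
  · rw [one_div_mul_eq_div]
  · rw [zero_mul]

theorem areaTerm_pow_conj_pow (n m : ℕ) :
    areaTerm (fun z => z ^ n) (fun z => (starRingEnd ℂ) (z ^ m))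
      = -(if n = m then (n : ℂ) else 0) := by
  have hpi : (Real.pi : ℂ) ≠ 0 := by exact_mod_cast Real.pi_ne_zero
  have e : ∀ z, delForm (fun z => z ^ n) z 1 *
      delbarForm (fun z => (starRingEnd ℂ) (z ^ m)) z 1
      = (n * m : ℂ) * ((starRingEnd ℂ) (z ^ (m - 1)) * z ^ (n - 1)) := by
    intro z
    rw [delbarForm_conj, delForm_eq_deriv (by fun_prop), delForm_eq_deriv (by fun_prop)]
    simp
    ring
  rw [areaTerm_eq]
  simp_rw [e]
  rw [integral_const_mul, setIntegral_ball_conj_pow_mul_pow]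
  rcases n with _ | n
  · simp
  rcases m with _ | m
  · simp
  have hn : (n : ℂ) + 1 ≠ 0 := Nat.cast_add_one_ne_zero n
  simp only [Nat.add_sub_cancel]
  by_cases h : n = m
  · subst h
    rw [if_pos rfl, if_pos rfl]
    push_cast
    field_simp
  · rw [if_neg (by omega), if_neg (by omega), mul_zero, mul_zero, neg_zero]

theorem traceDefect_pow_conj_pow (ht : -1 < t) (n m : ℕ) :
    traceDefect ht (fun z => z ^ n) (fun z => (starRingEnd ℂ) (z ^ m)) = 0 := by
  have h3 := norm_laplacianTerm_le ht (diskSmooth_pow n) (diskSmooth_pow m).conj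
  rw [zero_mul, zero_mul, norm_le_zero_iff] at h3
  rw [traceDefect, hankelPairing, tsum_inner_hankel_conj_pow, areaTerm_pow_conj_pow, h3]
  ring

theorem summable_mul_pow {a : ℕ → ℂ} (ha : Summable fun j : ℕ => (1 + j : ℝ) * ‖a j‖) {z : ℂ}
    (hz : ‖z‖ ≤ 1) : Summable fun j => a j * z ^ j := by
  refine Summable.of_norm_bounded ha fun j => ?_
  rw [norm_mul, norm_pow]
  have h1 : ‖z‖ ^ j ≤ 1 := pow_le_one₀ (norm_nonneg z) hz
  have h2 : (0 : ℝ) ≤ j := Nat.cast_nonneg j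
  nlinarith [norm_nonneg (a j), mul_nonneg h2 (norm_nonneg (a j))]

theorem norm_tsum_mul_pow_sub_le {a : ℕ → ℂ} (ha : Summable fun j : ℕ => (1 + j : ℝ) * ‖a j‖) {z w : ℂ}
    (hz : ‖z‖ ≤ 1) (hw : ‖w‖ ≤ 1) :
    ‖∑' j, a j * z ^ j - ∑' j, a j * w ^ j‖ ≤ (∑' j : ℕ, (1 + j : ℝ) * ‖a j‖) * ‖z - w‖ := by
  rw [← (summable_mul_pow ha hz).tsum_sub (summable_mul_pow ha hw), ← tsum_mul_right]
  refine tsum_of_norm_bounded (ha.mul_right ‖z - w‖).hasSum fun j => ?_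
  rw [← mul_sub, norm_mul]
  have h1 := norm_pow_sub_pow_le j hz hw
  have h2 := mul_le_mul_of_nonneg_left h1 (norm_nonneg (a j))
  nlinarith [mul_nonneg (norm_nonneg (a j)) (norm_nonneg (z - w))]

theorem differentiableOn_tsum_mul_pow {a : ℕ → ℂ} (ha : Summable fun j : ℕ => (1 + j : ℝ) * ‖a j‖) :
    DifferentiableOn ℂ (fun z => ∑' j, a j * z ^ j) (Metric.ball 0 1) := by
  refine Complex.differentiableOn_tsum_of_summable_norm ha (fun j => by fun_prop) Metric.isOpen_ball
    fun j z hz => ?_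
  rw [norm_mul, norm_pow]
  have h1 : ‖z‖ ^ j ≤ 1 := pow_le_one₀ (norm_nonneg z) (mem_ball_zero_iff.mp hz).le
  have h2 : (0 : ℝ) ≤ j := Nat.cast_nonneg j
  nlinarith [norm_nonneg (a j), mul_nonneg h2 (norm_nonneg (a j))]

theorem diskSmooth_tsum_mul_pow {a : ℕ → ℂ} (ha : Summable fun j : ℕ => (1 + j : ℝ) * ‖a j‖) :
    DiskSmooth (fun z => ∑' j, a j * z ^ j) (∑' j : ℕ, (1 + j : ℝ) * ‖a j‖) 0 :=
  .of_differentiableOn (differentiableOn_tsum_mul_pow ha) fun _ hz _ hw =>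
    norm_tsum_mul_pow_sub_le ha (mem_ball_zero_iff.mp hz).le (mem_ball_zero_iff.mp hw).le

/-- If the trace formula holds for the monomials, it holds for power series which are Lipschitz
with summable constants: the tails of the series are small in the Lipschitz norm. -/
theorem traceDefect_tsum_mul_pow (ht : -1 < t) {a : ℕ → ℂ}
    (ha : Summable fun j : ℕ => (1 + j : ℝ) * ‖a j‖) {g : ℂ → ℂ} {L' M' : ℝ}
    (hg : DiskSmooth g L' M') (h : ∀ j, traceDefect ht (fun z => z ^ j) g = 0) :
    traceDefect ht (fun z => ∑' j, a j * z ^ j) g = 0 := by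
  set b : ℕ → ℕ → ℂ := fun N j => if j < N then 0 else a j with hb
  have hle : ∀ N (j : ℕ), ‖(1 + j : ℝ) * ‖b N j‖‖ ≤ (1 + j : ℝ) * ‖a j‖ := by
    intro N j
    rw [Real.norm_of_nonneg (by positivity)]
    refine mul_le_mul_of_nonneg_left ?_ (by positivity)
    simp only [hb]
    split_ifs
    · simp
    · exact le_rfl
  have hs : ∀ N, Summable fun j : ℕ => (1 + j : ℝ) * ‖b N j‖ := fun N =>
    Summable.of_norm_bounded ha (hle N)
  have hlim : Tendsto (fun N => ∑' j : ℕ, (1 + j : ℝ) * ‖b N j‖) atTop (𝓝 0) := by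
    rw [← tsum_zero (α := ℝ) (β := ℕ)]
    refine tendsto_tsum_of_dominated_convergence ha (fun j => ?_) (Eventually.of_forall hle)
    refine tendsto_const_nhds.congr' ?_
    filter_upwards [eventually_gt_atTop j] with N hN
    simp only [hb, if_pos hN, norm_zero, mul_zero]
  set S : ℕ → ℂ → ℂ := fun N z => ∑' j, a j * z ^ j - ∑ j ∈ Finset.range N, a j * z ^ j with hS
  have hSb : ∀ N, ∀ z ∈ Metric.ball (0 : ℂ) 1, S N z = ∑' j, b N j * z ^ j := by
    intro N z hz
    have hz' := (mem_ball_zero_iff.mp hz).le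
    have h1 : HasSum (fun j => if j < N then a j * z ^ j else 0)
        (∑ j ∈ Finset.range N, a j * z ^ j) := by
      rw [← Finset.sum_congr rfl fun j hj => if_pos (Finset.mem_range.mp hj)]
      exact hasSum_sum_of_ne_finset_zero fun j hj => if_neg (by simpa using hj)
    have h2 := h1.add (summable_mul_pow (hs N) hz').hasSum
    rw [hS, sub_eq_iff_eq_add', ← h2.tsum_eq]
    refine tsum_congr fun j => ?_
    simp only [hb]
    split_ifs <;> simp
  have hSd : ∀ N, DiskSmooth (S N) (∑' j : ℕ, (1 + j : ℝ) * ‖b N j‖) 0 := by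
    intro N
    refine .of_differentiableOn ((differentiableOn_tsum_mul_pow ha).sub (by fun_prop))
      fun z hz w hw => ?_
    rw [hSb N z hz, hSb N w hw]
    exact norm_tsum_mul_pow_sub_le (hs N) (mem_ball_zero_iff.mp hz).le
      (mem_ball_zero_iff.mp hw).le
  have hstep : ∀ N, traceDefect ht (S N) g = traceDefect ht (S 0) g := by
    intro N
    induction N with
    | zero => rfl
    | succ N ih =>
      have h1 := traceDefect_add_const_mul ht (hSd N) (diskSmooth_pow N) hg (-a N)
      rw [h N, mul_zero, add_zero, ih] at h1
      rw [← h1]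
      congr 1
      ext z
      simp only [hS, Finset.sum_range_succ]
      ring
  have h0 : S 0 = fun z => ∑' j, a j * z ^ j := by
    ext z
    simp [hS]
  rw [← h0]
  refine traceDefect_eq_zero_of_forall_exists ht hg fun ε hε => ?_
  obtain ⟨N, hN⟩ := (hlim.eventually_le_const hε).exists
  exact ⟨S N, (hSd N).mono hN le_rfl, hstep N⟩

end Harmonic

/-! ### Functions of class `C²` on the closed disk -/

section ClosedDisk

theorem uniqueDiffOn_closedBall_one : UniqueDiffOn ℝ (Metric.closedBall (0 : ℂ) 1) :=
  uniqueDiffOn_convex (convex_closedBall 0 1)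
    ⟨0, Metric.ball_subset_interior_closedBall (Metric.mem_ball_self one_pos)⟩

theorem exists_norm_sub_le_of_contDiffOn {f : ℂ → ℂ}
    (hf : ContDiffOn ℝ 2 f (Metric.closedBall 0 1)) :
    ∃ L, ∀ z ∈ Metric.closedBall (0 : ℂ) 1, ∀ w ∈ Metric.closedBall (0 : ℂ) 1,
      ‖f z - f w‖ ≤ L * ‖z - w‖ := by
  have h1 : ContinuousOn (fderivWithin ℝ f (Metric.closedBall 0 1)) (Metric.closedBall 0 1) :=
    hf.continuousOn_fderivWithin uniqueDiffOn_closedBall_one (by norm_num)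
  obtain ⟨L, hL⟩ := (isCompact_closedBall (0 : ℂ) 1).exists_bound_of_continuousOn h1
  exact ⟨L, fun z hz w hw => (convex_closedBall (0 : ℂ) 1).norm_image_sub_le_of_norm_fderivWithin_le
    (hf.differentiableOn (by norm_num)) hL hw hz⟩

theorem exists_norm_fderiv_fderiv_le {f : ℂ → ℂ}
    (hf : ContDiffOn ℝ 2 f (Metric.closedBall 0 1)) :
    ∃ B, ∀ z ∈ Metric.ball (0 : ℂ) 1, ‖fderiv ℝ (fderiv ℝ f) z‖ ≤ B := by
  set S := Metric.closedBall (0 : ℂ) 1 with hS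
  have h1 : ContDiffOn ℝ 1 (fderivWithin ℝ f S) S :=
    hf.fderivWithin uniqueDiffOn_closedBall_one (by norm_num)
  have h2 : ContinuousOn (fderivWithin ℝ (fderivWithin ℝ f S) S) S :=
    h1.continuousOn_fderivWithin uniqueDiffOn_closedBall_one le_rfl
  obtain ⟨B, hB⟩ := (isCompact_closedBall (0 : ℂ) 1).exists_bound_of_continuousOn
    (E := ℂ →L[ℝ] ℂ →L[ℝ] ℂ) h2
  have hnhds : ∀ z ∈ Metric.ball (0 : ℂ) 1, S ∈ 𝓝 z := fun z hz =>
    mem_of_superset (Metric.isOpen_ball.mem_nhds hz) Metric.ball_subset_closedBall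
  refine ⟨B, fun z hz => ?_⟩
  have h3 : fderiv ℝ f =ᶠ[𝓝 z] fderivWithin ℝ f S := by
    filter_upwards [Metric.isOpen_ball.mem_nhds hz] with w hw
    exact (fderivWithin_of_mem_nhds (hnhds w hw)).symm
  rw [h3.fderiv_eq, ← fderivWithin_of_mem_nhds (hnhds z hz)]
  exact hB z (Metric.ball_subset_closedBall hz)

theorem exists_diskSmooth {f : ℂ → ℂ} (hf : ContDiffOn ℝ 2 f (Metric.closedBall 0 1)) :
    ∃ L M, DiskSmooth f L M := by
  obtain ⟨L, hL⟩ := exists_norm_sub_le_of_contDiffOn hf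
  obtain ⟨B, hB⟩ := exists_norm_fderiv_fderiv_le hf
  refine ⟨L, B + B, hf.mono Metric.ball_subset_closedBall, fun z hz w hw =>
    hL z (Metric.ball_subset_closedBall hz) w (Metric.ball_subset_closedBall hw), fun z hz => ?_⟩
  rw [laplacian_eq_fderiv_fderiv]
  have h1 := (fderiv ℝ (fderiv ℝ f) z).le_of_opNorm₂_le_of_le (hB z hz)
    (norm_one (α := ℂ)).le (norm_one (α := ℂ)).le
  have h2 := (fderiv ℝ (fderiv ℝ f) z).le_of_opNorm₂_le_of_le (hB z hz)
    Complex.norm_I.le Complex.norm_I.le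
  rw [mul_one, mul_one] at h1 h2
  exact (norm_add_le _ _).trans (add_le_add h1 h2)

/-- A Lipschitz function vanishing on the unit circle vanishes to first order there. -/
theorem norm_le_of_eq_zero_on_sphere {F : ℂ → ℂ} {K : ℝ}
    (hF : ∀ z ∈ Metric.closedBall (0 : ℂ) 1, ∀ w ∈ Metric.closedBall (0 : ℂ) 1,
      ‖F z - F w‖ ≤ K * ‖z - w‖) (h0 : ∀ w : ℂ, ‖w‖ = 1 → F w = 0) {z : ℂ}
    (hz : z ∈ Metric.ball (0 : ℂ) 1) : ‖F z‖ ≤ K * (1 - ‖z‖ ^ 2) := by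
  have hz' := mem_ball_zero_iff.mp hz
  obtain ⟨w, hw, hzw⟩ : ∃ w : ℂ, ‖w‖ = 1 ∧ ‖z - w‖ = 1 - ‖z‖ := by
    rcases eq_or_ne z 0 with rfl | hne
    · exact ⟨1, norm_one, by simp⟩
    · have hn : (‖z‖ : ℂ) ≠ 0 := by exact_mod_cast norm_ne_zero_iff.mpr hne
      have hn' : 0 < ‖z‖ := norm_pos_iff.mpr hne
      refine ⟨z / ‖z‖, by simp [hne], ?_⟩
      have e : z - z / ‖z‖ = ((1 - ‖z‖⁻¹ : ℝ) : ℂ) * z := by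
        push_cast
        field_simp
      rw [e, norm_mul, Complex.norm_real, Real.norm_of_nonpos]
      · field_simp
        ring
      · rw [sub_nonpos]
        exact (one_le_inv₀ hn').mpr hz'.le
  have h1 : ∀ w : ℂ, ‖w‖ = 1 → w ∈ Metric.closedBall (0 : ℂ) 1 := fun w hw =>
    mem_closedBall_zero_iff.mpr hw.le
  have hK : 0 ≤ K := by
    have h2 := (norm_nonneg _).trans (hF 1 (h1 1 norm_one) 0 (by simp))
    simpa using h2
  have h3 := hF z (Metric.ball_subset_closedBall hz) w (h1 w hw)
  rw [h0 w hw, sub_zero, hzw] at h3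
  refine h3.trans (mul_le_mul_of_nonneg_left ?_ hK)
  nlinarith [norm_nonneg z]

/-! ### Fourier series of `C²` functions -/

theorem norm_fourierCoeffOn_of_periodic {φ φ' : ℝ → ℂ} {T : ℝ} (hT : 0 < 0 + T)
    (hper : φ (0 + T) = φ 0) (hd : ∀ x, HasDerivAt φ (φ' x) x) (hc : Continuous φ') {n : ℤ}
    (hn : n ≠ 0) :
    ‖fourierCoeffOn hT φ n‖ = T / (2 * Real.pi * |(n : ℝ)|) * ‖fourierCoeffOn hT φ' n‖ := by
  rw [fourierCoeffOn_of_hasDerivAt hT hn (fun x _ => hd x) (hc.intervalIntegrable _ _), hper,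
    sub_self, mul_zero, zero_sub, norm_mul, norm_neg, norm_mul, norm_div]
  have hT' : 0 < T := by linarith
  simp only [norm_mul, norm_neg, Complex.norm_I, Complex.norm_real, Complex.norm_intCast,
    Complex.norm_ofNat, norm_one, Real.norm_of_nonneg Real.pi_pos.le]
  have e : ‖((0 + T : ℝ) : ℂ) - ((0 : ℝ) : ℂ)‖ = T := by
    rw [← Complex.ofReal_sub, Complex.norm_real, zero_add, sub_zero, Real.norm_of_nonneg hT'.le]
  rw [e]
  ring

/-- A periodic `C²` function is the sum of its Fourier series, whose coefficients `c n` satisfy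
`∑ |n| ‖c n‖ < ∞`: after two integrations by parts `n² c n` is square summable. -/
theorem exists_hasSum_fourier {φ : ℝ → ℂ} (hφ : ContDiff ℝ 2 φ)
    (hper : Function.Periodic φ (2 * Real.pi)) :
    ∃ c : ℤ → ℂ, (Summable fun n : ℤ => (1 + |(n : ℝ)|) * ‖c n‖) ∧
      ∀ θ ∈ Ico 0 (2 * Real.pi),
        HasSum (fun n : ℤ => c n * Complex.exp (θ * Complex.I) ^ n) (φ θ) := by
  have hT0 : 0 < 2 * Real.pi := Real.two_pi_pos
  have hfact : Fact (0 < 2 * Real.pi) := ⟨hT0⟩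
  have hT : 0 < 0 + 2 * Real.pi := lt_add_of_pos_right 0 hT0
  have hd1 : ∀ x, HasDerivAt φ (deriv φ x) x := fun x =>
    (hφ.differentiable (by norm_num) x).hasDerivAt
  have hφ1 : ContDiff ℝ 1 (deriv φ) := hφ.deriv' (n := 1)
  have hd2 : ∀ x, HasDerivAt (deriv φ) (deriv (deriv φ) x) x := fun x =>
    (hφ1.differentiable (by norm_num) x).hasDerivAt
  have hφ2 : Continuous (deriv (deriv φ)) := hφ1.continuous_deriv le_rfl
  have hper1 : Function.Periodic (deriv φ) (2 * Real.pi) := fun x => by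
    rw [← deriv_comp_add_const]
    exact congr_arg (fun ψ => deriv ψ x) (funext hper)
  set c : ℤ → ℂ := fourierCoeffOn hT φ with hc
  set d : ℤ → ℂ := fourierCoeffOn hT (deriv (deriv φ)) with hd
  have hcd : ∀ n : ℤ, n ≠ 0 → ‖c n‖ = 1 / |(n : ℝ)| ^ 2 * ‖d n‖ := by
    intro n hn
    have hn' : |(n : ℝ)| ≠ 0 := by simpa using hn
    rw [hc, norm_fourierCoeffOn_of_periodic hT (by rw [zero_add, ← hper 0, zero_add]) hd1
      hφ1.continuous hn, norm_fourierCoeffOn_of_periodic hT (by rw [zero_add, ← hper1 0, zero_add])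
      hd2 hφ2 hn]
    field_simp
    rfl
  have hds : Summable fun n => ‖d n‖ ^ 2 := by
    refine (hasSum_sq_fourierCoeffOn hT ?_).summable
    obtain ⟨C, hC⟩ := isCompact_Icc.exists_bound_of_continuousOn (s := Icc 0 (0 + 2 * Real.pi))
      hφ2.continuousOn
    refine MemLp.of_bound hφ2.aestronglyMeasurable C ?_
    filter_upwards [ae_restrict_mem measurableSet_Ioc] with x hx
    exact hC x (Ioc_subset_Icc_self hx)
  have hsum : Summable fun n : ℤ => (1 + |(n : ℝ)|) * ‖c n‖ := by
    have h2 : Summable fun n : ℤ => 1 / (n : ℝ) ^ 2 := Real.summable_one_div_int_pow.mpr one_lt_two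
    have h3 : Summable fun n : ℤ => if n = 0 then ‖c 0‖ else 0 := (hasSum_ite_eq 0 _).summable
    refine Summable.of_nonneg_of_le (fun n => by positivity) (fun n => ?_)
      (h3.add (hds.add h2))
    split_ifs with hn
    · subst hn
      have := sq_nonneg ‖d 0‖
      simp
    · have hn1 : (1 : ℝ) ≤ |(n : ℝ)| := by exact_mod_cast Int.one_le_abs hn
      have h4 := sq_nonneg (‖d n‖ - 1 / |(n : ℝ)|)
      have h5 : (1 + |(n : ℝ)|) * ‖c n‖ ≤ 2 * (1 / |(n : ℝ)| * ‖d n‖) := by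
        rw [hcd n hn]
        have e : 2 * (1 / |(n : ℝ)| * ‖d n‖) = (|(n : ℝ)| + |(n : ℝ)|) *
            (1 / |(n : ℝ)| ^ 2 * ‖d n‖) := by
          field_simp
          ring
        rw [e]
        gcongr
      have h6 : 1 / (n : ℝ) ^ 2 = (1 / |(n : ℝ)|) ^ 2 := by rw [div_pow, one_pow, sq_abs]
      rw [h6]
      linarith
  refine ⟨c, hsum, fun θ hθ => ?_⟩
  have hcont : Continuous (AddCircle.liftIoc (2 * Real.pi) 0 φ) :=
    AddCircle.liftIoc_continuous (by rw [zero_add, ← hper 0, zero_add]) hφ.continuous.continuousOn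
  set ψ : C(AddCircle (2 * Real.pi), ℂ) := ⟨_, hcont⟩ with hψ
  have hcψ : fourierCoeff ψ = c := funext fun n => fourierCoeff_liftIoc_eq φ n
  have hcs : Summable c := by
    refine Summable.of_norm_bounded hsum fun n => ?_
    nlinarith [mul_nonneg (abs_nonneg (n : ℝ)) (norm_nonneg (c n))]
  have h := has_pointwise_sum_fourier_series_of_summable (f := ψ) (by rwa [hcψ])
    (θ : AddCircle (2 * Real.pi))
  have hval : ψ (θ : AddCircle (2 * Real.pi)) = φ θ := by
    rcases eq_or_lt_of_le hθ.1 with h0 | h0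
    · have e : ((θ : ℝ) : AddCircle (2 * Real.pi)) = ((2 * Real.pi : ℝ) : AddCircle _) := by
        rw [← h0, AddCircle.coe_period, AddCircle.coe_zero]
      rw [e, ← h0, ← hper 0, zero_add]
      exact AddCircle.liftIoc_coe_apply ⟨hT0, by simp⟩
    · exact AddCircle.liftIoc_coe_apply ⟨h0, by simpa using hθ.2.le⟩
  rw [hval] at h
  refine h.congr_fun fun n => ?_
  rw [hcψ, smul_eq_mul, fourier_coe_apply, ← Complex.exp_int_mul]
  congr 2
  have hpi : (Real.pi : ℂ) ≠ 0 := by exact_mod_cast Real.pi_ne_zero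
  push_cast
  field_simp

/-- The boundary values of a `C²` function are those of a harmonic function given by two power
series, one in `z` and one in `z̄`. -/
theorem exists_harmonic_extension {f : ℂ → ℂ} (hf : ContDiffOn ℝ 2 f (Metric.closedBall 0 1)) :
    ∃ a b : ℕ → ℂ, (Summable fun j : ℕ => (1 + j : ℝ) * ‖a j‖) ∧
      (Summable fun j : ℕ => (1 + j : ℝ) * ‖b j‖) ∧
      ∀ w : ℂ, ‖w‖ = 1 →
        f w = ∑' j, a j * w ^ j + (starRingEnd ℂ) (∑' j, b j * w ^ j) := by
  have hmaps : ∀ θ : ℝ, circleMap 0 1 θ ∈ Metric.closedBall (0 : ℂ) 1 := fun θ =>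
    circleMap_mem_closedBall 0 zero_le_one θ
  have hφ : ContDiff ℝ 2 fun θ : ℝ => f (circleMap 0 1 θ) :=
    hf.comp_contDiff (contDiff_circleMap 0 1) hmaps
  obtain ⟨c, hc, hsum⟩ := exists_hasSum_fourier hφ fun θ => by
    rw [periodic_circleMap 0 1 θ]
  have hpos : Summable fun j : ℕ => (1 + j : ℝ) * ‖c j‖ := by
    have h := hc.comp_injective (Nat.cast_injective (R := ℤ))
    refine h.congr fun j => ?_
    simp
  have hneg : Summable fun j : ℕ => (1 + j : ℝ) * ‖c (-j)‖ := by
    have h := hc.comp_injective (neg_injective.comp (Nat.cast_injective (R := ℤ)))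
    refine h.congr fun j => ?_
    simp
  -- the constant coefficient is counted with the series in `z̄`
  set a : ℕ → ℂ := fun j => if j = 0 then 0 else c j with ha
  set b : ℕ → ℂ := fun j => (starRingEnd ℂ) (c (-j)) with hb
  have has : Summable fun j : ℕ => (1 + j : ℝ) * ‖a j‖ := by
    refine Summable.of_nonneg_of_le (fun j => by positivity) (fun j => ?_) hpos
    simp only [ha]
    split_ifs
    · rw [norm_zero, mul_zero]
      positivity
    · exact le_rfl
  have hbs : Summable fun j : ℕ => (1 + j : ℝ) * ‖b j‖ := by
    simpa only [hb, RCLike.norm_conj] using hneg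
  refine ⟨a, b, has, hbs, fun w hw => ?_⟩
  obtain ⟨θ, hθ, hwθ⟩ : ∃ θ ∈ Ico 0 (2 * Real.pi), w = Complex.exp (θ * Complex.I) := by
    refine ⟨toIcoMod Real.two_pi_pos 0 w.arg, ?_, ?_⟩
    · simpa using toIcoMod_mem_Ico Real.two_pi_pos 0 w.arg
    · have h1 := Complex.norm_mul_exp_arg_mul_I w
      rw [hw, Complex.ofReal_one, one_mul] at h1
      have h2 := (periodic_circleMap 0 1).sub_zsmul_eq (x := w.arg)
        (toIcoDiv Real.two_pi_pos 0 w.arg)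
      rw [self_sub_toIcoDiv_zsmul] at h2
      rw [circleMap_zero, circleMap_zero, Complex.ofReal_one, one_mul, one_mul, h1] at h2
      exact h2.symm
  have h := (hsum θ hθ).nat_add_neg
  rw [← hwθ] at h
  have hcirc : circleMap 0 1 θ = w := by rw [hwθ, circleMap]; simp
  rw [hcirc] at h
  have h' := h.sub (hasSum_ite_eq (0 : ℕ) (c 0))
  have hw1 : (starRingEnd ℂ) w = w⁻¹ := by
    rw [Complex.inv_def, Complex.normSq_eq_norm_sq, hw]
    simp
  have h1 := (summable_mul_pow has hw.le).hasSum
  have h2 := Complex.hasSum_conj'.mpr (summable_mul_pow hbs hw.le).hasSum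
  have h3 : HasSum (fun j : ℕ => c j * w ^ (j : ℤ) + c (-j) * w ^ (-j : ℤ)
      - if j = 0 then c 0 else 0)
      (∑' j, a j * w ^ j + (starRingEnd ℂ) (∑' j, b j * w ^ j)) := by
    refine (h1.add h2).congr_fun fun j => ?_
    simp only [hb, map_mul, Complex.conj_conj, map_pow, hw1, zpow_neg, zpow_natCast, inv_pow, ha]
    split_ifs with hj
    · subst hj
      simp
    · simp
  have h4 := h'.unique h3
  simpa using h4

end ClosedDisk

/-! ### The trace formula for general symbols -/

section GeneralSymbols

variable {t : ℝ}

/-- The trace formula for `f` and `g` follows from the formulas for the monomials `z ^ j` and `g`: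
up to a function vanishing at the boundary, `f` is a harmonic function. -/
theorem traceDefect_eq_zero_of_pow (ht : -1 < t) {f g : ℂ → ℂ}
    (hf : ContDiffOn ℝ 2 f (Metric.closedBall 0 1)) (hg : ContDiffOn ℝ 2 g (Metric.closedBall 0 1))
    (h : ∀ j : ℕ, traceDefect ht (fun z => z ^ j) g = 0) : traceDefect ht f g = 0 := by
  obtain ⟨a, b, ha, hb, hab⟩ := exists_harmonic_extension hf
  obtain ⟨L, M, hfs⟩ := exists_diskSmooth hf
  obtain ⟨L', M', hgs⟩ := exists_diskSmooth hg
  obtain ⟨B, hB⟩ := exists_norm_fderiv_fderiv_le hg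
  obtain ⟨K, hK⟩ := exists_norm_sub_le_of_contDiffOn hf
  have hA := diskSmooth_tsum_mul_pow ha
  have hBs := diskSmooth_tsum_mul_pow hb
  have hu := hA.add_const_mul hBs.conj 1
  have hu0 : traceDefect ht (fun z => ∑' j, a j * z ^ j +
      1 * (starRingEnd ℂ) (∑' j, b j * z ^ j)) g = 0 := by
    rw [traceDefect_add_const_mul ht hA hBs.conj hgs, traceDefect_tsum_mul_pow ht ha hgs h,
      traceDefect_conj_eq_zero ht hBs (differentiableOn_tsum_mul_pow hb) hgs]
    simp
  have h1 := traceDefect_add_const_mul ht hfs hu hgs (-1)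
  rw [hu0, mul_zero, add_zero] at h1
  rw [← h1]
  refine traceDefect_eq_zero_of_boundary_decay ht (hfs.add_const_mul hu (-1)) (fun z hz =>
    norm_le_of_eq_zero_on_sphere (F := fun z => f z + -1 * (∑' j, a j * z ^ j +
      1 * (starRingEnd ℂ) (∑' j, b j * z ^ j))) (K := K + ((∑' j : ℕ, (1 + j : ℝ) * ‖a j‖) +
      ∑' j : ℕ, (1 + j : ℝ) * ‖b j‖)) ?_ ?_ hz) hgs hB
  · intro z hz w hw
    have e1 := norm_tsum_mul_pow_sub_le ha (mem_closedBall_zero_iff.mp hz)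
      (mem_closedBall_zero_iff.mp hw)
    have e2 := norm_tsum_mul_pow_sub_le hb (mem_closedBall_zero_iff.mp hz)
      (mem_closedBall_zero_iff.mp hw)
    rw [← RCLike.norm_conj, map_sub] at e2
    refine le_trans (le_of_eq ?_) ((norm_sub_le_of_le (hK z hz w hw)
      (norm_add_le_of_le e1 e2)).trans (le_of_eq ?_))
    · congr 1
      ring
    · ring
  · intro w hw
    rw [hab w hw]
    ring

theorem contDiffOn_conj {f : ℂ → ℂ} {s : Set ℂ} (hf : ContDiffOn ℝ 2 f s) :
    ContDiffOn ℝ 2 (fun z => (starRingEnd ℂ) (f z)) s :=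
  Complex.conjCLE.contDiff.comp_contDiffOn hf

/-- The formula for `(z^j, z̄^k)` yields that for `(f, z̄^k)`, by conjugation that for `(z^k, g)`, and
from there the general one. -/
theorem traceDefect_eq_zero (ht : -1 < t) {f g : ℂ → ℂ}
    (hf : ContDiffOn ℝ 2 f (Metric.closedBall 0 1))
    (hg : ContDiffOn ℝ 2 g (Metric.closedBall 0 1)) : traceDefect ht f g = 0 := by
  have hpow : ∀ k : ℕ, ContDiffOn ℝ 2 (fun z : ℂ => z ^ k) (Metric.closedBall 0 1) := fun k => by
    fun_prop
  refine traceDefect_eq_zero_of_pow ht hf hg fun k => ?_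
  -- the roles of the two symbols are exchanged by complex conjugation
  rw [← map_eq_zero (starRingEnd ℂ), ← traceDefect_conj]
  exact traceDefect_eq_zero_of_pow ht (contDiffOn_conj hg) (contDiffOn_conj (hpow k)) fun j =>
    traceDefect_pow_conj_pow ht j k

/-- The `L¹`-norm of the kernel `ρ_t(|φ_z w|²)` is of order `t^{-1/2}`. -/
theorem tendsto_laplacianTerm {f g : ℂ → ℂ} {L M L' M' : ℝ} (hf : DiskSmooth f L M)
    (hg : DiskSmooth g L' M') : Tendsto (fun t => laplacianTerm t f g) atTop (𝓝 0) := by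
  have h1 : Tendsto (fun t : ℝ => 8 * Real.sqrt (t + 2)) atTop atTop :=
    (Real.tendsto_sqrt_atTop.comp (tendsto_atTop_add_const_right _ 2 tendsto_id)).const_mul_atTop
      (by norm_num)
  have h2 := (h1.const_div_atTop 1).const_mul (M * M')
  rw [mul_zero] at h2
  refine squeeze_zero_norm' ?_ h2
  filter_upwards [eventually_gt_atTop (-1 : ℝ)] with t ht
  exact norm_laplacianTerm_le ht hf hg

end GeneralSymbols

theorem theorem3p1 (f g : ℂ → ℂ)
    (hf : ContDiffOn ℝ 2 f (Metric.closedBall (0 : ℂ) 1))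
    (hg : ContDiffOn ℝ 2 g (Metric.closedBall (0 : ℂ) 1)) :
    (∀ t : ℝ, -1 < t → ∀ s ∈ Ioo (0 : ℝ) 1, 0 < rhoKernel t s) ∧
    IntegrableOn (areaCoeff (wedgeForm (delForm f) (delbarForm g))) (Metric.ball (0 : ℂ) 1) ∧
    (∀ t : ℝ, -1 < t →
      IntegrableOn (laplacianIntegrand t f g)
        (Metric.ball (0 : ℂ) 1 ×ˢ Metric.ball (0 : ℂ) 1) ∧
      HasTrace (semiCommutator t f g)
        (1 / (2 * Real.pi * Complex.I) * diskIntegral (wedgeForm (delForm f) (delbarForm g)) +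
          ∫ p in Metric.ball (0 : ℂ) 1 ×ˢ Metric.ball (0 : ℂ) 1, laplacianIntegrand t f g p)) ∧
    Tendsto (fun t : ℝ => opTrace (semiCommutator t f g)) atTop
      (𝓝 (1 / (2 * Real.pi * Complex.I) *
        diskIntegral (wedgeForm (delForm f) (delbarForm g)))) ∧
    Tendsto (fun t : ℝ =>
        ∫ p in Metric.ball (0 : ℂ) 1 ×ˢ Metric.ball (0 : ℂ) 1, laplacianIntegrand t f g p)
      atTop (𝓝 0) := by
  obtain ⟨L, M, hfs⟩ := exists_diskSmooth hf
  obtain ⟨L', M', hgs⟩ := exists_diskSmooth hg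
  have htrace : ∀ t : ℝ, -1 < t →
      HasTrace (semiCommutator t f g) (areaTerm f g + laplacianTerm t f g) := by
    intro t ht
    have h := hasTrace_semiCommutator ht hfs.norm_sub_le hgs.norm_sub_le
    have h0 := traceDefect_eq_zero ht hf hg
    rw [traceDefect] at h0
    have e : -hankelPairing ht f g = areaTerm f g + laplacianTerm t f g := by
      linear_combination -h0
    rwa [e] at h
  have hlim := tendsto_laplacianTerm hfs hgs
  refine ⟨fun t ht s hs => rhoKernel_pos ht hs, ?_, fun t ht => ⟨?_, htrace t ht⟩, ?_, hlim⟩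
  · rw [funext (areaCoeff_wedgeForm f g)]
    exact (integrableOn_delForm_mul_delbarForm hfs hgs).const_mul _
  · have h := integrable_laplacianIntegrand ht hfs hgs
    rwa [Measure.prod_restrict, ← Measure.volume_eq_prod] at h
  · have h := hlim.const_add (areaTerm f g)
    rw [add_zero] at h
    refine h.congr' ?_
    filter_upwards [eventually_gt_atTop (-1 : ℝ)] with t ht
    exact (htrace t ht).opTrace_eq.symm
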